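/- Let $\mathbb{R}^m_r$ be $\mathbb{R}^m$ with $\langle u,v\rangle_r = -\sum_{i\le r}u_iv_i+\sum_{i>r}u_iv_i$. For $N\ge 2$ and $0\le s\le N$ let $N^N_s(\kappa)$ denote the pseudo-Riemannian space form $\mathbb{R}^N_s$ ($\kappa=0$), $S^N_s=\{p\in\mathbb{R}^{N+1}_s:\langle p,p\rangle_s=1\}$ ($\kappa=1$; with $p_{N+1}>0$ if $s=N$) or $H^N_s=\{p\in\mathbb{R}^{N+1}_{s+1}:\langle p,p\rangle_{s+1}=-1\}$ ($\kappa=-1$; with $p_1>0$ if $s=0$), with Levi-Civita connection $\bar\nabla$. Let $n\ge 1$, $0\le s\le n+1$, and let $M$ be a connected smooth $n$-dimensional manifold, smoothly immersed in $N^{n+1}_s(\kappa)$ as a hypersurface whose induced metric $\langle\cdot,\cdot\rangle$ is non-degenerate, with a smooth normal vector field $\xi$ on $M$ satisfying $\langle\xi,\xi\rangle=\pm1$. Let $A_x u=-\bar\nabla_u\xi$ $(u\in T_xM)$ be the shape operator. *Petrov normal forms.* Let $J_m(c)$ be the $m\times m$ Jordan block with $c$ on the diagonal and $1$ above it, and let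 $E^{\mathfrak a}_m$ be the $m\times m$ matrix with ones on the anti-diagonal and zeros elsewhere. For $\beta>0$ let $C_m(\alpha,\beta)$ be the $2m\times 2m$ matrix with the $2\times2$ blocks $\begin{pmatrix}\alpha&-\beta\\ \beta&\alpha\end{pmatrix}$ on the diagonal, the blocks $E_2$ directly above it and zeros elsewhere, and let $\widehat{\mathcal E}_m$ be the $2m\times2m$ matrix with the blocks $\begin{pmatrix}-1&0\\0&1\end{pmatrix}$ on the block anti-diagonal and zeros elsewhere. A Petrov normal form is a pair of real matrices $$\Bigl(\bigoplus_{i=1}^a\bigoplus_{k=1}^{s_i}J_{m_{i,k}}(\lambda_i)\oplus\bigoplus_{j=1}^b\bigoplus_{l=1}^{t_j}C_{n_{j,l}}(\alpha_j,\beta_j),\ \ \bigoplus_{i=1}^a\bigoplus_{k=1}^{s_i}\epsilon(i,k)E^{\mathfrak a}_{m_{i,k}}\oplus\bigoplus_{j=1}^b\bigoplus_{l=1}^{t_j}\widehat{\mathcal E}_{n_{j,l}}\Bigr)$$ with $a,b\ge0$, $s_i,t_j,m_{i,k},n_{j,l}\ge1$, distinct $\lambda_i\in\mathbb{R}$, distinct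 $\alpha_j+\beta_j\sqrt{-1}$ with $\beta_j>0$, $m_{i,k}$ non-decreasing in $k$, $n_{j,l}$ non-decreasing in $l$, and signs $\epsilon(i,k)\in\{1,-1\}$ such that $\epsilon(i,k_1)\ge\epsilon(i,k_2)$ whenever $k_1\le k_2$ and $m_{i,k_1}=m_{i,k_2}$. It is a Petrov normal form of $(T,B)$, for an endomorphism $T$ and a symmetric bilinear form $B$ of a real vector space, if in some basis $T$ and $B$ have these two matrices. Its algebraic type consists of the multiset of pairs $(m_{i,k},\epsilon(i,k))$ and the multiset of the $n_{j,l}$. Suppose that the Jordan normal form of $A$ is constant on $M$, i.e. one and the same Jordan matrix (eigenvalues and block sizes) is the Jordan normal form of the complexification of $A_x$ for all $x\in M$. Then: 1. every $x\in M$ has an open neighbourhood $U_x$ with a smooth local frame $\{e_i\}$ of $TM$ on $U_x$ and a Petrov normal form $(P,G)$ such that at every $y\in U_x$ the matrix of $A_y$ with respect to $\{e_i(y)\}$ is $P$ and $(\langle e_i(y),e_j(y)\rangle)=G$; 2. all Petrov normal forms of $(A_x,\langle\cdot,\cdot\rangle_x)$, for all $x\in M$, have one and the same algebraic type; moreover they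 all have the same blocks: the multiset of the triples $(\lambda_i,m_{i,k},\epsilon(i,k))$ and the multiset of the pairs $(\alpha_j+\beta_j\sqrt{-1},n_{j,l})$ are the same for all of them. -/

import Mathlib

open scoped Manifold ContDiff TensorProduct

noncomputable section

/-! ### Pseudo-Riemannian space forms -/

/-- The pseudo-inner product `⟨u, v⟩_r = ᵗu ((-E_r) ⊕ E_{m-r}) v` on `ℝ^m_r`. -/
def pseudoInner (m r : ℕ) : LinearMap.BilinForm ℝ (Fin m → ℝ) :=
  Matrix.toBilin' (Matrix.diagonal fun i : Fin m => if (i : ℕ) < r then (-1 : ℝ) else 1)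

/-- The three families of pseudo-Riemannian space forms: `ℝ^N_s`, `S^N_s`, `H^N_s`. -/
inductive SpaceFormKind
  | pseudoEuclidean
  | pseudoSphere
  | pseudoHyperbolic

namespace SpaceFormKind

/-- The constant curvature `κ` of the space form. -/
def curvature : SpaceFormKind → ℝ
  | pseudoEuclidean => 0
  | pseudoSphere => 1
  | pseudoHyperbolic => -1

/-- The dimension of the pseudo-Euclidean space in which the `N`-dimensional space form lies. -/
@[reducible] def ambientDim : SpaceFormKind → ℕ → ℕ
  | pseudoEuclidean, N => N
  | pseudoSphere, N => N + 1
  | pseudoHyperbolic, N => N + 1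

/-- The index of the pseudo-Euclidean space in which the space form of index `s` lies. -/
def ambientIndex : SpaceFormKind → ℕ → ℕ
  | pseudoEuclidean, s => s
  | pseudoSphere, s => s
  | pseudoHyperbolic, s => s + 1

/-- The vector space underlying the ambient pseudo-Euclidean space. -/
abbrev Ambient (K : SpaceFormKind) (N : ℕ) : Type := Fin (K.ambientDim N) → ℝ

/-- The pseudo-inner product of the ambient pseudo-Euclidean space. -/
def inner (K : SpaceFormKind) (N s : ℕ) : LinearMap.BilinForm ℝ (K.Ambient N) :=
  pseudoInner (K.ambientDim N) (K.ambientIndex s)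

/-- The space form `N^N_s(κ)` as a subset of its ambient space. For `S^N_N` and `H^N_0`, where the
quadric has two components, one of them is selected. -/
def carrier : (K : SpaceFormKind) → (N s : ℕ) → Set (K.Ambient N)
  | pseudoEuclidean, _, _ => Set.univ
  | pseudoSphere, N, s =>
      {p : Fin (N + 1) → ℝ | pseudoInner (N + 1) s p p = 1 ∧ (s = N → 0 < p (Fin.last N))}
  | pseudoHyperbolic, N, s =>
      {p : Fin (N + 1) → ℝ | pseudoInner (N + 1) (s + 1) p p = -1 ∧ (s = 0 → 0 < p 0)}

/-- The tangent space of the space form at `p`: the whole space for `ℝ^N_s`, and `p^⊥` for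
the quadrics. -/
def tangentSpaceAt (K : SpaceFormKind) (N s : ℕ) (p : K.Ambient N) : Submodule ℝ (K.Ambient N) :=
  LinearMap.ker (K.curvature • K.inner N s p)

/-- The orthogonal projection `w ↦ w - κ ⟨p, w⟩ p` of the ambient space onto the tangent space at a
point `p` of the space form (recall `⟨p, p⟩ = κ` on the quadrics). -/
def tangentProj (K : SpaceFormKind) (N s : ℕ) (p : K.Ambient N) :
    K.Ambient N →ₗ[ℝ] K.Ambient N :=
  LinearMap.id - (K.curvature • K.inner N s p).smulRight p

end SpaceFormKind

/-! ### Hypersurfaces, induced metric, shape operator -/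

/-- A smooth non-degenerate (immersed) hypersurface `M` of dimension `n` in the space form
`N^{n+1}_s(κ)`, with a smooth unit normal vector field `ξ`. Maps into the space form, and vector
fields along them, are regarded as maps into the ambient pseudo-Euclidean space. -/
structure NondegHypersurface (K : SpaceFormKind) (n s : ℕ) (M : Type*) [TopologicalSpace M]
    [ChartedSpace (EuclideanSpace ℝ (Fin n)) M] where
  /-- The immersion `ι : M → N^{n+1}_s(κ)`. -/
  incl : M → K.Ambient (n + 1)
  /-- The unit normal field `ξ`. -/
  normal : M → K.Ambient (n + 1)
  contMDiff_incl : ContMDiff (𝓡 n) 𝓘(ℝ, K.Ambient (n + 1)) ∞ incl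
  contMDiff_normal : ContMDiff (𝓡 n) 𝓘(ℝ, K.Ambient (n + 1)) ∞ normal
  incl_mem : ∀ x, incl x ∈ K.carrier (n + 1) s
  immersion : ∀ x, Function.Injective (mvfderiv (𝓡 n) incl x)
  nondegenerate : ∀ (x : M) (u : TangentSpace (𝓡 n) x),
    (∀ v : TangentSpace (𝓡 n) x,
      K.inner (n + 1) s (mvfderiv (𝓡 n) incl x u) (mvfderiv (𝓡 n) incl x v) = 0) → u = 0
  normal_mem : ∀ x, normal x ∈ K.tangentSpaceAt (n + 1) s (incl x)
  normal_orthogonal : ∀ (x : M) (u : TangentSpace (𝓡 n) x),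
    K.inner (n + 1) s (normal x) (mvfderiv (𝓡 n) incl x u) = 0
  normal_unit : ∀ x, K.inner (n + 1) s (normal x) (normal x) = 1 ∨
    K.inner (n + 1) s (normal x) (normal x) = -1

namespace NondegHypersurface

variable {K : SpaceFormKind} {n s : ℕ} {M : Type*} [TopologicalSpace M]
  [ChartedSpace (EuclideanSpace ℝ (Fin n)) M] (S : NondegHypersurface K n s M)

/-- The differential of the immersion. -/
def dincl (x : M) : TangentSpace (𝓡 n) x →ₗ[ℝ] K.Ambient (n + 1) :=
  (mvfderiv (𝓡 n) S.incl x).toLinearMap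

/-- The induced metric on `T_x M`. -/
def metric (x : M) : LinearMap.BilinForm ℝ (TangentSpace (𝓡 n) x) :=
  (K.inner (n + 1) s).comp (S.dincl x) (S.dincl x)

/-- `u ↦ ∇̄_u ξ` for the Levi-Civita connection `∇̄` of the space form: the component tangent to
the space form of the flat derivative of `ξ` in the ambient pseudo-Euclidean space. -/
def nablaNormal (x : M) : TangentSpace (𝓡 n) x →ₗ[ℝ] K.Ambient (n + 1) :=
  K.tangentProj (n + 1) s (S.incl x) ∘ₗ (mvfderiv (𝓡 n) S.normal x).toLinearMap

/-- The shape operator `A_x u = -∇̄_u ξ` as an endomorphism of `T_x M`: the vector `-∇̄_u ξ`, which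
is tangent to `M`, is pulled back to `T_x M` by the inverse of the injective differential. -/
def shapeOperator (x : M) : TangentSpace (𝓡 n) x →ₗ[ℝ] TangentSpace (𝓡 n) x :=
  (S.dincl x).leftInverse ∘ₗ (-S.nablaNormal x)

/-! The vector `-∇̄_u ξ` is tangent to `M`, so that the shape operator does satisfy `A u = -∇̄_u ξ`. -/

theorem inner_comm (N : ℕ) (u v : K.Ambient N) : K.inner N s u v = K.inner N s v u := by
  simp only [SpaceFormKind.inner, pseudoInner, Matrix.toBilin'_apply, Matrix.diagonal_apply]
  simp only [mul_ite, mul_zero, ite_mul, zero_mul, Finset.sum_ite_eq, Finset.mem_univ, if_true]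
  refine Finset.sum_congr rfl fun i _ => ?_
  split_ifs <;> ring

theorem inner_deriv_of_unit (φ : M → K.Ambient (n+1))
    (hφ : ContMDiff (𝓡 n) 𝓘(ℝ, K.Ambient (n + 1)) ∞ φ)
    (hu : ∀ x, K.inner (n + 1) s (φ x) (φ x) = 1 ∨ K.inner (n + 1) s (φ x) (φ x) = -1)
    (x : M) (u : TangentSpace (𝓡 n) x) :
    K.inner (n + 1) s (φ x) (mvfderiv (𝓡 n) φ x u) = 0 := by
  set B := K.inner (n + 1) s
  have hB : ContDiff ℝ ∞ fun v : K.Ambient (n+1) => B v v := by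
    have : (fun v : K.Ambient (n+1) => B v v) = fun v => ∑ i, ∑ j, v i * (Matrix.diagonal fun i : Fin (K.ambientDim (n+1)) => if (i : ℕ) < (K.ambientIndex s) then (-1 : ℝ) else 1) i j * v j := by
      funext v; simp only [B, SpaceFormKind.inner, pseudoInner, Matrix.toBilin'_apply]
    rw [this]; fun_prop
  set g : M → ℝ := fun y => B (φ y) (φ y)
  have hg : Continuous g := hB.continuous.comp hφ.continuous
  have hloc : g =ᶠ[nhds x] fun _ => g x := by
    rcases hu x with h | h
    · have : {y | (0:ℝ) < g y} ∈ nhds x := (isOpen_lt continuous_const hg).mem_nhds (by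
        show (0:ℝ) < g x; simp only [g, B]; rw [h]; norm_num)
      filter_upwards [this] with y hy
      rcases hu y with h' | h'
      · simp only [g, B]; rw [h, h']
      · simp only [g, B] at hy; rw [h'] at hy; norm_num at hy
    · have : {y | g y < 0} ∈ nhds x := (isOpen_lt hg continuous_const).mem_nhds (by
        show g x < 0; simp only [g, B]; rw [h]; norm_num)
      filter_upwards [this] with y hy
      rcases hu y with h' | h'
      · simp only [g, B] at hy; rw [h'] at hy; norm_num at hy
      · simp only [g, B]; rw [h, h']
  have h0 : mfderiv (𝓡 n) 𝓘(ℝ, ℝ) g x = 0 := by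
    rw [hloc.mfderiv_eq]; exact mfderiv_const
  have hd : MDifferentiableAt (𝓡 n) 𝓘(ℝ, K.Ambient (n+1)) φ x :=
    hφ.mdifferentiableAt (by simp)
  let Bc : K.Ambient (n+1) →L[ℝ] K.Ambient (n+1) →L[ℝ] ℝ :=
    LinearMap.toContinuousLinearMap ((LinearMap.toContinuousLinearMap).toLinearMap ∘ₗ B)
  have hq : HasFDerivAt (fun v : K.Ambient (n+1) => B v v)
      ((Bc (φ x)) + (Bc.flip (φ x))) (φ x) := by
    have := Bc.hasFDerivAt_of_bilinear (hasFDerivAt_id (φ x)) (hasFDerivAt_id (φ x))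
    convert this using 1
    all_goals ext v; simp [Bc]
  have hcomp : mfderiv (𝓡 n) 𝓘(ℝ, ℝ) g x
      = (((Bc (φ x)) + (Bc.flip (φ x)))).comp (mfderiv (𝓡 n) 𝓘(ℝ, K.Ambient (n+1)) φ x) :=
    (hq.hasMFDerivAt.comp x hd.hasMFDerivAt).mfderiv
  rw [h0] at hcomp
  have := congrArg (fun L => L u) hcomp
  have h2 : (0:ℝ) = B (φ x) (mvfderiv (𝓡 n) φ x u) + B (mvfderiv (𝓡 n) φ x u) (φ x) := this
  have hs : B (mvfderiv (𝓡 n) φ x u) (φ x) = B (φ x) (mvfderiv (𝓡 n) φ x u) := inner_comm _ _ _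
  linarith

theorem inner_normal_deriv (x : M) (u : TangentSpace (𝓡 n) x) :
    K.inner (n + 1) s (S.normal x) (mvfderiv (𝓡 n) S.normal x u) = 0 :=
  inner_deriv_of_unit _ S.contMDiff_normal S.normal_unit x u

theorem curv_self (x : M) : K.curvature = 0 ∨ (K.curvature * K.curvature = 1 ∧
    K.inner (n+1) s (S.incl x) (S.incl x) = K.curvature ∧ K.ambientDim (n+1) = n + 2) := by
  have h := S.incl_mem x
  cases K
  · left; rfl
  · right; exact ⟨by norm_num [SpaceFormKind.curvature], h.1, rfl⟩
  · right; exact ⟨by norm_num [SpaceFormKind.curvature], h.1, rfl⟩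

theorem tangent_mem (x : M) (w : K.Ambient (n+1))
    (h1 : K.inner (n+1) s (S.normal x) w = 0)
    (h2 : K.curvature * K.inner (n+1) s (S.incl x) w = 0) : w ∈ LinearMap.range (S.dincl x) := by
  have hinj : LinearMap.ker (S.dincl x) = ⊥ := LinearMap.ker_eq_bot.2 (S.immersion x)
  have hr : Module.finrank ℝ (LinearMap.range (S.dincl x)) = n := by
    rw [LinearMap.finrank_range_of_inj (f := S.dincl x) (S.immersion x)]
    show Module.finrank ℝ (EuclideanSpace ℝ (Fin n)) = n
    simp
  set B := K.inner (n+1) s with hBdef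
  have hξ : B (S.normal x) (S.normal x) ≠ 0 := by
    rcases S.normal_unit x with h | h <;> (rw [h]; norm_num)
  rcases S.curv_self x with hk | ⟨hk, hf, hdim⟩
  · have hd : K.ambientDim (n+1) = n + 1 := by
      cases K
      · rfl
      · simp [SpaceFormKind.curvature] at hk
      · simp [SpaceFormKind.curvature] at hk
    have hle : LinearMap.range (S.dincl x) ≤ LinearMap.ker (B (S.normal x)) := by
      rintro _ ⟨u, rfl⟩; exact S.normal_orthogonal x u
    have hfr := LinearMap.finrank_range_add_finrank_ker (B (S.normal x))
    have hsurj : LinearMap.range (B (S.normal x)) = ⊤ := by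
      apply LinearMap.range_eq_top.2
      apply LinearMap.surjective
      intro h; apply hξ; rw [h]; rfl
    rw [hsurj] at hfr
    simp [hd] at hfr
    have : LinearMap.range (S.dincl x) = LinearMap.ker (B (S.normal x)) :=
      Submodule.eq_of_le_of_finrank_eq hle (by rw [hr]; omega)
    rw [this]; exact h1
  · have hk0 : K.curvature ≠ 0 := by intro h; rw [h] at hk; norm_num at hk
    have hfξ : B (S.incl x) (S.normal x) = 0 := by
      have := S.normal_mem x
      simp only [SpaceFormKind.tangentSpaceAt, LinearMap.mem_ker, LinearMap.smul_apply, smul_eq_mul, mul_eq_zero, hk0, false_or] at this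
      exact this
    have hξf : B (S.normal x) (S.incl x) = 0 := by rw [← hfξ]; exact inner_comm _ _ _
    let Φ := (B (S.normal x)).prod (B (S.incl x))
    have htan : ∀ u, B (S.incl x) (S.dincl x u) = 0 := by
      intro u
      refine inner_deriv_of_unit S.incl S.contMDiff_incl (fun y => ?_) x u
      rcases S.curv_self y with h | ⟨h, h', -⟩
      · exact absurd h hk0
      · rw [h']; exact mul_self_eq_one_iff.1 h
    have hle : LinearMap.range (S.dincl x) ≤ LinearMap.ker Φ := by
      rintro _ ⟨u, rfl⟩
      exact Prod.ext (S.normal_orthogonal x u) (htan u)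
    have hfr := LinearMap.finrank_range_add_finrank_ker Φ
    have hsurj : LinearMap.range Φ = ⊤ := by
      apply LinearMap.range_eq_top.2
      rintro ⟨p, q⟩
      refine ⟨(p / B (S.normal x) (S.normal x)) • S.normal x + (q / K.curvature) • S.incl x, ?_⟩
      have hf' : B (S.incl x) (S.incl x) = K.curvature := hf
      apply Prod.ext
      · simp [Φ, hξf, hξ]
      · simp [Φ, hfξ, hf', hk0]
    rw [hsurj] at hfr
    simp [hdim] at hfr
    have : LinearMap.range (S.dincl x) = LinearMap.ker Φ :=
      Submodule.eq_of_le_of_finrank_eq hle (by rw [hr]; omega)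
    rw [this]
    exact Prod.ext h1 (show B (S.incl x) w = 0 by simpa [hk0] using h2)

/-- The defining equation of the shape operator. -/
theorem dincl_shapeOperator (x : M) (u : TangentSpace (𝓡 n) x) :
    S.dincl x (S.shapeOperator x u) = -S.nablaNormal x u := by
  have hm : -S.nablaNormal x u ∈ LinearMap.range (S.dincl x) := by
    apply Submodule.neg_mem
    have hκ : K.curvature * K.inner (n+1) s (S.incl x) (S.normal x) = 0 := S.normal_mem x
    have hsym : K.inner (n+1) s (S.normal x) (S.incl x) = K.inner (n+1) s (S.incl x) (S.normal x) := inner_comm _ _ _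
    have hw : S.nablaNormal x u = mvfderiv (𝓡 n) S.normal x u - (K.curvature * K.inner (n+1) s (S.incl x) (mvfderiv (𝓡 n) S.normal x u)) • S.incl x := rfl
    apply S.tangent_mem
    · rw [hw, map_sub, map_smul, S.inner_normal_deriv, hsym, smul_eq_mul]
      linear_combination (-K.inner (n+1) s (S.incl x) (mvfderiv (𝓡 n) S.normal x u)) * hκ
    · rw [hw, map_sub, map_smul, smul_eq_mul]
      rcases S.curv_self x with hk | ⟨hk, hf, -⟩
      · rw [hk]; ring
      · rw [hf]; linear_combination (-K.curvature * K.inner (n+1) s (S.incl x) (mvfderiv (𝓡 n) S.normal x u)) * hk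
  obtain ⟨v, hv⟩ := hm
  show S.dincl x ((S.dincl x).leftInverse (-S.nablaNormal x u)) = _
  rw [← hv, LinearMap.leftInverse_apply_of_inj (f := S.dincl x) (LinearMap.ker_eq_bot.2 (S.immersion x))]

end NondegHypersurface

/-! ### Jordan normal forms of real endomorphisms -/

/-- The data of the Jordan normal form of a real endomorphism: the distinct real eigenvalues
`λ_i`, the distinct complex eigenvalues `α_j + β_j √-1` with positive imaginary part, and for each of
them the non-decreasing sequence of sizes of its Jordan blocks. -/
structure JordanData where
  a : ℕ
  b : ℕ
  lam : Fin a → ℝ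
  alpha : Fin b → ℝ
  beta : Fin b → ℝ
  s : Fin a → ℕ
  t : Fin b → ℕ
  m : (i : Fin a) → Fin (s i) → ℕ
  n : (j : Fin b) → Fin (t j) → ℕ
  lam_injective : Function.Injective lam
  beta_pos : ∀ j, 0 < beta j
  alpha_beta_injective : Function.Injective fun j => (alpha j, beta j)
  s_pos : ∀ i, 0 < s i
  t_pos : ∀ j, 0 < t j
  m_pos : ∀ i k, 0 < m i k
  n_pos : ∀ j l, 0 < n j l
  m_mono : ∀ i, Monotone (m i)
  n_mono : ∀ j, Monotone (n j)

/-- The Jordan block `J_m(c)`, with ones above the diagonal. -/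
def jordanBlock {R : Type*} [Zero R] [One R] (m : ℕ) (c : R) : Matrix (Fin m) (Fin m) R :=
  Matrix.of fun p q => if p = q then c else if (p : ℕ) + 1 = q then 1 else 0

namespace JordanData

/-- Positions in the real part: eigenvalue, block, position inside the block. -/
abbrev RealIndex (D : JordanData) : Type := Σ i : Fin D.a, Σ k : Fin (D.s i), Fin (D.m i k)

/-- Positions in the blocks of the `j`-th complex eigenvalue. -/
abbrev ComplexIndex (D : JordanData) (j : Fin D.b) : Type := Σ l : Fin (D.t j), Fin (D.n j l)

/-- Positions in the Jordan matrix. -/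
abbrev Index (D : JordanData) : Type :=
  D.RealIndex ⊕ (Σ j : Fin D.b, D.ComplexIndex j ⊕ D.ComplexIndex j)

/-- The Jordan matrix `J`: the direct sum of the blocks `J_{m_{i,k}}(λ_i)` and, for each `j`,
of the blocks `J_{n_{j,l}}(α_j + β_j √-1)` followed by the blocks `J_{n_{j,l}}(α_j - β_j √-1)`. -/
def matrix (D : JordanData) : Matrix D.Index D.Index ℂ :=
  Matrix.fromBlocks
    (Matrix.blockDiagonal' fun i => Matrix.blockDiagonal' fun k =>
      jordanBlock (D.m i k) (D.lam i : ℂ))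
    0 0
    (Matrix.blockDiagonal' fun j => Matrix.fromBlocks
      (Matrix.blockDiagonal' fun l =>
        jordanBlock (D.n j l) ((D.alpha j : ℂ) + (D.beta j : ℂ) * Complex.I))
      0 0
      (Matrix.blockDiagonal' fun l =>
        jordanBlock (D.n j l) ((D.alpha j : ℂ) - (D.beta j : ℂ) * Complex.I)))

end JordanData

/-- `D` gives the Jordan normal form of `T`: in some basis of the complexification of `V`, the
matrix of the complexification of `T` is the Jordan matrix of `D`. -/
def HasJordanNormalForm {V : Type*} [AddCommGroup V] [Module ℝ V] (T : V →ₗ[ℝ] V)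
    (D : JordanData) : Prop :=
  ∃ b : Module.Basis D.Index ℂ (ℂ ⊗[ℝ] V), LinearMap.toMatrix b b (T.baseChange ℂ) = D.matrix

/-! ### Petrov normal forms -/

/-- The data of a Petrov normal form: Jordan data and a sign `ε(i, k)` for every block of a real
eigenvalue; among blocks of equal size of one eigenvalue the signs `1` come first. -/
structure PetrovData extends JordanData where
  eps : (i : Fin a) → Fin (s i) → ℤ
  eps_eq : ∀ i k, eps i k = 1 ∨ eps i k = -1
  eps_anti : ∀ i k₁ k₂, k₁ ≤ k₂ → m i k₁ = m i k₂ → eps i k₂ ≤ eps i k₁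

/-- The anti-diagonal matrix `E^𝔞_m` whose anti-diagonal entries are all `1`. -/
def antiDiagOne (m : ℕ) : Matrix (Fin m) (Fin m) ℝ :=
  Matrix.of fun p q => if q = p.rev then 1 else 0

/-- The `2n × 2n` block matrix with `C = !![α, -β; β, α]` on the diagonal and `E_2` above it;
the position `(p, i)` is the `i`-th one in the `p`-th `2 × 2` block. -/
def complexBlock (n : ℕ) (α β : ℝ) : Matrix (Fin n × Fin 2) (Fin n × Fin 2) ℝ :=
  Matrix.of fun p q =>
    if p.1 = q.1 then (!![α, -β; β, α] : Matrix (Fin 2) (Fin 2) ℝ) p.2 q.2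
    else if (p.1 : ℕ) + 1 = q.1 then (1 : Matrix (Fin 2) (Fin 2) ℝ) p.2 q.2
    else 0

/-- The `2n × 2n` block matrix with the blocks `!![-1, 0; 0, 1]` on the anti-diagonal. -/
def complexFormBlock (n : ℕ) : Matrix (Fin n × Fin 2) (Fin n × Fin 2) ℝ :=
  Matrix.of fun p q =>
    if q.1 = p.1.rev then (!![-1, 0; 0, 1] : Matrix (Fin 2) (Fin 2) ℝ) p.2 q.2 else 0

namespace PetrovData

/-- Positions in the matrices of a Petrov normal form. -/
abbrev FrameIndex (P : PetrovData) : Type :=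
  P.RealIndex ⊕ (Σ j : Fin P.b, Σ l : Fin (P.t j), Fin (P.n j l) × Fin 2)

/-- The matrix of the operator in Petrov normal form. -/
def opMatrix (P : PetrovData) : Matrix P.FrameIndex P.FrameIndex ℝ :=
  Matrix.fromBlocks
    (Matrix.blockDiagonal' fun i => Matrix.blockDiagonal' fun k =>
      jordanBlock (P.m i k) (P.lam i))
    0 0
    (Matrix.blockDiagonal' fun j => Matrix.blockDiagonal' fun l =>
      complexBlock (P.n j l) (P.alpha j) (P.beta j))

/-- The matrix of the bilinear form in Petrov normal form. -/
def formMatrix (P : PetrovData) : Matrix P.FrameIndex P.FrameIndex ℝ :=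
  Matrix.fromBlocks
    (Matrix.blockDiagonal' fun i => Matrix.blockDiagonal' fun k =>
      (P.eps i k : ℝ) • antiDiagOne (P.m i k))
    0 0
    (Matrix.blockDiagonal' fun j => Matrix.blockDiagonal' fun l =>
      complexFormBlock (P.n j l))

/-- The real blocks, each recorded as (eigenvalue, size, sign), as a multiset. -/
def realBlocks (P : PetrovData) : Multiset (ℝ × ℕ × ℤ) :=
  (Finset.univ : Finset (Σ i : Fin P.a, Fin (P.s i))).val.map
    fun q => (P.lam q.1, P.m q.1 q.2, P.eps q.1 q.2)

/-- The complex blocks, each recorded as (eigenvalue with positive imaginary part, size), as a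
multiset. -/
def complexBlocks (P : PetrovData) : Multiset (ℂ × ℕ) :=
  (Finset.univ : Finset (Σ j : Fin P.b, Fin (P.t j))).val.map
    fun q => (⟨P.alpha q.1, P.beta q.1⟩, P.n q.1 q.2)

/-- The algebraic type: the sizes and signs of the real blocks and the sizes of the complex
blocks, without the eigenvalues. -/
def algebraicType (P : PetrovData) : Multiset (ℕ × ℤ) × Multiset ℕ :=
  (P.realBlocks.map fun q => q.2, P.complexBlocks.map fun q => q.2)

end PetrovData

/-- In the basis `e`, the pair `(T, B)` is given by the matrices of the Petrov normal form `P`. -/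
def IsPetrovBasis {V : Type*} [AddCommGroup V] [Module ℝ V] (T : V →ₗ[ℝ] V)
    (B : LinearMap.BilinForm ℝ V) (P : PetrovData) (e : Module.Basis P.FrameIndex ℝ V) : Prop :=
  LinearMap.toMatrix e e T = P.opMatrix ∧ LinearMap.BilinForm.toMatrix e B = P.formMatrix

/-- `P` is a Petrov normal form of the pair `(T, B)`. -/
def HasPetrovNormalForm {V : Type*} [AddCommGroup V] [Module ℝ V] (T : V →ₗ[ℝ] V)
    (B : LinearMap.BilinForm ℝ V) (P : PetrovData) : Prop :=
  ∃ e : Module.Basis P.FrameIndex ℝ V, IsPetrovBasis T B P e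

end

/-! At a single point the statement is the classification of self-adjoint operators for an
indefinite form: a normal form exists (`exists_hasPetrovNormalForm`) and its blocks are unique
(`HasPetrovNormalForm.blocks_eq`). The geometric content is that a normal form at `x` spreads
smoothly to a neighbourhood.

Spreading. The shape operator is self-adjoint because the second derivatives of the immersion are
symmetric. A constant Jordan form makes every shape operator similar over ℝ to the normal form `P`
at `x`, so the linear equation `T X = X P` has a solution space of constant dimension, and the
solution at `x` extends to a smooth family `X`. This `X` need not carry the metric `G` to the normal
form `H`. The discrepancy `H⁻¹ Xᵗ G X` equals 1 at `x`, commutes with `P` and is self-adjoint for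
`H`; it therefore has a smooth square root `Q` with the last two properties, and `X Q⁻¹` is the
required frame (`exists_contDiffOn_normalizing_frame`). Together with uniqueness, the blocks, signs
included, are locally constant, hence constant on the connected `M`.

Existence. On a primary part, a vector `u` with `B(N^m u, u) ≠ 0`, for `N` nilpotent of index `m +
1`, is corrected to generate a chain on which `B` is anti-diagonal. Its span is non-degenerate, and
induction applies to the orthogonal complement. For a non-real eigenvalue, a polynomial `J` in `T`
with `J² = -1` makes the space complex, and the same construction is carried out over ℂ.

Uniqueness. Let `q` be the irreducible real polynomial of an eigenvalue. On `ker q(T)^k` the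
quadratic form `± B(q(T)^(k-1) u, u)` has as positive index the number of blocks with that
eigenvalue, size `k` and prescribed sign (no sign for non-real eigenvalues). The law of inertia
(`card_le_card_of_definite`) makes this number independent of the basis. -/

/-! ### Smooth dependence in linear algebra -/

section SmoothLinearAlgebra

open Module Topology

/-- A vector in the kernel of one member of a smooth family of linear maps extends to a smooth family
of vectors lying in the kernels of those members whose kernel has the same dimension. -/
theorem exists_contDiffOn_mem_ker {E W W' : Type*} [NormedAddCommGroup E] [NormedSpace ℝ E]
    [NormedAddCommGroup W] [NormedSpace ℝ W] [FiniteDimensional ℝ W]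
    [NormedAddCommGroup W'] [NormedSpace ℝ W'] [FiniteDimensional ℝ W']
    (L : E → W →L[ℝ] W') (hL : ContDiff ℝ ∞ L) (t₀ : E) (w₀ : W) (hw₀ : L t₀ w₀ = 0) :
    ∃ (O : Set E) (ξ : E → W), IsOpen O ∧ t₀ ∈ O ∧ ContDiffOn ℝ ∞ ξ O ∧ ξ t₀ = w₀ ∧
      ∀ t ∈ O, finrank ℝ (LinearMap.ker (L t).toLinearMap) =
        finrank ℝ (LinearMap.ker (L t₀).toLinearMap) → L t (ξ t) = 0 := by
  have : CompleteSpace W := FiniteDimensional.complete ℝ W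
  set R := LinearMap.range (L t₀).toLinearMap
  set N := LinearMap.ker (L t₀).toLinearMap
  obtain ⟨π', hπ'⟩ := R.subtype.exists_leftInverse_of_injective R.ker_subtype
  obtain ⟨p', hp'⟩ := N.subtype.exists_leftInverse_of_injective N.ker_subtype
  have hπ : ∀ r : R, π' r = r := fun r => LinearMap.congr_fun hπ' r
  have hp : ∀ r : N, p' r = r := fun r => LinearMap.congr_fun hp' r
  let π : W' →L[ℝ] R := LinearMap.toContinuousLinearMap π'
  let p : W →L[ℝ] N := LinearMap.toContinuousLinearMap p'
  -- `Φ t₀` is bijective, since `L t₀` is injective on a complement of its kernel and `p` detects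
  -- the kernel. Bijectivity is an open condition, and the sought family is the preimage of `(0,
  -- w₀)` under `Φ t`.
  let Φ : E → W →L[ℝ] (R × N) := fun t =>
    (ContinuousLinearMap.inl ℝ R N).comp (π.comp (L t)) + (ContinuousLinearMap.inr ℝ R N).comp p
  have hΦ : ContDiff ℝ ∞ Φ := by
    refine ContDiff.add ?_ contDiff_const
    exact contDiff_const.clm_comp (contDiff_const.clm_comp hL)
  have hΦa : ∀ t w, Φ t w = (π' (L t w), p' w) := fun t w => by
    simp [Φ, π, p]
  have hker : LinearMap.ker (Φ t₀).toLinearMap = ⊥ := by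
    refine LinearMap.ker_eq_bot'.2 fun w hw => ?_
    have h := (hΦa t₀ w).symm.trans hw
    have h1 : π' (L t₀ w) = 0 := congrArg Prod.fst h
    have h2 : p' w = 0 := congrArg Prod.snd h
    have h3 := hπ ⟨L t₀ w, ⟨w, rfl⟩⟩
    rw [show ((⟨L t₀ w, ⟨w, rfl⟩⟩ : R) : W') = L t₀ w from rfl, h1] at h3
    have h4 : L t₀ w = 0 := congrArg Subtype.val h3.symm
    have h5 := hp ⟨w, h4⟩
    rw [show ((⟨w, h4⟩ : N) : W) = w from rfl, h2] at h5
    exact congrArg Subtype.val h5.symm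
  have hfr : finrank ℝ W = finrank ℝ (R × N) := by
    rw [finrank_prod]; exact (LinearMap.finrank_range_add_finrank_ker (L t₀).toLinearMap).symm
  let e₀ : W ≃ₗ[ℝ] (R × N) :=
    LinearEquiv.ofInjectiveOfFinrankEq (Φ t₀).toLinearMap (LinearMap.ker_eq_bot.1 hker) hfr
  let e : W ≃L[ℝ] (R × N) := e₀.toContinuousLinearEquiv
  have he : (e : W →L[ℝ] (R × N)) = Φ t₀ := by
    ext1 w; rfl
  refine ⟨Φ ⁻¹' Set.range ((↑) : (W ≃L[ℝ] (R × N)) → W →L[ℝ] (R × N)),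
    fun t => ContinuousLinearMap.inverse (Φ t) (0, ⟨w₀, hw₀⟩),
    ContinuousLinearEquiv.isOpen.preimage hΦ.continuous, ⟨e, he⟩, ?_, ?_, ?_⟩
  · rintro t ⟨f, hf⟩
    have h1 : ContDiffAt ℝ ∞ (fun t => ContinuousLinearMap.inverse (Φ t)) t :=
      ContDiffAt.comp (g := ContinuousLinearMap.inverse) t
        (hf ▸ contDiffAt_map_inverse f) hΦ.contDiffAt
    exact (h1.clm_apply contDiffAt_const).contDiffWithinAt
  · show ContinuousLinearMap.inverse (Φ t₀) _ = w₀
    rw [← he, ContinuousLinearMap.inverse_equiv]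
    apply e.injective
    rw [ContinuousLinearEquiv.coe_coe, e.apply_symm_apply]
    have : e w₀ = Φ t₀ w₀ := rfl
    rw [this, hΦa, hw₀, map_zero]
    exact Prod.ext rfl (hp ⟨w₀, hw₀⟩).symm
  · rintro t ⟨f, hf⟩ hd
    set w := ContinuousLinearMap.inverse (Φ t) (0, ⟨w₀, hw₀⟩) with hw
    have hw' : Φ t w = (0, ⟨w₀, hw₀⟩) := by
      rw [hw, ← hf, ContinuousLinearMap.inverse_equiv]; simp
    have h1 : π' (L t w) = 0 := congrArg Prod.fst ((hΦa t w).symm.trans hw')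
    -- Surjectivity onto `R` gives the kernel of `π' ∘ L t` the dimension of `ker (L t₀)`. It
    -- contains `ker (L t)`, so the two coincide once the dimensions agree.
    have hsurj : LinearMap.range (π' ∘ₗ (L t).toLinearMap) = ⊤ := by
      refine LinearMap.range_eq_top.2 fun r => ?_
      refine ⟨f.symm (r, 0), ?_⟩
      have : Φ t (f.symm (r, 0)) = (r, 0) := by rw [← hf]; simp
      exact congrArg Prod.fst ((hΦa t _).symm.trans this)
    have hle : LinearMap.ker (L t).toLinearMap ≤ LinearMap.ker (π' ∘ₗ (L t).toLinearMap) :=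
      LinearMap.ker_le_ker_comp _ _
    have hfr' := LinearMap.finrank_range_add_finrank_ker (π' ∘ₗ (L t).toLinearMap)
    rw [hsurj, finrank_top] at hfr'
    have h0 := LinearMap.finrank_range_add_finrank_ker (L t₀).toLinearMap
    have heq := Submodule.eq_of_le_of_finrank_eq hle (by
      rw [hd]
      change finrank ℝ R + finrank ℝ N = _ at h0
      omega)
    have : w ∈ LinearMap.ker (L t).toLinearMap := by rw [heq]; exact h1
    exact this

/-- A smooth square root near `1` that preserves a given subspace closed under squaring. -/
theorem exists_contDiffOn_sqrt {A : Type*} [NormedRing A] [NormedAlgebra ℝ A]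
    [FiniteDimensional ℝ A] (W : Submodule ℝ A) (h1 : (1 : A) ∈ W)
    (hsq : ∀ a ∈ W, a * a ∈ W) :
    ∃ (O : Set A) (r : A → A), IsOpen O ∧ (1 : A) ∈ O ∧ ContDiffOn ℝ ∞ r O ∧ r 1 = 1 ∧
      (∀ a ∈ O, IsUnit (r a)) ∧ ∀ a ∈ O, a ∈ W → r a ∈ W ∧ r a * r a = a := by
  have : CompleteSpace A := FiniteDimensional.complete ℝ A
  have : CompleteSpace W := FiniteDimensional.complete ℝ W
  obtain ⟨p', hp'⟩ := W.subtype.exists_leftInverse_of_injective W.ker_subtype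
  have hp : ∀ r : W, p' r = r := fun r => LinearMap.congr_fun hp' r
  let p : A →L[ℝ] W := LinearMap.toContinuousLinearMap p'
  -- As `W` is closed under squaring, the projection changes nothing and `f` is the squaring map of
  -- `W`. Its derivative at 1 is multiplication by 2, so the inverse function theorem yields the
  -- root.
  let f : W → W := fun w => p ((w : A) * (w : A))
  have hfv : ∀ w : W, (f w : A) = w * w := fun w =>
    congrArg Subtype.val (hp ⟨(w : A) * w, hsq _ w.2⟩)
  let o : W := ⟨1, h1⟩
  -- Analyticity at a point persists on a neighbourhood, whereas for `∞` at a point the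
  -- neighbourhood may shrink with the order.
  have hf : ContDiff ℝ ω f := by
    refine p.contDiff.comp ?_
    exact (W.subtypeL.contDiff).mul W.subtypeL.contDiff
  let D : W ≃L[ℝ] W := ContinuousLinearEquiv.smulLeft (Units.mk0 (2 : ℝ) two_ne_zero)
  have hD : HasFDerivAt f (D : W →L[ℝ] W) o := by
    have h : HasFDerivAt (fun w : W => (w : A) * (w : A)) _ o :=
      HasFDerivAt.mul' (W.subtypeL.hasFDerivAt) (W.subtypeL.hasFDerivAt)
    have h2 := p.hasFDerivAt.comp o h
    refine h2.congr_fderiv ?_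
    ext1 w
    have : p' (w : A) = w := hp w
    simp [D, o, p, ContinuousLinearEquiv.smulLeft, two_smul, this]
  have hfa : ContDiffAt ℝ ω f o := hf.contDiffAt
  have hn : (ω : WithTop ℕ∞) ≠ 0 := by simp
  have hfo : f o = o := Subtype.ext (by rw [hfv]; simp [o])
  let g := hfa.localInverse hD hn
  have hg : ContDiffAt ℝ ω g o := by
    have := hfa.to_localInverse hD hn
    rwa [hfo] at this
  have hgo : g o = o := by
    have := hfa.localInverse_apply_image hD hn
    rwa [hfo] at this
  have hr : ∀ᶠ w in 𝓝 o, f (g w) = w := by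
    have := (hfa.hasStrictFDerivAt' hD hn).eventually_right_inverse
    rw [hfo] at this
    exact this
  have hp1 : p 1 = o := hp o
  have hev : ∀ᶠ w in 𝓝 o, ContDiffAt ℝ ω g w ∧ f (g w) = w ∧ IsUnit ((g w : W) : A) := by
    refine (hg.eventually (by simp)).and (hr.and ?_)
    have hc : ContinuousAt (fun w => ((g w : W) : A)) o :=
      continuous_subtype_val.continuousAt.comp hg.continuousAt
    refine hc.eventually (Units.isOpen.mem_nhds ?_)
    show IsUnit ((g o : W) : A)
    rw [hgo]; exact isUnit_one
  obtain ⟨O', hO', hO'o, hoO'⟩ := eventually_nhds_iff.1 hev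
  refine ⟨p ⁻¹' O', fun a => (g (p a) : A), hO'o.preimage p.continuous, ?_, ?_, ?_, ?_, ?_⟩
  · show p 1 ∈ O'
    rwa [hp1]
  · intro a ha
    have h2 : ContDiffAt ℝ ∞ g (p a) := (hO' _ ha).1.of_le (by simp)
    exact (W.subtypeL.contDiff.contDiffAt.comp a
      (h2.comp a p.contDiff.contDiffAt)).contDiffWithinAt
  · show ((g (p 1) : W) : A) = 1
    rw [hp1, hgo]
  · exact fun a ha => (hO' _ ha).2.2
  · intro a ha haW
    refine ⟨(g (p a)).2, ?_⟩
    show ((g (p a) : W) : A) * _ = a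
    rw [← hfv, (hO' _ ha).2.1]
    exact congrArg Subtype.val (hp ⟨a, haW⟩)

/-- Left multiplication by `Y` identifies the commutant of `P` with the solutions `Z` of `T Z = Z
P`. Hence the dimension of the solution space is the same for all `T` similar to `P`, as
`exists_contDiffOn_mem_ker` demands. -/
theorem finrank_ker_intertwiner {A : Type*} [Ring A] [Algebra ℝ A] (P T Y : A) (hY : IsUnit Y) (h : T * Y = Y * P) :
    finrank ℝ (LinearMap.ker (LinearMap.mulLeft ℝ T - LinearMap.mulRight ℝ P)) =
      finrank ℝ (LinearMap.ker (LinearMap.mulLeft ℝ P - LinearMap.mulRight ℝ P)) := by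
  obtain ⟨y, rfl⟩ := hY
  have h' : (↑y⁻¹ : A) * T = P * (↑y⁻¹ : A) := by
    rw [Units.inv_mul_eq_iff_eq_mul, ← mul_assoc, ← h, mul_assoc]; simp
  symm
  refine LinearEquiv.finrank_eq (LinearEquiv.ofLinearMap
    ((LinearMap.mulLeft ℝ (y : A)).restrict ?_)
    ((LinearMap.mulLeft ℝ (↑y⁻¹ : A)).restrict ?_) ?_ ?_)
  · intro Z hZ
    simp only [LinearMap.mem_ker, LinearMap.sub_apply, LinearMap.mulLeft_apply,
      LinearMap.mulRight_apply, sub_eq_zero] at hZ ⊢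
    rw [← mul_assoc, h, mul_assoc, hZ, mul_assoc]
  · intro Z hZ
    simp only [LinearMap.mem_ker, LinearMap.sub_apply, LinearMap.mulLeft_apply,
      LinearMap.mulRight_apply, sub_eq_zero] at hZ ⊢
    rw [← mul_assoc, ← h', mul_assoc, hZ, mul_assoc]
  · ext1 Z
    exact Subtype.ext (by simp)
  · ext1 Z
    exact Subtype.ext (by simp)

/-- In a finite-dimensional algebra with an anti-involution `θ`, such as the matrices with the
transposition: let `(P, H)` be the matrices of a pair (self-adjoint operator, non-degenerate form) in the frame
`X₀`. For the nearby pairs whose operator is similar to `P`, there is a frame, smooth in the pair, in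
which they have the same matrices `(P, H)`. -/
theorem exists_contDiffOn_normalizing_frame {A : Type*} [NormedRing A] [NormedAlgebra ℝ A]
    [FiniteDimensional ℝ A] (θ : A →ₗ[ℝ] A)
    (hθm : ∀ a b, θ (a * b) = θ b * θ a) (hθθ : ∀ a, θ (θ a) = a)
    (P H T₀ G₀ X₀ : A) (hH : IsUnit H)
    (hX₀ : IsUnit X₀) (hHs : θ H = H) (hHP : H * P = θ P * H)
    (hT₀ : T₀ * X₀ = X₀ * P) (hG₀ : θ X₀ * G₀ * X₀ = H) :
    ∃ (O : Set (A × A)) (F : A × A → A),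
      IsOpen O ∧ (T₀, G₀) ∈ O ∧ ContDiffOn ℝ ∞ F O ∧
      ∀ T G, (T, G) ∈ O → θ G = G → G * T = θ T * G →
        (∃ Y : A, IsUnit Y ∧ T * Y = Y * P) →
        IsUnit (F (T, G)) ∧ T * F (T, G) = F (T, G) * P ∧
          θ (F (T, G)) * G * F (T, G) = H := by
  have : CompleteSpace A := FiniteDimensional.complete ℝ A
  have hθ1 : θ 1 = 1 := by
    have h := hθm (θ 1) 1
    rwa [mul_one, hθθ, mul_one, eq_comm] at h
  let L : A → A →L[ℝ] A := fun T =>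
    ContinuousLinearMap.mul ℝ _ T - (ContinuousLinearMap.mul ℝ A).flip P
  have hLl : ∀ T, (L T).toLinearMap = LinearMap.mulLeft ℝ T - LinearMap.mulRight ℝ P := by
    intro T; ext1 Z; simp [L]
  have hL : ContDiff ℝ ∞ L :=
    (ContinuousLinearMap.mul ℝ A).contDiff.sub contDiff_const
  obtain ⟨O₁, X, hO₁, hT₀O₁, hX, hXT₀, hXk⟩ := exists_contDiffOn_mem_ker L hL T₀ X₀
    (by simp [L, hT₀])
  -- The elements commuting with `P` and self-adjoint for `H`. Products of two of them need not be
  -- self-adjoint, but squares are.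
  let W : Submodule ℝ A :=
    { carrier := {S | S * P = P * S ∧ θ S * H = H * S}
      add_mem' := by
        rintro a b ⟨h1, h2⟩ ⟨h3, h4⟩
        exact ⟨by rw [add_mul, mul_add, h1, h3],
          by rw [map_add, add_mul, mul_add, h2, h4]⟩
      zero_mem' := ⟨by simp, by simp⟩
      smul_mem' := by
        rintro c a ⟨h1, h2⟩
        exact ⟨by rw [smul_mul_assoc, mul_smul_comm, h1],
          by rw [map_smul, smul_mul_assoc, mul_smul_comm, h2]⟩ }
  obtain ⟨O₂, r, hO₂, h1O₂, hr, hr1, hru, hrW⟩ := exists_contDiffOn_sqrt W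
    ⟨by simp, by simp [hθ1]⟩ (by
      rintro a ⟨h1, h2⟩
      refine ⟨by rw [mul_assoc, h1, ← mul_assoc, h1, mul_assoc], ?_⟩
      rw [hθm, mul_assoc, h2, ← mul_assoc, h2, mul_assoc])
  let τ : A →L[ℝ] A :=
    LinearMap.toContinuousLinearMap θ
  have hτ : ∀ Z, τ Z = θ Z := fun Z => rfl
  -- The discrepancy between the form in the frame `X` and `H`; it is 1 at `(T₀, G₀)`.
  let σ : A × A → A := fun q =>
    Ring.inverse H * (τ (X q.1) * q.2 * X q.1)
  obtain ⟨η, rfl⟩ := hH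
  have hO₁' : IsOpen (O₁ ∩ X ⁻¹' {Z | IsUnit Z}) :=
    hX.continuousOn.isOpen_inter_preimage hO₁ Units.isOpen
  have hXf : ContDiffOn ℝ ∞ (fun q : A × A => X q.1)
      ((O₁ ∩ X ⁻¹' {Z | IsUnit Z}) ×ˢ Set.univ) :=
    hX.comp contDiff_fst.contDiffOn fun q hq => hq.1.1
  have hσ : ContDiffOn ℝ ∞ σ ((O₁ ∩ X ⁻¹' {Z | IsUnit Z}) ×ˢ Set.univ) := by
    refine contDiffOn_const.mul (((τ.contDiff.comp_contDiffOn hXf).mul ?_).mul hXf)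
    exact contDiff_snd.contDiffOn
  refine ⟨((O₁ ∩ X ⁻¹' {Z | IsUnit Z}) ×ˢ Set.univ) ∩ σ ⁻¹' O₂,
    fun q => X q.1 * Ring.inverse (r (σ q)),
    hσ.continuousOn.isOpen_inter_preimage (hO₁'.prod isOpen_univ) hO₂, ?_, ?_, ?_⟩
  · refine ⟨⟨⟨hT₀O₁, ?_⟩, trivial⟩, ?_⟩
    · show IsUnit (X T₀)
      rwa [hXT₀]
    · show Ring.inverse _ * (τ (X T₀) * G₀ * X T₀) ∈ O₂
      rw [hτ, hXT₀, hG₀, Ring.inverse_mul_cancel _ η.isUnit]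
      exact h1O₂
  · refine (hXf.mono Set.inter_subset_left).mul ?_
    intro q hq
    obtain ⟨u, hu⟩ := hru _ hq.2
    refine ContDiffAt.comp_contDiffWithinAt q (g := Ring.inverse) ?_ ?_
    · rw [← hu]; exact contDiffAt_ringInverse ℝ u
    · exact (hr.comp (hσ.mono Set.inter_subset_left) fun q hq => hq.2) q hq
  · rintro T G ⟨⟨⟨hT1, hT2⟩, -⟩, hS⟩ hG hGT ⟨Y, hY, hTY⟩
    have hXT : T * X T = X T * P := by
      have := hXk T hT1 (by
        rw [hLl, hLl, finrank_ker_intertwiner P T Y hY hTY,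
          finrank_ker_intertwiner P T₀ X₀ hX₀ hT₀])
      simpa [L, sub_eq_zero] using this
    have hη : (η : A) * ↑η⁻¹ = 1 := by simp
    set G' := θ (X T) * G * X T with hG'
    have hSd : σ (T, G) = (↑η⁻¹ : A) * G' := by
      show Ring.inverse _ * _ = _
      rw [Ring.inverse_unit]; rfl
    have hG's : θ G' = G' := by
      simp only [hG', hθm, hθθ, hG, mul_assoc]
    have hηS : (η : A) * σ (T, G) = G' := by
      rw [hSd, ← mul_assoc, hη, one_mul]
    have hηP : (↑η⁻¹ : A) * θ P = P * (↑η⁻¹ : A) := by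
      rw [Units.inv_mul_eq_iff_eq_mul, ← mul_assoc, hHP, mul_assoc]; simp
    have hG'P : G' * P = θ P * G' := by
      calc G' * P = θ (X T) * (G * (X T * P)) := by simp only [hG', mul_assoc]
        _ = θ (X T) * ((G * T) * X T) := by rw [← hXT, mul_assoc]
        _ = θ (T * X T) * G * X T := by
            rw [hGT, hθm]; simp only [mul_assoc]
        _ = θ P * G' := by
            rw [hXT, hθm]; simp only [hG', mul_assoc]
    have hSW : σ (T, G) ∈ W := by
      constructor
      · rw [hSd, mul_assoc, hG'P, ← mul_assoc, hηP, mul_assoc]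
      · calc θ (σ (T, G)) * η = θ (σ (T, G)) * θ η := by rw [hHs]
          _ = θ (η * σ (T, G)) := (hθm _ _).symm
          _ = η * σ (T, G) := by rw [hηS, hG's]
    obtain ⟨⟨hQP, hQH⟩, hQQ⟩ := hrW _ hS hSW
    obtain ⟨q, hq⟩ := hru _ hS
    show IsUnit (X T * Ring.inverse (r (σ (T, G)))) ∧ T * (X T * Ring.inverse (r (σ (T, G)))) =
      (X T * Ring.inverse (r (σ (T, G)))) * P ∧
      θ (X T * Ring.inverse (r (σ (T, G)))) * G * (X T * Ring.inverse (r (σ (T, G)))) = _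
    rw [← hq] at hQP hQH hQQ ⊢
    rw [Ring.inverse_unit]
    have hqP : (↑q⁻¹ : A) * P = P * (↑q⁻¹ : A) := by
      rw [Units.inv_mul_eq_iff_eq_mul, ← mul_assoc, hQP, mul_assoc]; simp
    have hqt : θ (↑q⁻¹ : A) * θ (q : A) = 1 := by
      rw [← hθm]; simp [hθ1]
    refine ⟨hT2.mul q⁻¹.isUnit, ?_, ?_⟩
    · rw [← mul_assoc, hXT, mul_assoc, ← hqP, mul_assoc]
    -- With `G' = H Q Q`, self-adjointness `H Q = θ(Q) H` moves one factor `Q` to the left, and the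
    -- two factors cancel against `θ(Q⁻¹)` and `Q⁻¹`.
    · calc θ (X T * (↑q⁻¹ : A)) * G * (X T * (↑q⁻¹ : A))
          = θ (↑q⁻¹ : A) * G' * (↑q⁻¹ : A) := by
            rw [hθm]; simp only [hG', mul_assoc]
        _ = θ (↑q⁻¹ : A) * (η * q * q) * (↑q⁻¹ : A) := by
            rw [← hηS, ← hQQ, mul_assoc (η : A)]
        _ = (θ (↑q⁻¹ : A) * θ (q : A)) * η *
              ((q : A) * (↑q⁻¹ : A)) := by
            rw [← hQH]; simp only [mul_assoc]
        _ = η := by rw [hqt]; simp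

end SmoothLinearAlgebra

/-! ### The induced metric and the shape operator in local frames -/

open Bundle in
/-- The derivative of a smooth vector-valued function along a smooth vector field is smooth. -/
theorem ContMDiff.contMDiffOn_mvfderiv_apply {n : ℕ} {M F : Type*} [TopologicalSpace M]
    [ChartedSpace (EuclideanSpace ℝ (Fin n)) M] [IsManifold (𝓡 n) ∞ M]
    [NormedAddCommGroup F] [NormedSpace ℝ F] {f : M → F}
    (hf : ContMDiff (𝓡 n) 𝓘(ℝ, F) ∞ f) {X : (y : M) → TangentSpace (𝓡 n) y} {U : Set M}
    (hX : ContMDiffOn (𝓡 n) (𝓡 n).tangent ∞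
      (fun y => (⟨y, X y⟩ : TotalSpace (EuclideanSpace ℝ (Fin n)) (TangentSpace (𝓡 n)))) U) :
    ContMDiffOn (𝓡 n) 𝓘(ℝ, F) ∞ (fun y => mvfderiv (𝓡 n) f y (X y)) U := by
  have h1 := hf.contMDiff_tangentMap (m := ∞) (by simp)
  exact ((contMDiff_snd_tangentBundle_modelSpace F 𝓘(ℝ, F)).comp h1).comp_contMDiffOn hX

namespace NondegHypersurface

variable {K : SpaceFormKind} {n s : ℕ} {M : Type*} [TopologicalSpace M]
  [ChartedSpace (EuclideanSpace ℝ (Fin n)) M] (S : NondegHypersurface K n s M)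

theorem metric_comm (x : M) (u v : TangentSpace (𝓡 n) x) : S.metric x u v = S.metric x v u :=
  inner_comm _ _ _

theorem metric_eq_zero {x : M} {u : TangentSpace (𝓡 n) x} (h : ∀ v, S.metric x u v = 0) : u = 0 :=
  S.nondegenerate x u h

theorem curvature_mul_inner_dincl (x : M) (u : TangentSpace (𝓡 n) x) :
    K.curvature * K.inner (n + 1) s (S.incl x) (S.dincl x u) = 0 := by
  rcases S.curv_self x with h | ⟨h, -, -⟩
  · rw [h, zero_mul]
  · have hk : K.curvature ≠ 0 := by intro h0; rw [h0] at h; norm_num at h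
    have : K.inner (n + 1) s (S.incl x) (S.dincl x u) = 0 := by
      refine inner_deriv_of_unit S.incl S.contMDiff_incl (fun y => ?_) x u
      rcases S.curv_self y with h' | ⟨h', h'', -⟩
      · exact absurd h' hk
      · rw [h'']; exact mul_self_eq_one_iff.1 h'
    rw [this, mul_zero]

/-- The second fundamental form as the derivative of the normal field. -/
theorem metric_shapeOperator (x : M) (u v : TangentSpace (𝓡 n) x) :
    S.metric x (S.shapeOperator x u) v =
      -K.inner (n + 1) s (mvfderiv (𝓡 n) S.normal x u) (mvfderiv (𝓡 n) S.incl x v) := by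
  have h : S.metric x (S.shapeOperator x u) v =
      K.inner (n + 1) s (S.dincl x (S.shapeOperator x u)) (S.dincl x v) := rfl
  have hw : S.nablaNormal x u = mvfderiv (𝓡 n) S.normal x u -
    (K.curvature * K.inner (n+1) s (S.incl x) (mvfderiv (𝓡 n) S.normal x u)) • S.incl x := rfl
  -- Projecting to the space form changes the derivative of the normal by a multiple of the position
  -- vector, which pairs to zero with tangent vectors of `M` when `κ ≠ 0` and is absent when `κ =
  -- 0`.
  have h0 := S.curvature_mul_inner_dincl x v
  have hv : S.dincl x v = mvfderiv (𝓡 n) S.incl x v := rfl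
  rw [h, S.dincl_shapeOperator, hw, ← hv]
  simp only [map_neg, map_sub, map_smul, LinearMap.neg_apply, LinearMap.sub_apply,
    LinearMap.smul_apply, smul_eq_mul]
  linear_combination (K.inner (n+1) s (S.incl x) (mvfderiv (𝓡 n) S.normal x u)) * h0

theorem contMDiffOn_inner {φ ψ : M → K.Ambient (n + 1)} {U : Set M}
    (hφ : ContMDiffOn (𝓡 n) 𝓘(ℝ, K.Ambient (n + 1)) ∞ φ U)
    (hψ : ContMDiffOn (𝓡 n) 𝓘(ℝ, K.Ambient (n + 1)) ∞ ψ U) :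
    ContMDiffOn (𝓡 n) 𝓘(ℝ, ℝ) ∞ (fun y => K.inner (n + 1) s (φ y) (ψ y)) U := by
  let Bc : K.Ambient (n + 1) →L[ℝ] K.Ambient (n + 1) →L[ℝ] ℝ :=
    LinearMap.toContinuousLinearMap
      ((LinearMap.toContinuousLinearMap).toLinearMap ∘ₗ K.inner (n + 1) s)
  exact (Bc.contMDiff.comp_contMDiffOn hφ).clm_apply hψ

variable [IsManifold (𝓡 n) ∞ M]

/-- In a chart, differentiating `⟨ξ, ∂_v f⟩ = 0` along `u` gives `⟨∂_u ξ, ∂_v f⟩ = -⟨ξ, ∂_u ∂_v f⟩`,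
and second derivatives are symmetric. -/
theorem inner_mvfderiv_normal_comm (x : M) (u v : TangentSpace (𝓡 n) x) :
    K.inner (n + 1) s (mvfderiv (𝓡 n) S.normal x u) (mvfderiv (𝓡 n) S.incl x v) =
      K.inner (n + 1) s (mvfderiv (𝓡 n) S.normal x v) (mvfderiv (𝓡 n) S.incl x u) := by
  set φ := extChartAt (𝓡 n) x with hφ
  set f : EuclideanSpace ℝ (Fin n) → K.Ambient (n + 1) := S.incl ∘ φ.symm with hf
  set g : EuclideanSpace ℝ (Fin n) → K.Ambient (n + 1) := S.normal ∘ φ.symm with hg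
  have hopen : IsOpen φ.target := isOpen_extChartAt_target x
  have hz : φ x ∈ φ.target := mem_extChartAt_target x
  have hsymm : ContMDiffOn 𝓘(ℝ, EuclideanSpace ℝ (Fin n)) (𝓡 n) ∞ φ.symm φ.target :=
    contMDiffOn_extChartAt_symm x
  have hfd : ContDiffOn ℝ ∞ f φ.target :=
    contMDiffOn_iff_contDiffOn.1 (S.contMDiff_incl.comp_contMDiffOn hsymm)
  have hgd : ContDiffOn ℝ ∞ g φ.target :=
    contMDiffOn_iff_contDiffOn.1 (S.contMDiff_normal.comp_contMDiffOn hsymm)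
  have hfx : ContDiffAt ℝ ∞ f (φ x) := hfd.contDiffAt (hopen.mem_nhds hz)
  have hgx : ContDiffAt ℝ ∞ g (φ x) := hgd.contDiffAt (hopen.mem_nhds hz)
  have hι : ∀ u : TangentSpace (𝓡 n) x,
      mvfderiv (𝓡 n) S.incl x u = fderiv ℝ f (φ x) u := by
    intro u
    have : mfderiv (𝓡 n) 𝓘(ℝ, K.Ambient (n + 1)) S.incl x = fderivWithin ℝ
        (writtenInExtChartAt (𝓡 n) 𝓘(ℝ, K.Ambient (n + 1)) x S.incl) (Set.range (𝓡 n)) (φ x) :=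
      (S.contMDiff_incl.mdifferentiableAt (by simp)).mfderiv
    change mfderiv (𝓡 n) 𝓘(ℝ, K.Ambient (n + 1)) S.incl x u = _
    rw [this]
    simp only [ModelWithCorners.range_eq_univ, fderivWithin_univ]
    rfl
  have hξ : ∀ u : TangentSpace (𝓡 n) x,
      mvfderiv (𝓡 n) S.normal x u = fderiv ℝ g (φ x) u := by
    intro u
    have : mfderiv (𝓡 n) 𝓘(ℝ, K.Ambient (n + 1)) S.normal x = fderivWithin ℝ
        (writtenInExtChartAt (𝓡 n) 𝓘(ℝ, K.Ambient (n + 1)) x S.normal) (Set.range (𝓡 n)) (φ x) :=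
      (S.contMDiff_normal.mdifferentiableAt (by simp)).mfderiv
    change mfderiv (𝓡 n) 𝓘(ℝ, K.Ambient (n + 1)) S.normal x u = _
    rw [this]
    simp only [ModelWithCorners.range_eq_univ, fderivWithin_univ]
    rfl
  set B := K.inner (n + 1) s
  let Bc : K.Ambient (n + 1) →L[ℝ] K.Ambient (n + 1) →L[ℝ] ℝ :=
    LinearMap.toContinuousLinearMap ((LinearMap.toContinuousLinearMap).toLinearMap ∘ₗ B)
  have hzero : ∀ z ∈ φ.target, ∀ w : EuclideanSpace ℝ (Fin n), Bc (g z) (fderiv ℝ f z w) = 0 := by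
    intro z hz w
    have h1 : MDifferentiableAt 𝓘(ℝ, EuclideanSpace ℝ (Fin n)) (𝓡 n) φ.symm z :=
      (hsymm.contMDiffAt (hopen.mem_nhds hz)).mdifferentiableAt (by simp)
    have h2 : mfderiv 𝓘(ℝ, EuclideanSpace ℝ (Fin n)) 𝓘(ℝ, K.Ambient (n + 1)) f z =
        (mfderiv (𝓡 n) 𝓘(ℝ, K.Ambient (n + 1)) S.incl (φ.symm z)).comp
          (mfderiv 𝓘(ℝ, EuclideanSpace ℝ (Fin n)) (𝓡 n) φ.symm z) :=
      mfderiv_comp z (S.contMDiff_incl.mdifferentiableAt (by simp)) h1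
    rw [mfderiv_eq_fderiv] at h2
    have h3 : fderiv ℝ f z w = mvfderiv (𝓡 n) S.incl (φ.symm z)
        (mfderiv 𝓘(ℝ, EuclideanSpace ℝ (Fin n)) (𝓡 n) φ.symm z w) :=
      congrArg (fun L => L w) h2
    rw [h3]
    exact S.normal_orthogonal _ _
  have hder : ∀ a b : EuclideanSpace ℝ (Fin n),
      B (fderiv ℝ g (φ x) a) (fderiv ℝ f (φ x) b) +
        B (g (φ x)) (fderiv ℝ (fderiv ℝ f) (φ x) a b) = 0 := by
    intro a b
    have hev : (fun z => Bc (g z) (fderiv ℝ f z b)) =ᶠ[nhds (φ x)] fun _ => 0 := by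
      filter_upwards [hopen.mem_nhds hz] with z hz using hzero z hz b
    have hf2 : DifferentiableAt ℝ (fderiv ℝ f) (φ x) :=
      (hfx.fderiv_right (m := 1) (by norm_cast)).differentiableAt (by simp)
    have hf3 : HasFDerivAt (fun z => fderiv ℝ f z b)
        ((fderiv ℝ (fderiv ℝ f) (φ x)).flip b) (φ x) := by
      have := hf2.hasFDerivAt.clm_apply (hasFDerivAt_const b (φ x))
      refine this.congr_fderiv ?_
      ext1 w; simp
    have hgder := (hgx.differentiableAt (by simp)).hasFDerivAt
    have h4 := Bc.hasFDerivAt_of_bilinear hgder hf3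
    have h5 := h4.unique ((hasFDerivAt_const (0 : ℝ) (φ x)).congr_of_eventuallyEq hev)
    have h6 := congrArg (fun L => L a) h5
    simp only [add_apply, zero_apply] at h6
    have h7 : B (g (φ x)) (fderiv ℝ (fderiv ℝ f) (φ x) a b) +
      B (fderiv ℝ g (φ x) a) (fderiv ℝ f (φ x) b) = 0 := h6
    rw [add_comm]; exact h7
  have hsy := hfx.isSymmSndFDerivAt
    (by rw [minSmoothness_of_isRCLikeNormedField]; exact WithTop.coe_le_coe.2 le_top) u v
  have e1 := hder u v
  have e2 := hder v u
  rw [hsy] at e1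
  rw [hι, hι, hξ, hξ]
  linarith

/-- The shape operator is self-adjoint. -/
theorem metric_shapeOperator_comm (x : M) (u v : TangentSpace (𝓡 n) x) :
    S.metric x (S.shapeOperator x u) v = S.metric x u (S.shapeOperator x v) := by
  rw [S.metric_comm x u, S.metric_shapeOperator, S.metric_shapeOperator,
    S.inner_mvfderiv_normal_comm]

end NondegHypersurface

/-! ### Endomorphisms with the same Jordan normal form -/

theorem LinearMap.toMatrix_eq_iff {R V ι : Type*} [CommRing R] [AddCommGroup V] [Module R V]
    [Fintype ι] [DecidableEq ι] (b : Module.Basis ι R V) (T : V →ₗ[R] V) (P : Matrix ι ι R) :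
    LinearMap.toMatrix b b T = P ↔ ∀ i, T (b i) = ∑ k, P k i • b k := by
  constructor
  · rintro rfl i
    simp only [LinearMap.toMatrix_apply]
    exact (b.sum_repr _).symm
  · intro h
    ext k i
    rw [LinearMap.toMatrix_apply, h, b.repr_sum_self]

section Similarity

open Polynomial

/-- Real matrices that are similar over `ℂ` are similar over `ℝ`. -/
theorem Matrix.exists_isUnit_real_intertwiner {ι : Type*} [Fintype ι] [DecidableEq ι]
    (P T : Matrix ι ι ℝ) (Y : Matrix ι ι ℂ) (hY : IsUnit Y)
    (h : T.map Complex.ofRealHom * Y = Y * P.map Complex.ofRealHom) :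
    ∃ Z : Matrix ι ι ℝ, IsUnit Z ∧ T * Z = Z * P := by
  set Y₁ : Matrix ι ι ℝ := Y.map Complex.re
  set Y₂ : Matrix ι ι ℝ := Y.map Complex.im
  have h1 : T * Y₁ = Y₁ * P := by
    ext i j
    have := congrArg Complex.re (congrFun (congrFun h i) j)
    simpa [Matrix.mul_apply, Complex.re_sum, Y₁] using this
  have h2 : T * Y₂ = Y₂ * P := by
    ext i j
    have := congrArg Complex.im (congrFun (congrFun h i) j)
    simpa [Matrix.mul_apply, Complex.im_sum, Y₂] using this
  -- `det (Y₁ + X Y₂)` takes the value `det Y ≠ 0` at `X = i`, so it is a non-zero polynomial and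
  -- has a non-zero value at some real `t`.
  let p : ℝ[X] := (Y₁.map C + (X : ℝ[X]) • Y₂.map C).det
  have hp : p ≠ 0 := by
    intro h0
    have he : (aeval Complex.I : ℝ[X] →ₐ[ℝ] ℂ) p = Y.det := by
      rw [AlgHom.map_det]
      congr 1
      ext i j
      simp [Y₁, Y₂, Complex.re_add_im]
    rw [h0, map_zero] at he
    exact ((Matrix.isUnit_iff_isUnit_det Y).1 hY).ne_zero he.symm
  obtain ⟨t, ht⟩ : ∃ t, p.eval t ≠ 0 := by
    by_contra hc
    push Not at hc
    exact hp (Polynomial.funext fun t => by rw [hc t, eval_zero])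
  refine ⟨Y₁ + t • Y₂, ?_, ?_⟩
  · rw [Matrix.isUnit_iff_isUnit_det, isUnit_iff_ne_zero]
    have : p.eval t = (Y₁ + t • Y₂).det := by
      rw [← coe_evalRingHom, RingHom.map_det]
      congr 1
      ext i j
      simp; ring
    rwa [← this]
  · rw [mul_add, add_mul, h1, Matrix.mul_smul, Matrix.smul_mul, h2]

/-- Matching the two Jordan bases gives a complex similarity, which descends to ℝ. -/
theorem HasJordanNormalForm.exists_intertwiner {V V' : Type*} [AddCommGroup V] [Module ℝ V]
    [AddCommGroup V'] [Module ℝ V'] {T : V →ₗ[ℝ] V} {T' : V' →ₗ[ℝ] V'} {D : JordanData}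
    (h : HasJordanNormalForm T D) (h' : HasJordanNormalForm T' D)
    {ι : Type*} [Fintype ι] [DecidableEq ι] (e : Module.Basis ι ℝ V) (e' : Module.Basis ι ℝ V') :
    ∃ Z : Matrix ι ι ℝ, IsUnit Z ∧
      LinearMap.toMatrix e' e' T' * Z = Z * LinearMap.toMatrix e e T := by
  obtain ⟨b, hb⟩ := h
  obtain ⟨b', hb'⟩ := h'
  let Φ : (ℂ ⊗[ℝ] V) ≃ₗ[ℂ] (ℂ ⊗[ℝ] V') := b.equiv b' (Equiv.refl _)
  have hΦ : T'.baseChange ℂ ∘ₗ Φ.toLinearMap = Φ.toLinearMap ∘ₗ T.baseChange ℂ := by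
    refine b.ext fun i => ?_
    have h1 : T.baseChange ℂ (b i) = ∑ k, D.matrix k i • b k := 
      (LinearMap.toMatrix_eq_iff _ _ _).1 hb i
    have h2 : T'.baseChange ℂ (b' i) = ∑ k, D.matrix k i • b' k := 
      (LinearMap.toMatrix_eq_iff _ _ _).1 hb' i
    simp only [LinearMap.comp_apply, LinearEquiv.coe_coe, h1, map_sum, map_smul, Φ,
      Module.Basis.equiv_apply, Equiv.refl_apply, h2]
  let E := Algebra.TensorProduct.basis ℂ e
  let E' := Algebra.TensorProduct.basis ℂ e'
  refine Matrix.exists_isUnit_real_intertwiner _ _ (LinearMap.toMatrix E E' Φ.toLinearMap) ?_ ?_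
  · rw [isUnit_iff_exists]
    refine ⟨LinearMap.toMatrix E' E Φ.symm.toLinearMap, ?_, ?_⟩
    · rw [← LinearMap.toMatrix_comp]; simp
    · rw [← LinearMap.toMatrix_comp]; simp
  · have h1 : (LinearMap.toMatrix e' e' T').map Complex.ofRealHom =
        LinearMap.toMatrix E' E' (T'.baseChange ℂ) := (LinearMap.toMatrix_baseChange ℂ T' e' e').symm
    have h2 : (LinearMap.toMatrix e e T).map Complex.ofRealHom =
        LinearMap.toMatrix E E (T.baseChange ℂ) := (LinearMap.toMatrix_baseChange ℂ T e e).symm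
    rw [h1, h2, ← LinearMap.toMatrix_comp, ← LinearMap.toMatrix_comp, hΦ]

end Similarity

/-! ### Smooth Petrov frames near a point -/

section SmoothFrames

open Module

variable {n : ℕ} {M : Type*} [TopologicalSpace M] [ChartedSpace (EuclideanSpace ℝ (Fin n)) M]
  {ι : Type*} [Fintype ι] [DecidableEq ι]

/-- Matrices are carried to the normed algebra of operators on Euclidean space, where
`exists_contDiffOn_normalizing_frame` applies; smoothness is still tested on entries. -/
theorem contMDiffOn_toEuclideanCLM {Z : M → Matrix ι ι ℝ} {U : Set M}
    (hZ : ∀ i j, ContMDiffOn (𝓡 n) 𝓘(ℝ, ℝ) ∞ (fun y => Z y i j) U) :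
    ContMDiffOn (𝓡 n) 𝓘(ℝ, EuclideanSpace ℝ ι →L[ℝ] EuclideanSpace ℝ ι) ∞
      (fun y => Matrix.toEuclideanCLM (n := ι) (𝕜 := ℝ) (Z y)) U := by
  have h : (fun y => Matrix.toEuclideanCLM (n := ι) (𝕜 := ℝ) (Z y)) = fun y =>
      ∑ i, ∑ j, Z y i j • Matrix.toEuclideanCLM (n := ι) (𝕜 := ℝ) (Matrix.single i j 1) := by
    funext y
    conv_lhs => rw [Matrix.matrix_eq_sum_single (Z y)]
    simp only [map_sum, ← map_smul, Matrix.smul_single, smul_eq_mul, mul_one]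
  rw [h]
  refine contMDiffOn_finsetSum fun i _ => contMDiffOn_finsetSum fun j _ => ?_
  exact (hZ i j).smul contMDiffOn_const

theorem contMDiffOn_toEuclideanCLM_symm_apply
    {Z : M → EuclideanSpace ℝ ι →L[ℝ] EuclideanSpace ℝ ι} {U : Set M}
    (hZ : ContMDiffOn (𝓡 n) 𝓘(ℝ, EuclideanSpace ℝ ι →L[ℝ] EuclideanSpace ℝ ι) ∞ Z U) (i j : ι) :
    ContMDiffOn (𝓡 n) 𝓘(ℝ, ℝ) ∞
      (fun y => (Matrix.toEuclideanCLM (n := ι) (𝕜 := ℝ)).symm (Z y) i j) U := by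
  let ℓ : (EuclideanSpace ℝ ι →L[ℝ] EuclideanSpace ℝ ι) →ₗ[ℝ] ℝ :=
    (Matrix.entryLinearMap ℝ ℝ i j) ∘ₗ
      (Matrix.toEuclideanCLM (n := ι) (𝕜 := ℝ)).symm.toAlgEquiv.toLinearMap
  exact (LinearMap.toContinuousLinearMap ℓ).contMDiff.comp_contMDiffOn hZ

/-- Let `T` be a family of self-adjoint operators for a smooth family `G` of non-degenerate forms, all
similar to one matrix `P`. If in a frame the pair has the matrices `(P, H)` at the point `x`, then near
`x` there is a smooth family of frames with that property. -/
theorem exists_contMDiffOn_normalizing_frame (T G : M → Matrix ι ι ℝ) {U : Set M} (hU : IsOpen U)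
    {x : M} (hx : x ∈ U)
    (hG : ∀ i j, ContMDiffOn (𝓡 n) 𝓘(ℝ, ℝ) ∞ (fun y => G y i j) U)
    (hGT : ∀ i j, ContMDiffOn (𝓡 n) 𝓘(ℝ, ℝ) ∞ (fun y => (G y * T y) i j) U)
    (hGu : ∀ y ∈ U, IsUnit (G y)) (hGs : ∀ y ∈ U, (G y).transpose = G y)
    (hTs : ∀ y ∈ U, G y * T y = (T y).transpose * G y)
    (P H X₀ : Matrix ι ι ℝ) (hX₀ : IsUnit X₀) (hTx : T x * X₀ = X₀ * P)
    (hGx : X₀.transpose * G x * X₀ = H)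
    (hP : ∀ y ∈ U, ∃ Y : Matrix ι ι ℝ, IsUnit Y ∧ T y * Y = Y * P) :
    ∃ (V : Set M) (F : M → Matrix ι ι ℝ), IsOpen V ∧ x ∈ V ∧ V ⊆ U ∧
      (∀ i j, ContMDiffOn (𝓡 n) 𝓘(ℝ, ℝ) ∞ (fun y => F y i j) V) ∧
      ∀ y ∈ V, IsUnit (F y) ∧ T y * F y = F y * P ∧ (F y).transpose * G y * F y = H := by
  let Ψ := (Matrix.toEuclideanCLM (n := ι) (𝕜 := ℝ)).toAlgEquiv
  -- Transposition, transported to operators; this is the anti-involution.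
  let θ : (EuclideanSpace ℝ ι →L[ℝ] EuclideanSpace ℝ ι) →ₗ[ℝ] _ :=
    Ψ.toLinearMap ∘ₗ (Matrix.transposeLinearEquiv ι ι ℝ ℝ).toLinearMap ∘ₗ Ψ.symm.toLinearMap
  have hθ : ∀ Z, θ (Ψ Z) = Ψ Z.transpose := fun Z => by
    show Ψ (Ψ.symm (Ψ Z)).transpose = _
    rw [Ψ.symm_apply_apply]
  have hX₀t : IsUnit X₀.transpose := (Matrix.isUnit_transpose (A := X₀)).2 hX₀
  have hHu : IsUnit H := hGx ▸ (hX₀t.mul (hGu x hx)).mul hX₀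
  have hHs : H.transpose = H := by
    rw [← hGx]
    simp only [Matrix.transpose_mul, Matrix.transpose_transpose, hGs x hx, mul_assoc]
  have hHP : H * P = P.transpose * H := by
    calc H * P = X₀.transpose * G x * (X₀ * P) := by rw [← hGx]; simp only [mul_assoc]
      _ = X₀.transpose * (G x * T x) * X₀ := by rw [← hTx]; simp only [mul_assoc]
      _ = (T x * X₀).transpose * G x * X₀ := by
        rw [hTs x hx, Matrix.transpose_mul]; simp only [mul_assoc]
      _ = P.transpose * H := by
        rw [hTx, Matrix.transpose_mul, ← hGx]; simp only [mul_assoc]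
  obtain ⟨O, F, hO, hxO, hF, hFO⟩ := exists_contDiffOn_normalizing_frame θ
    (fun a b => by
      obtain ⟨a, rfl⟩ := Ψ.surjective a
      obtain ⟨b, rfl⟩ := Ψ.surjective b
      rw [← map_mul, hθ, hθ, hθ, Matrix.transpose_mul, map_mul])
    (fun a => by
      obtain ⟨a, rfl⟩ := Ψ.surjective a
      rw [hθ, hθ, Matrix.transpose_transpose])
    (Ψ P) (Ψ H) (Ψ (T x)) (Ψ (G x)) (Ψ X₀) (hHu.map Ψ) (hX₀.map Ψ)
    (by rw [hθ, hHs]) (by rw [hθ, ← map_mul, ← map_mul, hHP])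
    (by rw [← map_mul, ← map_mul, hTx]) (by rw [hθ, ← map_mul, ← map_mul, hGx])
  have hGc : ContMDiffOn (𝓡 n) 𝓘(ℝ, EuclideanSpace ℝ ι →L[ℝ] EuclideanSpace ℝ ι) ∞
      (fun y => Ψ (G y)) U := contMDiffOn_toEuclideanCLM hG
  -- Smoothness of `T` is recovered from `T = G⁻¹ (G T)`. In the application, the entries of `G T`
  -- are those of the second fundamental form, which derivatives of the immersion and the normal
  -- give directly.
  have hTc : ContMDiffOn (𝓡 n) 𝓘(ℝ, EuclideanSpace ℝ ι →L[ℝ] EuclideanSpace ℝ ι) ∞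
      (fun y => Ψ (T y)) U := by
    have h1 : ContMDiffOn (𝓡 n) 𝓘(ℝ, EuclideanSpace ℝ ι →L[ℝ] EuclideanSpace ℝ ι) ∞
      (fun y => Ψ (G y * T y)) U := contMDiffOn_toEuclideanCLM hGT
    have h2 : ContMDiffOn (𝓡 n) 𝓘(ℝ, EuclideanSpace ℝ ι →L[ℝ] EuclideanSpace ℝ ι) ∞
        (fun y => Ring.inverse (Ψ (G y))) U := by
      intro y hy
      obtain ⟨u, hu⟩ := (hGu y hy).map Ψ
      refine ContMDiffAt.comp_contMDiffWithinAt y (g := Ring.inverse) ?_ (hGc y hy)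
      exact ContDiffAt.contMDiffAt (hu ▸ contDiffAt_ringInverse ℝ u)
    have h3 := h2.clm_comp h1
    refine h3.congr fun y hy => ?_
    show _ = Ring.inverse (Ψ (G y)) * Ψ (G y * T y)
    rw [map_mul, Ring.inverse_mul_cancel_left _ _ ((hGu y hy).map Ψ)]
  have hpair := hTc.prodMk_space hGc
  refine ⟨U ∩ (fun y => (Ψ (T y), Ψ (G y))) ⁻¹' O, fun y => Ψ.symm (F (Ψ (T y), Ψ (G y))),
    hpair.continuousOn.isOpen_inter_preimage hU hO, ⟨hx, hxO⟩, Set.inter_subset_left, ?_, ?_⟩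
  · refine contMDiffOn_toEuclideanCLM_symm_apply ?_
    exact hF.contMDiffOn.comp (hpair.mono Set.inter_subset_left) fun y hy => hy.2
  · rintro y ⟨hy, hyO⟩
    obtain ⟨Y, hY, hTY⟩ := hP y hy
    obtain ⟨h1, h2, h3⟩ := hFO (Ψ (T y)) (Ψ (G y)) hyO (by rw [hθ, hGs y hy])
      (by rw [hθ, ← map_mul, ← map_mul, hTs y hy])
      ⟨Ψ Y, hY.map Ψ, by rw [← map_mul, ← map_mul, hTY]⟩
    obtain ⟨Z, hZ⟩ := Ψ.surjective (F (Ψ (T y), Ψ (G y)))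
    dsimp only
    rw [← hZ] at h1 h2 h3 ⊢
    rw [Ψ.symm_apply_apply]
    rw [hθ, ← map_mul, ← map_mul] at h3
    rw [← map_mul, ← map_mul] at h2
    refine ⟨?_, Ψ.injective h2, Ψ.injective h3⟩
    have := h1.map Ψ.symm
    rwa [Ψ.symm_apply_apply] at this

end SmoothFrames

namespace NondegHypersurface

open Module Bundle

variable {K : SpaceFormKind} {n s : ℕ} {M : Type*} [TopologicalSpace M]
  [ChartedSpace (EuclideanSpace ℝ (Fin n)) M] [IsManifold (𝓡 n) ∞ M]
  (S : NondegHypersurface K n s M)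

/-- If all shape operators have the same Jordan normal form, a Petrov basis at a point extends to a
smooth local frame of Petrov bases of the same normal form. -/
theorem exists_isLocalFrameOn_isPetrovBasis {D : JordanData}
    (hJ : ∀ x : M, HasJordanNormalForm (S.shapeOperator x) D) {x : M} {P : PetrovData}
    (hP : HasPetrovNormalForm (S.shapeOperator x) (S.metric x) P) :
    ∃ (U : Set M) (e : P.FrameIndex → (y : M) → TangentSpace (𝓡 n) y)
      (he : IsLocalFrameOn (𝓡 n) (EuclideanSpace ℝ (Fin n)) ∞ e U), IsOpen U ∧ x ∈ U ∧
        ∀ (y : M) (hy : y ∈ U),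
          IsPetrovBasis (S.shapeOperator y) (S.metric y) P (he.toBasisAt hy) := by
  obtain ⟨e₀, he₀, he₀'⟩ := hP
  let tr := trivializationAt (EuclideanSpace ℝ (Fin n)) (TangentSpace (𝓡 n) (M := M)) x
  -- The tangent space is by definition the model space, so `e₀` also serves as a basis of the
  -- fibre. This only provides some frame indexed by `P.FrameIndex`; its relation to `e₀` at `x`
  -- enters later through the matrix `X₀`.
  let b : Basis P.FrameIndex ℝ (EuclideanSpace ℝ (Fin n)) := e₀
  let σ := tr.localFrame b
  have hσ : IsLocalFrameOn (𝓡 n) (EuclideanSpace ℝ (Fin n)) ∞ σ tr.baseSet :=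
    tr.isLocalFrameOn_localFrame_baseSet (𝓡 n) ∞ b
  have hx : x ∈ tr.baseSet := FiberBundle.mem_baseSet_trivializationAt' x
  classical
  -- The value 0 off the base set is never used.
  let T : M → Matrix P.FrameIndex P.FrameIndex ℝ := fun y =>
    if hy : y ∈ tr.baseSet then
      LinearMap.toMatrix (hσ.toBasisAt hy) (hσ.toBasisAt hy) (S.shapeOperator y) else 0
  let G : M → Matrix P.FrameIndex P.FrameIndex ℝ := fun y =>
    Matrix.of fun i j => S.metric y (σ i y) (σ j y)
  have hT : ∀ y (hy : y ∈ tr.baseSet), T y =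
      LinearMap.toMatrix (hσ.toBasisAt hy) (hσ.toBasisAt hy) (S.shapeOperator y) :=
    fun y hy => dif_pos hy
  have hG : ∀ y (hy : y ∈ tr.baseSet), G y =
      LinearMap.BilinForm.toMatrix (hσ.toBasisAt hy) (S.metric y) := by
    intro y hy
    ext i j
    rw [LinearMap.BilinForm.toMatrix_apply, hσ.toBasisAt_coe hy, hσ.toBasisAt_coe hy]
    rfl
  have hGT : ∀ y ∈ tr.baseSet, ∀ i j,
      (G y * T y) i j = S.metric y (S.shapeOperator y (σ j y)) (σ i y) := by
    intro y hy i j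
    have h1 := (LinearMap.toMatrix_eq_iff (hσ.toBasisAt hy) (S.shapeOperator y) _).1 (hT y hy).symm j
    simp only [hσ.toBasisAt_coe hy] at h1
    rw [h1, S.metric_comm, map_sum, Matrix.mul_apply]
    refine Finset.sum_congr rfl fun k _ => ?_
    rw [map_smul, smul_eq_mul, mul_comm]
    rfl
  obtain ⟨V, F, hV, hxV, hVU, hF, hFV⟩ := exists_contMDiffOn_normalizing_frame T G
    tr.open_baseSet hx (n := n)
    (fun i j => contMDiffOn_inner (S.contMDiff_incl.contMDiffOn_mvfderiv_apply (hσ.contMDiffOn i))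
      (S.contMDiff_incl.contMDiffOn_mvfderiv_apply (hσ.contMDiffOn j)))
    (fun i j => by
      refine (contMDiffOn_inner (s := s)
        (S.contMDiff_normal.contMDiffOn_mvfderiv_apply (hσ.contMDiffOn j))
        (S.contMDiff_incl.contMDiffOn_mvfderiv_apply (hσ.contMDiffOn i))).neg.congr ?_
      intro y hy
      rw [hGT y hy, S.metric_shapeOperator])
    (fun y hy => by
      rw [hG y hy, Matrix.isUnit_iff_isUnit_det, isUnit_iff_ne_zero]
      refine (LinearMap.BilinForm.nondegenerate_iff_det_ne_zero _).1 ?_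
      refine ⟨fun u hu => S.metric_eq_zero hu, fun u hu => S.metric_eq_zero fun v => ?_⟩
      rw [S.metric_comm]; exact hu v)
    (fun y hy => by
      ext i j
      exact S.metric_comm y _ _)
    (fun y hy => by
      ext i j
      have h := hGT y hy j i
      rw [S.metric_shapeOperator_comm, S.metric_comm, ← hGT y hy i j] at h
      rw [← h, ← Matrix.transpose_apply (G y * T y), Matrix.transpose_mul]
      rw [show (G y).transpose = G y from Matrix.ext fun i j => S.metric_comm y _ _])
    P.opMatrix P.formMatrix ((hσ.toBasisAt hx).toMatrix e₀)
    (by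
      have := (hσ.toBasisAt hx).invertibleToMatrix e₀
      exact isUnit_of_invertible _)
    (by
      rw [hT x hx, ← he₀, linearMap_toMatrix_mul_basis_toMatrix,
        basis_toMatrix_mul_linearMap_toMatrix])
    (by
      rw [hG x hx, ← he₀', LinearMap.BilinForm.toMatrix_mul_basis_toMatrix])
    (fun y hy => by
      obtain ⟨Z, hZ, h⟩ := (hJ x).exists_intertwiner (hJ y) e₀ (hσ.toBasisAt hy)
      refine ⟨Z, hZ, ?_⟩
      rw [hT y hy, ← he₀, h])
  let e : P.FrameIndex → (y : M) → TangentSpace (𝓡 n) y := fun i y => ∑ k, F y k i • σ k y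
  have hbasis : ∀ y (hy : y ∈ V), ∃ c : Basis P.FrameIndex ℝ (TangentSpace (𝓡 n) y),
      (∀ i, c i = e i y) ∧ (hσ.toBasisAt (hVU hy)).toMatrix c = F y := by
    intro y hy
    set c₀ := hσ.toBasisAt (hVU hy) with hc₀
    let c := c₀.map (Matrix.toLinearEquiv c₀ (F y)
      ((Matrix.isUnit_iff_isUnit_det _).1 (hFV y hy).1))
    have hc : ∀ i, c i = ∑ k, F y k i • c₀ k := fun i => by
      rw [Basis.map_apply]
      exact Matrix.toLin_self c₀ c₀ (F y) i
    refine ⟨c, fun i => ?_, ?_⟩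
    · rw [hc]
      simp only [hc₀, hσ.toBasisAt_coe]
      rfl
    · ext k i
      rw [Basis.toMatrix_apply, hc, c₀.repr_sum_self]
  have he : IsLocalFrameOn (𝓡 n) (EuclideanSpace ℝ (Fin n)) ∞ e V :=
    { linearIndependent := by
        intro y hy
        obtain ⟨c, hc, -⟩ := hbasis y hy
        simp only [← hc]
        exact c.linearIndependent
      generating := by
        intro y hy
        obtain ⟨c, hc, -⟩ := hbasis y hy
        simp only [← hc]
        exact c.span_eq.ge
      contMDiffOn := fun i => ContMDiffOn.sum_section fun k _ =>
        (hF k i).smul_section ((hσ.contMDiffOn k).mono hVU) }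
  refine ⟨V, e, he, hV, hxV, fun y hy => ?_⟩
  obtain ⟨c, hc, hcF⟩ := hbasis y hy
  have hcb : he.toBasisAt hy = c := Basis.eq_of_apply_eq fun i => by
    rw [he.toBasisAt_coe, hc]
  obtain ⟨hFu, hTF, hGF⟩ := hFV y hy
  rw [hcb]
  rw [← hcF, hT y (hVU hy), linearMap_toMatrix_mul_basis_toMatrix] at hTF
  constructor
  · have := congrArg (c.toMatrix (hσ.toBasisAt (hVU hy)) * ·) hTF
    simp only [← mul_assoc, Basis.toMatrix_mul_toMatrix_flip, one_mul,
      basis_toMatrix_mul_linearMap_toMatrix] at this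
    exact this
  · rw [← hcF, hG y (hVU hy), LinearMap.BilinForm.toMatrix_mul_basis_toMatrix] at hGF
    exact hGF

end NondegHypersurface

/-! ### Chains of self-adjoint nilpotent operators -/

section Chains

open Module

variable {F V : Type*} [Field F] [AddCommGroup V] [Module F V]

theorem LinearMap.BilinForm.pow_apply_left (B : LinearMap.BilinForm F V) {N : V →ₗ[F] V}
    (hN : ∀ u v, B (N u) v = B u (N v)) (k : ℕ) (u v : V) :
    B ((N ^ k) u) v = B u ((N ^ k) v) := by
  induction k generalizing u with
  | zero => simp
  | succ k ih =>
    rw [pow_succ, Module.End.mul_apply, ih, hN, ← Module.End.mul_apply, ← pow_succ', pow_succ]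

theorem LinearMap.BilinForm.pow_apply_pow (B : LinearMap.BilinForm F V) {N : V →ₗ[F] V}
    (hN : ∀ u v, B (N u) v = B u (N v)) (k l : ℕ) (u v : V) :
    B ((N ^ k) u) ((N ^ l) v) = B ((N ^ (k + l)) u) v := by
  rw [← B.pow_apply_left hN, ← Module.End.mul_apply, ← pow_add, add_comm]

/-- Replacing `w` by `w + a N^(J+1) w` leaves the pairings `B(N^k w, w)` with `k ≥ m - J` unchanged,
because `N^(m+1) = 0`, and shifts the one with `k = m - J - 1` by `2 a c`. So the unwanted pairings
can be removed one after another, from the top down. -/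
theorem exists_chain_of_pow_apply_ne_zero (h2 : (2 : F) ≠ 0) (B : LinearMap.BilinForm F V)
    {N : V →ₗ[F] V} (hN : ∀ u v, B (N u) v = B u (N v)) {m : ℕ}
    (hm : N ^ (m + 1) = 0) {u : V} (hu : B ((N ^ m) u) u ≠ 0) :
    ∃ w, ∀ k, B ((N ^ k) w) w = if k = m then B ((N ^ m) u) u else 0 := by
  have hzero : ∀ k, m < k → N ^ k = 0 := fun k hk => pow_eq_zero_of_le hk hm
  have key : ∀ J ≤ m, ∃ w, B ((N ^ m) w) w = B ((N ^ m) u) u ∧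
      ∀ k < m, m ≤ k + J → B ((N ^ k) w) w = 0 := by
    intro J
    induction J with
    | zero => exact fun _ => ⟨u, rfl, fun k h1 h2 => by omega⟩
    | succ J ih =>
      intro hJ
      obtain ⟨w, hw1, hw2⟩ := ih (by omega)
      set c := B ((N ^ m) u) u
      -- The solution of `B(N^(m-J-1) w, w) + 2 a c = 0`.
      set a : F := -B ((N ^ (m - J - 1)) w) w / (2 * c) with ha
      have hexp : ∀ k, B ((N ^ k) (w + a • (N ^ (J + 1)) w)) (w + a • (N ^ (J + 1)) w) =
          B ((N ^ k) w) w + 2 * a * B ((N ^ (k + (J + 1))) w) w +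
            a * a * B ((N ^ (k + (J + 1) + (J + 1))) w) w := by
        intro k
        have h3 : B ((N ^ k) ((N ^ (J + 1)) w)) w = B ((N ^ (k + (J + 1))) w) w := by
          rw [← Module.End.mul_apply, ← pow_add]
        have h4 : B ((N ^ k) w) ((N ^ (J + 1)) w) = B ((N ^ (k + (J + 1))) w) w :=
          B.pow_apply_pow hN _ _ _ _
        have h5 : B ((N ^ k) ((N ^ (J + 1)) w)) ((N ^ (J + 1)) w) =
            B ((N ^ (k + (J + 1) + (J + 1))) w) w := by
          rw [← Module.End.mul_apply, ← pow_add]; exact B.pow_apply_pow hN _ _ _ _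
        simp only [map_add, map_smul, LinearMap.add_apply, LinearMap.smul_apply, smul_eq_mul,
          h3, h4, h5]
        ring
      refine ⟨w + a • (N ^ (J + 1)) w, ?_, fun k hk hkJ => ?_⟩
      · rw [hexp, hw1, hzero _ (by omega), hzero _ (by omega)]
        simp
      · rw [hexp, hzero (k + (J + 1) + (J + 1)) (by omega)]
        by_cases h : m ≤ k + J
        · rw [hw2 k hk h, hzero _ (by omega)]
          simp
        · have hk' : k = m - J - 1 := by omega
          rw [show k + (J + 1) = m by omega, hw1, hk', ha]
          simp only [LinearMap.zero_apply, map_zero, mul_zero, add_zero]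
          field_simp
          ring
  obtain ⟨w, hw1, hw2⟩ := key m le_rfl
  refine ⟨w, fun k => ?_⟩
  split_ifs with h
  · rw [h, hw1]
  · rcases lt_or_gt_of_ne h with h | h
    · exact hw2 k h (by omega)
    · rw [hzero k h]; simp

/-- A nilpotent self-adjoint operator for a non-degenerate symmetric form has a chain on which the
form is anti-diagonal. -/
theorem exists_chain_of_isNilpotent [Nontrivial V] (h2 : (2 : F) ≠ 0)
    (B : LinearMap.BilinForm F V) (hB : ∀ u v, B u v = B v u)
    (hBn : ∀ u, (∀ v, B u v = 0) → u = 0)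
    {N : V →ₗ[F] V} (hN : ∀ u v, B (N u) v = B u (N v)) (hnil : IsNilpotent N) :
    ∃ (m : ℕ) (c : F) (w : V), c ≠ 0 ∧ N ^ (m + 1) = 0 ∧
      ∀ k, B ((N ^ k) w) w = if k = m then c else 0 := by
  classical
  have hex : ∃ k, N ^ k = 0 := hnil
  obtain ⟨m, hm⟩ : ∃ m, Nat.find hex = m + 1 := by
    refine Nat.exists_eq_succ_of_ne_zero fun h0 => ?_
    have := Nat.find_spec hex
    rw [h0, pow_zero] at this
    exact one_ne_zero this
  have hm1 : N ^ (m + 1) = 0 := hm ▸ Nat.find_spec hex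
  have hm0 : N ^ m ≠ 0 := Nat.find_min hex (by omega)
  -- Polarization: `B(N^m u, v)` is symmetric, so if its quadratic form vanished, non-degeneracy
  -- would force `N^m = 0`.
  obtain ⟨u, hu⟩ : ∃ u, B ((N ^ m) u) u ≠ 0 := by
    by_contra hc
    push Not at hc
    refine hm0 (LinearMap.ext fun u => hBn _ fun v => ?_)
    have h := hc (u + v)
    simp only [map_add, LinearMap.add_apply, hc, zero_add, add_zero] at h
    rw [B.pow_apply_left hN m v u, hB v, ← two_mul] at h
    exact (mul_eq_zero.1 h).resolve_left h2
  obtain ⟨w, hw⟩ := exists_chain_of_pow_apply_ne_zero h2 B hN hm1 hu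
  exact ⟨m, _, w, hu, hm1, hw⟩

/-- The chain is listed backwards, with `ψ (m - p)` in position `p`, so that ones above the diagonal
send each vector to its predecessor. Column 0 has no such one, which is consistent because `ψ (m +
1) = 0`. -/
theorem sum_shift_smul {R W : Type*} [Ring R] [AddCommGroup W] [Module R W] (m : ℕ) (ψ : ℕ → W)
    (hψ : ψ (m + 1) = 0) (x : R) (p : Fin (m + 1)) :
    ∑ q : Fin (m + 1), (if q = p then x else if (q : ℕ) + 1 = p then 1 else 0) • ψ (m - q) =
      x • ψ (m - p) + ψ (m - p + 1) := by
  have h1 : ∀ q : Fin (m + 1),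
      (if q = p then x else if (q : ℕ) + 1 = p then 1 else 0) • ψ (m - q) =
      (if q = p then x • ψ (m - p) else 0) + (if (q : ℕ) + 1 = p then ψ (m - p + 1) else 0) := by
    intro q
    split_ifs with h1 h2 h2
    · subst h1; omega
    · subst h1; rw [add_zero]
    · rw [one_smul, zero_add]
      congr 1
      omega
    · simp
  rw [Finset.sum_congr rfl fun q _ => h1 q, Finset.sum_add_distrib, Finset.sum_ite_eq' ]
  simp only [Finset.mem_univ, if_true]
  congr 1
  rcases p with ⟨p, hp⟩
  rcases p with _ | p
  · simp only [Nat.add_eq_zero_iff, one_ne_zero, and_false, if_false, Finset.sum_const_zero]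
    rw [Nat.sub_zero, hψ]
  · rw [Finset.sum_eq_single ⟨p, by omega⟩]
    · simp
    · intro q _ hq
      refine if_neg fun h => hq ?_
      ext
      simpa using h
    · simp

end Chains

/-! ### Petrov blocks -/

/-- The blocks of Petrov normal forms. -/
inductive PetrovBlock
  | real (lam : ℝ) (m : ℕ) (eps : ℤ)
  | complex (alpha beta : ℝ) (n : ℕ)

namespace PetrovBlock

/-- The positions in a block. -/
@[reducible] def Idx : PetrovBlock → Type
  | real _ m _ => Fin m
  | complex _ _ n => Fin n × Fin 2

instance (b : PetrovBlock) : Fintype b.Idx := by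
  cases b <;> infer_instance

instance (b : PetrovBlock) : DecidableEq b.Idx := by
  cases b <;> infer_instance

/-- The matrix of the operator in a block. -/
def op : (b : PetrovBlock) → Matrix b.Idx b.Idx ℝ
  | real lam m _ => jordanBlock m lam
  | complex alpha beta n => complexBlock n alpha beta

/-- The matrix of the form in a block. -/
def form : (b : PetrovBlock) → Matrix b.Idx b.Idx ℝ
  | real _ m eps => (eps : ℝ) • antiDiagOne m
  | complex _ _ n => complexFormBlock n

/-- The restrictions on the data of a block. -/
def Valid : PetrovBlock → Prop
  | real _ m eps => 0 < m ∧ (eps = 1 ∨ eps = -1)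
  | complex _ beta n => 0 < beta ∧ 0 < n

/-- Makes the form of a block visibly invertible; `IsChain.eq_zero_of_inner_eq_zero` rests on it. -/
theorem form_mul_form {b : PetrovBlock} (hb : b.Valid) : b.form * b.form = 1 := by
  rcases b with ⟨lam, m, eps⟩ | ⟨alpha, beta, n⟩
  · ext p q
    have h1 : (eps : ℝ) * eps = 1 := by
      rcases hb.2 with h | h <;> simp [h]
    simp only [form, antiDiagOne, Matrix.smul_mul, Matrix.mul_smul, smul_smul, h1, one_smul]
    rw [Matrix.mul_apply, Matrix.one_apply, Finset.sum_eq_single (Fin.rev p)]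
    · simp [eq_comm]
    · intro r _ hr
      simp [hr]
    · simp
  · ext ⟨p, i⟩ ⟨q, j⟩
    simp only [form, complexFormBlock]
    rw [Matrix.mul_apply, Matrix.one_apply, Fintype.sum_prod_type, Finset.sum_eq_single p.rev]
    · by_cases h : q = p
      · subst h
        fin_cases i <;> fin_cases j <;> simp
      · simp [h, Ne.symm h]
    · intro r _ hr
      simp [hr]
    · simp

/-- The vectors `φ` are a basis of a copy of the block `b` in `(T, B)`. -/
structure IsChain {V : Type*} [AddCommGroup V] [Module ℝ V] (T : V →ₗ[ℝ] V)
    (B : LinearMap.BilinForm ℝ V) (b : PetrovBlock) (φ : b.Idx → V) : Prop where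
  apply_eq : ∀ p, T (φ p) = ∑ q, b.op q p • φ q
  inner_eq : ∀ p q, B (φ p) (φ q) = b.form p q

end PetrovBlock

/-! ### Existence of blocks -/

namespace PetrovBlock

open Module

/-- The form on the vectors `N ^ (m - p) w` of a chain is anti-diagonal. -/
theorem inner_chain {F V : Type*} [Field F] [AddCommGroup V] [Module F V]
    (B : LinearMap.BilinForm F V) {N : V →ₗ[F] V} (hN : ∀ u v, B (N u) v = B u (N v)) {m : ℕ}
    {c : F} {w : V} (hw : ∀ k, B ((N ^ k) w) w = if k = m then c else 0) (p q : Fin (m + 1)) :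
    B ((N ^ (m - (p : ℕ))) w) ((N ^ (m - (q : ℕ))) w) = if q = p.rev then c else 0 := by
  rw [B.pow_apply_pow hN, hw]
  refine if_congr ?_ rfl rfl
  rw [Fin.ext_iff, Fin.val_rev]
  omega

variable {V : Type*} [AddCommGroup V] [Module ℝ V]

/-- Over ℝ, rescaling the generator multiplies the constant `c` of the chain by a positive square,
so it can be normalized to `±1` but keeps its sign. That sign is `ε`. -/
theorem exists_isChain_real [Nontrivial V] (T : V →ₗ[ℝ] V) (B : LinearMap.BilinForm ℝ V)
    (hB : ∀ u v, B u v = B v u) (hBn : ∀ u, (∀ v, B u v = 0) → u = 0)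
    (hT : ∀ u v, B (T u) v = B u (T v)) {lam : ℝ} (hnil : IsNilpotent (T - lam • (1 : End ℝ V))) :
    ∃ (b : PetrovBlock) (φ : b.Idx → V), b.Valid ∧ b.IsChain T B φ ∧ Nonempty b.Idx := by
  set N : V →ₗ[ℝ] V := T - lam • (1 : End ℝ V) with hNdef
  have hN : ∀ u v, B (N u) v = B u (N v) := by
    intro u v
    simp [hNdef, hT]
  obtain ⟨m, c, w, hc, hm, hw⟩ := exists_chain_of_isNilpotent two_ne_zero B hB hBn hN hnil
  obtain ⟨eps, heps, z, hz⟩ : ∃ eps : ℤ, (eps = 1 ∨ eps = -1) ∧ ∃ z : ℝ, z * z * c = eps := by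
    have h1 : (√|c|)⁻¹ * (√|c|)⁻¹ = |c|⁻¹ := by
      rw [← mul_inv, Real.mul_self_sqrt (abs_nonneg c)]
    rcases lt_or_gt_of_ne hc with h | h
    · refine ⟨-1, Or.inr rfl, (√|c|)⁻¹, ?_⟩
      rw [h1, abs_of_neg h, inv_neg, neg_mul, inv_mul_cancel₀ hc]; simp
    · refine ⟨1, Or.inl rfl, (√|c|)⁻¹, ?_⟩
      rw [h1, abs_of_pos h, inv_mul_cancel₀ hc]; simp
  have hw' : ∀ k, B ((N ^ k) (z • w)) (z • w) = if k = m then (eps : ℝ) else 0 := by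
    intro k
    simp only [map_smul, LinearMap.smul_apply, smul_eq_mul, hw, ← hz]
    split_ifs <;> ring
  refine ⟨real lam (m + 1) eps, fun p => (N ^ (m - (p : ℕ))) (z • w), ⟨m.succ_pos, heps⟩,
    ⟨fun p => ?_, fun p q => ?_⟩, ⟨(0 : Fin (m + 1))⟩⟩
  · have h := sum_shift_smul m (fun k => (N ^ k) (z • w)) (by simp only [hm]; rfl) lam p
    simp only [op, jordanBlock, Matrix.of_apply]
    refine Eq.trans ?_ h.symm
    rw [pow_succ', Module.End.mul_apply]
    generalize (N ^ (m - (p : ℕ))) (z • w) = v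
    simp [hNdef]
  · refine (inner_chain B hN hw' p q).trans ?_
    simp [form, antiDiagOne]

theorem _root_.LinearMap.BilinForm.aeval_apply_left (B : LinearMap.BilinForm ℝ V) {T : V →ₗ[ℝ] V}
    (hT : ∀ u v, B (T u) v = B u (T v)) (p : Polynomial ℝ) (u v : V) :
    B (Polynomial.aeval T p u) v = B u (Polynomial.aeval T p v) := by
  induction p using Polynomial.induction_on' with
  | add p q hp hq => simp [hp, hq]
  | monomial k c =>
    rw [Polynomial.aeval_monomial, Module.End.mul_apply, Module.End.mul_apply,
      Module.algebraMap_end_apply, Module.algebraMap_end_apply, map_smul, LinearMap.smul_apply,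
      map_smul, B.pow_apply_left hT]

/-- An operator annihilated by a power of `(X - α) ^ 2 + β ^ 2` is, up to a nilpotent operator,
`α + β J` for a complex structure `J` that is a polynomial in it. -/
theorem exists_complex_structure (T : V →ₗ[ℝ] V) {alpha beta : ℝ} (hbeta : 0 < beta)
    (hnil : IsNilpotent ((T - alpha • (1 : End ℝ V)) ^ 2 + beta ^ 2 • (1 : End ℝ V))) :
    ∃ p : Polynomial ℝ, Polynomial.aeval T p * Polynomial.aeval T p = -1 ∧
      IsNilpotent (T - alpha • (1 : End ℝ V) - beta • Polynomial.aeval T p) := by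
  -- Working in the commutative algebra `ℝ[T]` makes the root `j` found below a polynomial in `T`.
  let A := (Polynomial.aeval (R := ℝ) (T : End ℝ V)).range
  let I : CommRing A := { (inferInstance : Ring A) with
    mul_comm := by
      rintro ⟨_, p, rfl⟩ ⟨_, q, rfl⟩
      apply Subtype.ext
      show Polynomial.aeval T p * Polynomial.aeval T q = Polynomial.aeval T q * Polynomial.aeval T p
      rw [← map_mul, mul_comm, map_mul] }
  let t : A := ⟨T, Polynomial.X, Polynomial.aeval_X _⟩
  -- `a = (T - α)/β` is a root of `X² + 1` up to a nilpotent error, and Newton's method corrects it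
  -- to an exact root `j` with `a - j` nilpotent.
  let a : A := beta⁻¹ • (t - alpha • 1)
  have hnil' : IsNilpotent (a ^ 2 + 1) := by
    have h1 : a ^ 2 + 1 = (beta⁻¹) ^ 2 • ((t - alpha • 1) ^ 2 + beta ^ 2 • 1) := by
      rw [smul_add, smul_smul, ← mul_pow, inv_mul_cancel₀ hbeta.ne', one_pow, one_smul, smul_pow]
    rw [h1]
    refine IsNilpotent.smul ?_ _
    obtain ⟨k, hk⟩ := hnil
    exact ⟨k, Subtype.ext hk⟩
  have hunit : IsUnit (Polynomial.aeval a
      (Polynomial.derivative (Polynomial.X ^ 2 + 1 : Polynomial ℝ))) := by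
    have h2 : Polynomial.aeval a (Polynomial.derivative (Polynomial.X ^ 2 + 1 : Polynomial ℝ)) =
        (2 : ℝ) • a := by
      simp [two_smul, one_add_one_eq_two]
      rw [map_ofNat, two_mul]
    rw [h2]
    -- `a² = -(1 - nilpotent)`, so the derivative `2 a` is a unit.
    have h3 : IsUnit (a * a) := by
      have : a * a = -(1 - (a ^ 2 + 1)) := by ring
      rw [this]
      exact (hnil'.isUnit_one_sub).neg
    exact (isUnit_of_mul_isUnit_left h3).smul (Units.mk0 (2 : ℝ) two_ne_zero)
  obtain ⟨j, ⟨hj1, hj2⟩, -⟩ := Polynomial.existsUnique_nilpotent_sub_and_aeval_eq_zero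
    (P := (Polynomial.X ^ 2 + 1 : Polynomial ℝ)) (x := a) (by simpa using hnil') hunit
  have h4 : j * j = -1 := by
    have : j ^ 2 + 1 = 0 := by simpa using hj2
    rw [← sq]; exact eq_neg_of_add_eq_zero_left this
  have h5 : t - alpha • 1 - beta • j = beta • (a - j) := by
    rw [smul_sub, smul_smul, mul_inv_cancel₀ hbeta.ne', one_smul]
  obtain ⟨k, hk⟩ := hj1.smul beta
  rw [← h5] at hk
  obtain ⟨_, p, rfl⟩ := j
  exact ⟨p, congrArg Subtype.val h4, k, congrArg Subtype.val hk⟩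

/-- With `J` as multiplication by `i`, the form `B(u, v) - i B(J u, v)` is complex bilinear,
symmetric and non-degenerate, and `N` is complex linear and self-adjoint for it. The chain lemma
over ℂ applies; the two conclusions about `B` are its real and imaginary parts. -/
theorem exists_chain_of_complex_structure [Nontrivial V] (B : LinearMap.BilinForm ℝ V)
    (hB : ∀ u v, B u v = B v u) (hBn : ∀ u, (∀ v, B u v = 0) → u = 0)
    {N J : End ℝ V} (hN : ∀ u v, B (N u) v = B u (N v)) (hJ : ∀ u v, B (J u) v = B u (J v))
    (hNJ : N * J = J * N) (hJJ : J * J = -1) (hnil : IsNilpotent N) :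
    ∃ (m : ℕ) (w : V), N ^ (m + 1) = 0 ∧ (∀ k, B ((N ^ k) w) w = if k = m then -1 else 0) ∧
      ∀ k, B (J ((N ^ k) w)) w = 0 := by
  let _ : Module ℂ V := Module.compHom V (Complex.liftAux J hJJ).toRingHom
  have hsmul : ∀ (z : ℂ) (v : V), z • v = z.re • v + z.im • J v := fun z v => rfl
  have hJJ' : ∀ v, J (J v) = -v := fun v => LinearMap.congr_fun hJJ v
  have hNJ' : ∀ v, N (J v) = J (N v) := fun v => LinearMap.congr_fun hNJ v
  let Nc : V →ₗ[ℂ] V :=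
    { toFun := N
      map_add' := map_add N
      map_smul' := fun z v => by
        simp only [hsmul, map_add, map_smul, hNJ', RingHom.id_apply] }
  have hpow : ∀ k v, (Nc ^ k) v = (N ^ k) v := by
    intro k
    induction k with
    | zero => exact fun v => rfl
    | succ k ih =>
      intro v
      rw [pow_succ', pow_succ', Module.End.mul_apply, Module.End.mul_apply, ih]
      rfl
  let Bc : LinearMap.BilinForm ℂ V := LinearMap.mk₂ ℂ (fun u v => (⟨B u v, -B (J u) v⟩ : ℂ))
    (fun u u' v => by apply Complex.ext <;> simp; ring)
    (fun z u v => by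
      apply Complex.ext
      · simp [hsmul]
      · simp [hsmul, hJJ']; ring)
    (fun u v v' => by apply Complex.ext <;> simp; ring)
    (fun z u v => by
      apply Complex.ext
      · simp [hsmul, hJ]
      · simp [hsmul, ← hJ, hJJ']; ring)
  have hBc : ∀ u v, Bc u v = ⟨B u v, -B (J u) v⟩ := fun u v => rfl
  obtain ⟨m, c, w, hc, hm, hw⟩ := exists_chain_of_isNilpotent (two_ne_zero : (2 : ℂ) ≠ 0) Bc
    (fun u v => by rw [hBc, hBc, hB u v, hJ u v, hB u])
    (fun u hu => hBn u fun v => congrArg Complex.re (hu v))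
    (N := Nc) (fun u v => by
      show (⟨B (N u) v, -B (J (N u)) v⟩ : ℂ) = ⟨B u (N v), -B (J u) (N v)⟩
      rw [hN, ← hNJ', hN])
    (by
      obtain ⟨k, hk⟩ := hnil
      exact ⟨k, LinearMap.ext fun v => by rw [hpow, hk]; rfl⟩)
  -- Every non-zero constant is a square over ℂ, so no sign survives. The value `-1` matches the
  -- entry `-1` of the form block.
  obtain ⟨z, hz⟩ := IsAlgClosed.exists_pow_nat_eq (-c⁻¹) (n := 2) two_pos
  have hw' : ∀ k, Bc ((Nc ^ k) (z • w)) (z • w) = if k = m then -1 else 0 := by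
    intro k
    simp only [map_smul, LinearMap.smul_apply, smul_eq_mul, hw]
    split_ifs
    · rw [← mul_assoc, ← sq, hz, neg_mul, inv_mul_cancel₀ hc]
    · simp
  refine ⟨m, z • w, LinearMap.ext fun v => by rw [← hpow, hm]; rfl, fun k => ?_, fun k => ?_⟩
  · have h := congrArg Complex.re (hw' k)
    rw [hpow] at h
    refine h.trans ?_
    split_ifs <;> simp
  · have h := congrArg Complex.im (hw' k)
    rw [hpow] at h
    have h' : -B (J ((N ^ k) (z • w))) (z • w) = 0 := by
      refine h.trans ?_
      split_ifs <;> simp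
    exact neg_eq_zero.1 h'

/-- Write `T = α + β J + N`. The vectors `N^(m-p) w` and `J N^(m-p) w` form the `p`-th pair: `α + β
J` gives the diagonal `2 × 2` blocks and `N` the identity blocks above them. -/
theorem exists_isChain_complex [Nontrivial V] (T : V →ₗ[ℝ] V) (B : LinearMap.BilinForm ℝ V)
    (hB : ∀ u v, B u v = B v u) (hBn : ∀ u, (∀ v, B u v = 0) → u = 0)
    (hT : ∀ u v, B (T u) v = B u (T v)) {alpha beta : ℝ} (hbeta : 0 < beta)
    (hnil : IsNilpotent ((T - alpha • (1 : End ℝ V)) ^ 2 + beta ^ 2 • (1 : End ℝ V))) :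
    ∃ (b : PetrovBlock) (φ : b.Idx → V), b.Valid ∧ b.IsChain T B φ ∧ Nonempty b.Idx := by
  obtain ⟨p, hJ, hJnil⟩ := exists_complex_structure T hbeta hnil
  have hJs := B.aeval_apply_left hT p
  have hTJ : T * Polynomial.aeval T p = Polynomial.aeval T p * T := by
    have h := map_mul (Polynomial.aeval (R := ℝ) T) Polynomial.X p
    rw [mul_comm, map_mul, Polynomial.aeval_X] at h
    exact h.symm
  generalize Polynomial.aeval T p = J at hJ hJnil hJs hTJ
  set N : End ℝ V := T - alpha • (1 : End ℝ V) - beta • J with hNdef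
  have hN : ∀ u v, B (N u) v = B u (N v) := by
    intro u v
    simp [hNdef, hT, hJs]
  have hNJ : N * J = J * N := by
    simp [hNdef, sub_mul, mul_sub, hTJ]
  have hTv : ∀ v, T v = alpha • v + beta • J v + N v := by
    intro v
    simp [hNdef]
  obtain ⟨m, w, hm, hw, hw'⟩ := exists_chain_of_complex_structure B hB hBn hN hJs hNJ hJ hJnil
  have hJJ' : ∀ v, J (J v) = -v := fun v => LinearMap.congr_fun hJ v
  have hNJ' : ∀ v, N (J v) = J (N v) := fun v => LinearMap.congr_fun hNJ v
  let φ : Fin (m + 1) × Fin 2 → V := fun q =>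
    if q.2 = 0 then (N ^ (m - (q.1 : ℕ))) w else J ((N ^ (m - (q.1 : ℕ))) w)
  have hsum : ∀ (x y : Fin 2 → ℝ) (p : Fin (m + 1)),
      ∑ q : Fin (m + 1), ∑ i : Fin 2,
        (if q = p then x i else if (q : ℕ) + 1 = p then y i else 0) • φ (q, i) =
      ∑ q : Fin (m + 1), (if q = p then x 0 else if (q : ℕ) + 1 = p then y 0 else 0) •
        (N ^ (m - (q : ℕ))) w + J (∑ q : Fin (m + 1),
          (if q = p then x 1 else if (q : ℕ) + 1 = p then y 1 else 0) • (N ^ (m - (q : ℕ))) w) := by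
    intro x y p
    rw [map_sum, ← Finset.sum_add_distrib]
    refine Finset.sum_congr rfl fun q _ => ?_
    rw [Fin.sum_univ_two, map_smul]
    rfl
  have hone : ∀ (x : ℝ) (p : Fin (m + 1)), ∑ q : Fin (m + 1),
      (if q = p then x else if (q : ℕ) + 1 = p then 1 else 0) • (N ^ (m - (q : ℕ))) w =
        x • (N ^ (m - (p : ℕ))) w + N ((N ^ (m - (p : ℕ))) w) := by
    intro x p
    have h := sum_shift_smul m (fun k => (N ^ k) w) (by simp only [hm]; rfl) x p
    refine h.trans ?_
    rw [pow_succ', Module.End.mul_apply]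
  have hnone : ∀ (x : ℝ) (p : Fin (m + 1)), ∑ q : Fin (m + 1),
      (if q = p then x else if (q : ℕ) + 1 = p then 0 else 0) • (N ^ (m - (q : ℕ))) w =
        x • (N ^ (m - (p : ℕ))) w := by
    intro x p
    simp only [ite_self, ite_smul, zero_smul, Finset.sum_ite_eq', Finset.mem_univ, if_true]
  refine ⟨complex alpha beta (m + 1), φ, ⟨hbeta, m.succ_pos⟩,
    ⟨?_, ?_⟩, ⟨((0 : Fin (m + 1)), (0 : Fin 2))⟩⟩
  · rintro ⟨p, i⟩
    rw [Fintype.sum_prod_type]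
    refine Eq.trans ?_ (hsum (fun j => (!![alpha, -beta; beta, alpha] : Matrix _ _ ℝ) j i)
      (fun j => (1 : Matrix (Fin 2) (Fin 2) ℝ) j i) p).symm
    obtain rfl | rfl : i = 0 ∨ i = 1 := by omega
    · simp only [Fin.isValue, Matrix.one_apply_eq, Matrix.of_apply, Matrix.cons_val',
        Matrix.cons_val_zero, Matrix.cons_val_one, Matrix.cons_val_fin_one, hone, ne_eq, one_ne_zero,
        not_false_eq_true, Matrix.one_apply_ne, hnone, map_smul]
      rw [show φ (p, 0) = (N ^ (m - (p : ℕ))) w from rfl, hTv]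
      abel
    · simp only [Fin.isValue, Matrix.one_apply_eq, Matrix.of_apply, Matrix.cons_val',
        Matrix.cons_val_zero, Matrix.cons_val_one, Matrix.cons_val_fin_one, hone, ne_eq, zero_ne_one,
        not_false_eq_true, Matrix.one_apply_ne, hnone, map_smul, map_add]
      rw [show φ (p, 1) = J ((N ^ (m - (p : ℕ))) w) from rfl, hTv, hJJ', hNJ']
      simp only [smul_neg, neg_smul]
      abel
  · have h00 := inner_chain B hN hw
    have h01 : ∀ p q : Fin (m + 1),
        B (J ((N ^ (m - (p : ℕ))) w)) ((N ^ (m - (q : ℕ))) w) = 0 := by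
      intro p q
      have h : ∀ v, (N ^ (m - (q : ℕ))) (J v) = J ((N ^ (m - (q : ℕ))) v) := fun v =>
        LinearMap.congr_fun (Commute.pow_left hNJ (m - (q : ℕ))).eq v
      rw [← B.pow_apply_left hN, h, ← Module.End.mul_apply (N ^ _), ← pow_add, hw']
    rintro ⟨p, i⟩ ⟨q, j⟩
    simp only [form, complexFormBlock, Matrix.of_apply]
    obtain rfl | rfl : i = 0 ∨ i = 1 := by omega
    all_goals obtain rfl | rfl : j = 0 ∨ j = 1 := by omega
    · refine (h00 p q).trans ?_
      simp
    · refine (hB _ _).trans ((h01 q p).trans ?_)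
      simp
    · refine (h01 p q).trans ?_
      simp
    -- `B(J u, J v) = B(u, J² v) = -B(u, v)` accounts for the opposite signs in the form block.
    · refine (hJs _ _).trans ?_
      refine (congrArg _ (hJJ' _)).trans ?_
      rw [map_neg, h00 p q]
      split_ifs <;> simp

end PetrovBlock

/-! ### Decomposition into blocks -/

namespace PetrovBlock

open Module

theorem IsChain.map {V V' : Type*} [AddCommGroup V] [Module ℝ V] [AddCommGroup V'] [Module ℝ V']
    {T : V →ₗ[ℝ] V} {B : LinearMap.BilinForm ℝ V} {T' : V' →ₗ[ℝ] V'}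
    {B' : LinearMap.BilinForm ℝ V'} {b : PetrovBlock} {φ : b.Idx → V'} (h : b.IsChain T' B' φ)
    (f : V' →ₗ[ℝ] V) (hT : ∀ v, T (f v) = f (T' v)) (hB : ∀ u v, B (f u) (f v) = B' u v) :
    b.IsChain T B (fun p => f (φ p)) where
  apply_eq p := by
    rw [hT, h.apply_eq, map_sum]
    simp only [map_smul]
  inner_eq p q := by rw [hB, h.inner_eq]

variable {V : Type*} [AddCommGroup V] [Module ℝ V]

/-- The Gram matrix of a chain is invertible. This gives both linear independence of the chain and
non-degeneracy of its span. -/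
theorem IsChain.eq_zero_of_inner_eq_zero {T : V →ₗ[ℝ] V} {B : LinearMap.BilinForm ℝ V}
    {b : PetrovBlock} {φ : b.Idx → V} (h : b.IsChain T B φ) (hb : b.Valid) {c : b.Idx → ℝ}
    (hc : ∀ q, B (∑ p, c p • φ p) (φ q) = 0) : c = 0 := by
  have h1 : Matrix.vecMul c b.form = 0 := by
    funext q
    have := hc q
    simp only [map_sum, map_smul, LinearMap.sum_apply, LinearMap.smul_apply, smul_eq_mul,
      h.inner_eq] at this
    exact this
  have h2 : Matrix.vecMul (Matrix.vecMul c b.form) b.form = c := by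
    rw [Matrix.vecMul_vecMul, form_mul_form hb, Matrix.vecMul_one]
  rw [← h2, h1, Matrix.zero_vecMul]

/-- A non-injective self-adjoint operator commuting with `T` is nilpotent on a non-trivial
non-degenerate `T`-invariant subspace. -/
theorem exists_nondegenerate_nilpotent_subspace [FiniteDimensional ℝ V] (T f : End ℝ V)
    (B : LinearMap.BilinForm ℝ V) (hBn : ∀ u, (∀ v, B u v = 0) → u = 0) (hf : ∀ u v, B (f u) v = B u (f v)) (hfT : Commute f T)
    (hinj : ¬ Function.Injective f) :
    ∃ (W : Submodule ℝ V) (k : ℕ), W ≠ ⊥ ∧ (∀ v ∈ W, T v ∈ W) ∧ (∀ v ∈ W, (f ^ k) v = 0) ∧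
      ∀ u ∈ W, (∀ v ∈ W, B u v = 0) → u = 0 := by
  -- Fitting decomposition; `k ≥ 1` ensures that `ker (f ^ k)` contains the non-trivial `ker f`.
  obtain ⟨k, hk, hk1⟩ := (f.eventually_isCompl_ker_pow_range_pow.and
    (Filter.eventually_ge_atTop 1)).exists
  refine ⟨LinearMap.ker (f ^ k), k, ?_, ?_, fun v hv => hv, ?_⟩
  · intro h0
    apply hinj
    rw [← LinearMap.ker_eq_bot, ← le_bot_iff, ← h0]
    intro v hv
    rw [LinearMap.mem_ker] at hv ⊢
    obtain ⟨l, rfl⟩ := Nat.exists_eq_add_of_le' hk1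
    rw [pow_succ, Module.End.mul_apply, hv, map_zero]
  · intro v hv
    rw [LinearMap.mem_ker] at hv ⊢
    have := LinearMap.congr_fun (hfT.pow_left k).eq v
    rw [Module.End.mul_apply, Module.End.mul_apply, hv, map_zero] at this
    exact this
  -- Self-adjointness makes `ker (f ^ k)` orthogonal to `range (f ^ k)`, so a vector of the kernel
  -- orthogonal to the kernel is orthogonal to everything.
  · intro u hu hu'
    refine hBn u fun v => ?_
    obtain ⟨v₁, h₁, v₂, ⟨w, rfl⟩, rfl⟩ := Submodule.mem_sup.1
      (hk.sup_eq_top ▸ Submodule.mem_top : v ∈ LinearMap.ker (f ^ k) ⊔ LinearMap.range (f ^ k))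
    rw [map_add, hu' v₁ h₁, ← B.pow_apply_left hf, LinearMap.mem_ker.1 hu]
    simp

/-- If `q(T)` were injective, the complementary factor would already annihilate `T`, against
minimality of the degree. -/
theorem not_injective_aeval_of_dvd_minpoly [FiniteDimensional ℝ V] (T : End ℝ V)
    {q : Polynomial ℝ} (hq : q ∣ minpoly ℝ T) (hdeg : 0 < q.natDegree) :
    ¬ Function.Injective (Polynomial.aeval T q) := by
  intro hinj
  obtain ⟨g, hg⟩ := hq
  have hne : minpoly ℝ T ≠ 0 := minpoly.ne_zero (Algebra.IsIntegral.isIntegral T)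
  have hg0 : g ≠ 0 := by rintro rfl; exact hne (by rw [hg, mul_zero])
  have hq0 : q ≠ 0 := by rintro rfl; exact hne (by rw [hg, zero_mul])
  have h1 : Polynomial.aeval T g = 0 := by
    refine LinearMap.ext fun v => hinj ?_
    rw [← Module.End.mul_apply, ← map_mul, ← hg, minpoly.aeval]
    simp
  have h2 := minpoly.degree_le_of_ne_zero ℝ T hg0 h1
  have h3 := Polynomial.natDegree_le_natDegree h2
  rw [hg, Polynomial.natDegree_mul hq0 hg0] at h3
  omega

/-- A complex root of the minimal polynomial gives a real factor `q`, linear or quadratic. On the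
generalized kernel of `q(T)`, which is non-degenerate and invariant, the real or the complex
construction of chains applies. -/
theorem exists_isChain [FiniteDimensional ℝ V] [Nontrivial V] (T : End ℝ V)
    (B : LinearMap.BilinForm ℝ V) (hB : ∀ u v, B u v = B v u)
    (hBn : ∀ u, (∀ v, B u v = 0) → u = 0) (hT : ∀ u v, B (T u) v = B u (T v)) :
    ∃ (b : PetrovBlock) (φ : b.Idx → V), b.Valid ∧ b.IsChain T B φ ∧ Nonempty b.Idx := by
  have hlift : ∀ q : Polynomial ℝ, q ∣ minpoly ℝ T → 0 < q.natDegree →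
      (∀ (W : Submodule ℝ V) (hW : ∀ v ∈ W, T v ∈ W) (k : ℕ), Nontrivial W →
        (∀ v ∈ W, (Polynomial.aeval T q ^ k) v = 0) →
        (∀ u v, B.restrict W u v = B.restrict W v u) →
        (∀ u, (∀ v, B.restrict W u v = 0) → u = 0) →
        (∀ u v, B.restrict W (T.restrict hW u) v = B.restrict W u (T.restrict hW v)) →
        ∃ (b : PetrovBlock) (φ : b.Idx → W), b.Valid ∧ b.IsChain (T.restrict hW) (B.restrict W) φ ∧
          Nonempty b.Idx) →
      ∃ (b : PetrovBlock) (φ : b.Idx → V), b.Valid ∧ b.IsChain T B φ ∧ Nonempty b.Idx := by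
    intro q hq hdeg h
    obtain ⟨W, k, hW0, hWT, hWk, hWn⟩ := exists_nondegenerate_nilpotent_subspace T
      (Polynomial.aeval T q) B hBn (B.aeval_apply_left hT q)
      (by
        have := (Polynomial.commute_X q).map (Polynomial.aeval T)
        rw [Polynomial.aeval_X] at this
        exact this.symm)
      (not_injective_aeval_of_dvd_minpoly T hq hdeg)
    obtain ⟨b, φ, hb, hφ, hne⟩ := h W hWT k (Submodule.nontrivial_iff_ne_bot.2 hW0) hWk
      (fun u v => hB _ _)
      (fun u hu => Subtype.ext (hWn u u.2 fun v hv => hu ⟨v, hv⟩)) (fun u v => hT _ _)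
    exact ⟨b, _, hb, hφ.map W.subtype (fun v => rfl) (fun u v => rfl), hne⟩
  have hdeg : (minpoly ℝ T).degree ≠ 0 :=
    (minpoly.degree_pos (Algebra.IsIntegral.isIntegral T)).ne'
  obtain ⟨z, hz⟩ := IsAlgClosed.exists_aeval_eq_zero ℂ (minpoly ℝ T) hdeg
  by_cases him : z.im = 0
  · have hz' : z = algebraMap ℝ ℂ z.re := Complex.ext rfl him
    have hroot : (minpoly ℝ T).IsRoot z.re := by
      rw [hz', Polynomial.aeval_algebraMap_apply, Polynomial.coe_aeval_eq_eval] at hz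
      exact (algebraMap ℝ ℂ).injective (by rw [hz, map_zero])
    refine hlift (Polynomial.X - Polynomial.C z.re) (Polynomial.dvd_iff_isRoot.2 hroot)
      (by rw [Polynomial.natDegree_X_sub_C]; exact one_pos) ?_
    intro W hW k _ hk h1 h2 h3
    refine exists_isChain_real (T.restrict hW) (B.restrict W) h1 h2 h3 (lam := z.re) ⟨k, ?_⟩
    have hf : ∀ v ∈ W, (T - z.re • (1 : End ℝ V)) v ∈ W := fun v hv =>
      W.sub_mem (hW v hv) (W.smul_mem _ hv)
    have : T.restrict hW - z.re • (1 : End ℝ W) = (T - z.re • (1 : End ℝ V)).restrict hf := rfl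
    rw [this, Module.End.pow_restrict]
    refine LinearMap.ext fun v => Subtype.ext ?_
    have := hk v v.2
    rw [map_sub, Polynomial.aeval_X, Polynomial.aeval_C, Algebra.algebraMap_eq_smul_one] at this
    exact this
  · have hq := Polynomial.quadratic_dvd_of_aeval_eq_zero_im_ne_zero _ hz him
    refine hlift _ hq ?_ ?_
    · have : (Polynomial.X ^ 2 - Polynomial.C (2 * z.re) * Polynomial.X + Polynomial.C (‖z‖ ^ 2) :
          Polynomial ℝ).natDegree = 2 := by compute_degree!
      omega
    intro W hW k _ hk h1 h2 h3
    -- The root may lie in the lower half-plane; the quadratic factor depends only on `|Im z|`.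
    refine exists_isChain_complex (T.restrict hW) (B.restrict W) h1 h2 h3 (alpha := z.re)
      (beta := |z.im|) (abs_pos.2 him) ⟨k, ?_⟩
    have hf₁ : ∀ v ∈ W, (T - z.re • (1 : End ℝ V)) v ∈ W := fun v hv =>
      W.sub_mem (hW v hv) (W.smul_mem _ hv)
    have hf : ∀ v ∈ W, ((T - z.re • (1 : End ℝ V)) ^ 2 + |z.im| ^ 2 • (1 : End ℝ V)) v ∈ W :=
      fun v hv => W.add_mem (hf₁ _ (hf₁ v hv)) (W.smul_mem _ hv)
    have : (T.restrict hW - z.re • (1 : End ℝ W)) ^ 2 + |z.im| ^ 2 • (1 : End ℝ W) =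
      ((T - z.re • (1 : End ℝ V)) ^ 2 + |z.im| ^ 2 • (1 : End ℝ V)).restrict hf := rfl
    rw [this, Module.End.pow_restrict]
    refine LinearMap.ext fun v => Subtype.ext ?_
    have hv := hk v v.2
    have he : Polynomial.aeval T (Polynomial.X ^ 2 - Polynomial.C (2 * z.re) * Polynomial.X +
        Polynomial.C (‖z‖ ^ 2)) =
        (T - z.re • (1 : End ℝ V)) ^ 2 + |z.im| ^ 2 • (1 : End ℝ V) := by
      rw [map_add, map_sub, map_mul, map_pow, Polynomial.aeval_X, Polynomial.aeval_C,
        Polynomial.aeval_C, Algebra.algebraMap_eq_smul_one, Algebra.algebraMap_eq_smul_one,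
        sq_abs, ← Complex.normSq_eq_norm_sq, Complex.normSq_apply]
      simp only [sq, sub_mul, mul_sub, smul_mul_assoc, mul_smul_comm, one_mul, mul_one]
      module
    rw [he] at hv
    exact hv

/-- An orthogonal decomposition of `(T, B)` into blocks. -/
structure IsDecomposition (T : End ℝ V) (B : LinearMap.BilinForm ℝ V) {ι : Type*}
    (L : ι → PetrovBlock) (φ : ∀ i, (L i).Idx → V) : Prop where
  valid : ∀ i, (L i).Valid
  isChain : ∀ i, (L i).IsChain T B (φ i)
  orthogonal : ∀ i j, i ≠ j → ∀ p q, B (φ i p) (φ j q) = 0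
  span_eq_top : Submodule.span ℝ (Set.range fun x : Σ i, (L i).Idx => φ x.1 x.2) = ⊤

/-- The span of one chain is non-degenerate and `T`-invariant, so its orthogonal complement is a
complement, is non-degenerate, and is `T`-invariant by self-adjointness. Its dimension is smaller,
and induction continues there. -/
theorem exists_isDecomposition_of_finrank (d : ℕ) : ∀ (V : Type*) [AddCommGroup V] [Module ℝ V]
    [FiniteDimensional ℝ V] (T : End ℝ V) (B : LinearMap.BilinForm ℝ V), finrank ℝ V = d →
    (∀ u v, B u v = B v u) → (∀ u, (∀ v, B u v = 0) → u = 0) →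
    (∀ u v, B (T u) v = B u (T v)) →
    ∃ (ι : Type) (_ : Fintype ι) (L : ι → PetrovBlock) (φ : ∀ i, (L i).Idx → V),
      IsDecomposition T B L φ := by
  induction d using Nat.strong_induction_on with
  | _ d ih =>
  intro V _ _ _ T B hd hB hBn hT
  rcases subsingleton_or_nontrivial V with hV | hV
  · exact ⟨Empty, inferInstance, fun i => i.elim, fun i => i.elim, fun i => i.elim, fun i => i.elim,
      fun i => i.elim, Subsingleton.elim _ _⟩
  obtain ⟨b, φ, hb, hφ, ⟨p₀⟩⟩ := exists_isChain T B hB hBn hT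
  set W := Submodule.span ℝ (Set.range φ) with hWdef
  have hrefl : B.IsRefl := fun u v h => by rw [hB, h]
  have hW : ∀ u ∈ W, (∀ v ∈ W, B u v = 0) → u = 0 := by
    intro u hu h
    obtain ⟨c, rfl⟩ := (Submodule.mem_span_range_iff_exists_fun ℝ).1 hu
    have := hφ.eq_zero_of_inner_eq_zero hb fun q => h _ (Submodule.subset_span ⟨q, rfl⟩)
    simp [this]
  have hcompl : IsCompl W (B.orthogonal W) :=
    LinearMap.BilinForm.isCompl_orthogonal_of_restrict_nondegenerate hrefl
      ⟨fun u hu => Subtype.ext (hW u u.2 fun v hv => hu ⟨v, hv⟩),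
        fun u hu => Subtype.ext (hW u u.2 fun v hv => by rw [hB]; exact hu ⟨v, hv⟩)⟩
  have hW0 : W ≠ ⊥ := by
    intro h0
    have h1 : φ p₀ = 0 := by
      have : φ p₀ ∈ W := Submodule.subset_span ⟨p₀, rfl⟩
      rwa [h0, Submodule.mem_bot] at this
    have := hφ.eq_zero_of_inner_eq_zero hb (c := Pi.single p₀ 1) (by simp [Pi.single_apply, h1])
    simpa using congrFun this p₀
  set W' := B.orthogonal W with hW'def
  have hφW' : ∀ v ∈ W', ∀ p, B (φ p) v = 0 := fun v hv p => hv _ (Submodule.subset_span ⟨p, rfl⟩)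
  have hTW' : ∀ v ∈ W', T v ∈ W' := by
    intro v hv w hw
    obtain ⟨c, rfl⟩ := (Submodule.mem_span_range_iff_exists_fun ℝ).1 hw
    show B _ _ = 0
    rw [← hT, map_sum, map_sum, LinearMap.sum_apply]
    refine Finset.sum_eq_zero fun p _ => ?_
    rw [map_smul, hφ.apply_eq, map_smul, LinearMap.smul_apply, map_sum, LinearMap.sum_apply,
      Finset.sum_eq_zero, smul_zero]
    intro q _
    rw [map_smul, LinearMap.smul_apply, hφW' v hv, smul_zero]
  have hlt : finrank ℝ W' < d := by
    have h1 := Submodule.finrank_add_eq_of_isCompl hcompl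
    have h2 : 0 < finrank ℝ W := by
      have := Submodule.nontrivial_iff_ne_bot.2 hW0
      exact finrank_pos
    omega
  obtain ⟨ι, hι, L, ψ, hψ⟩ := ih _ hlt W' (T.restrict hTW') (B.restrict W') rfl (fun u v => hB _ _)
    (fun u hu => Subtype.ext (hBn u fun v => by
      obtain ⟨v₁, h₁, v₂, h₂, rfl⟩ := Submodule.mem_sup.1
        (hcompl.sup_eq_top ▸ Submodule.mem_top : v ∈ W ⊔ W')
      rw [map_add, hB _ v₁, u.2 v₁ h₁, zero_add]
      exact hu ⟨v₂, h₂⟩)) (fun u v => hT _ _)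
  let L' : Option ι → PetrovBlock := fun o => o.elim b L
  let φ' : ∀ o, (L' o).Idx → V := fun o => match o with
    | none => φ
    | some i => fun p => (ψ i p : V)
  refine ⟨Option ι, inferInstance, L', φ', ?_, ?_, ?_, ?_⟩
  · rintro (_ | i)
    · exact hb
    · exact hψ.valid i
  · rintro (_ | i)
    · exact hφ
    · exact (hψ.isChain i).map W'.subtype (fun v => rfl) (fun u v => rfl)
  · rintro (_ | i) (_ | j) hij p q
    · exact absurd rfl hij
    · exact hφW' _ (ψ j q).2 p
    · exact (hB _ _).trans (hφW' _ (ψ i p).2 q)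
    · exact hψ.orthogonal i j (fun h => hij (congrArg some h)) p q
  · rw [eq_top_iff, ← hcompl.sup_eq_top]
    refine sup_le ?_ ?_
    · rw [hWdef, Submodule.span_le]
      rintro _ ⟨p, rfl⟩
      exact Submodule.subset_span ⟨⟨none, p⟩, rfl⟩
    · have h1 : Submodule.map W'.subtype ⊤ = W' := by simp
      rw [← h1, ← hψ.span_eq_top, Submodule.map_span, Submodule.span_le]
      rintro _ ⟨_, ⟨⟨i, p⟩, rfl⟩, rfl⟩
      exact Submodule.subset_span ⟨⟨some i, p⟩, rfl⟩

theorem IsDecomposition.linearIndependent {T : End ℝ V} {B : LinearMap.BilinForm ℝ V} {ι : Type*}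
    [Fintype ι] {L : ι → PetrovBlock} {φ : ∀ i, (L i).Idx → V} (h : IsDecomposition T B L φ) :
    LinearIndependent ℝ fun x : Σ i, (L i).Idx => φ x.1 x.2 := by
  rw [Fintype.linearIndependent_iff]
  rintro c hc ⟨i, p⟩
  have h1 := (h.isChain i).eq_zero_of_inner_eq_zero (h.valid i) (c := fun p => c ⟨i, p⟩) (by
    intro q
    have h2 := congrArg (fun v => B v (φ i q)) hc
    simp only [Fintype.sum_sigma, map_sum, LinearMap.sum_apply, map_zero, LinearMap.zero_apply] at h2
    rw [Finset.sum_eq_single i] at h2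
    · rw [map_sum, LinearMap.sum_apply]; exact h2
    · intro j _ hj
      refine Finset.sum_eq_zero fun p _ => ?_
      rw [map_smul, LinearMap.smul_apply, h.orthogonal j i hj, smul_zero]
    · simp)
  exact congrFun h1 p

/-- Existence of a basis in which a self-adjoint operator and a non-degenerate form are block
diagonal with Petrov blocks. -/
theorem exists_basis_blockDiagonal [FiniteDimensional ℝ V] (T : End ℝ V)
    (B : LinearMap.BilinForm ℝ V) (hB : ∀ u v, B u v = B v u)
    (hBn : ∀ u, (∀ v, B u v = 0) → u = 0) (hT : ∀ u v, B (T u) v = B u (T v)) :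
    ∃ (ι : Type) (_ : Fintype ι) (_ : DecidableEq ι) (L : ι → PetrovBlock)
      (e : Basis (Σ i, (L i).Idx) ℝ V), (∀ i, (L i).Valid) ∧
      LinearMap.toMatrix e e T = Matrix.blockDiagonal' (fun i => (L i).op) ∧
      LinearMap.BilinForm.toMatrix e B = Matrix.blockDiagonal' (fun i => (L i).form) := by
  classical
  obtain ⟨ι, _, L, φ, h⟩ := exists_isDecomposition_of_finrank _ V T B rfl hB hBn hT
  let e : Basis (Σ i, (L i).Idx) ℝ V := Basis.mk h.linearIndependent h.span_eq_top.ge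
  have he : ∀ x, e x = φ x.1 x.2 := fun x => Basis.mk_apply _ _ x
  refine ⟨ι, inferInstance, inferInstance, L, e, h.valid, ?_, ?_⟩
  · rw [LinearMap.toMatrix_eq_iff]
    rintro ⟨i, p⟩
    simp only [he, (h.isChain i).apply_eq, Fintype.sum_sigma]
    rw [Finset.sum_eq_single i]
    · simp only [Matrix.blockDiagonal'_apply_eq]
    · intro j _ hj
      refine Finset.sum_eq_zero fun q _ => ?_
      rw [Matrix.blockDiagonal'_apply_ne _ _ _ hj, zero_smul]
    · simp
  · ext ⟨i, p⟩ ⟨j, q⟩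
    rw [LinearMap.BilinForm.toMatrix_apply, he, he]
    by_cases hij : i = j
    · subst hij
      rw [Matrix.blockDiagonal'_apply_eq, (h.isChain i).inner_eq]
    · rw [Matrix.blockDiagonal'_apply_ne _ _ _ hij, h.orthogonal i j hij]

end PetrovBlock

/-! ### Petrov normal forms as families of blocks -/

section Sorting

theorem exists_equiv_fin_monotone {X α : Type*} [Fintype X] [LinearOrder α] (key : X → α) :
    ∃ e : Fin (Fintype.card X) ≃ X, Monotone (key ∘ e) := by
  let e₀ := (Fintype.equivFin X).symm
  exact ⟨(Tuple.sort (key ∘ e₀)).trans e₀, Tuple.monotone_sort (key ∘ e₀)⟩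

/-- A finite type can be listed by grouping its elements by the values of `v`, and sorting each
group by `key`. -/
theorem exists_sigma_fin_equiv_sorted {X A α : Type*} [Fintype X] [LinearOrder α] (v : X → A)
    (key : X → α) :
    ∃ (a : ℕ) (lam : Fin a → A) (s : Fin a → ℕ) (e : (Σ i, Fin (s i)) ≃ X),
      Function.Injective lam ∧ (∀ i, 0 < s i) ∧ (∀ q, v (e q) = lam q.1) ∧
      ∀ i, Monotone fun k => key (e ⟨i, k⟩) := by
  classical
  let g := Fintype.equivFin (Set.range v)
  let f : X → Fin (Fintype.card (Set.range v)) := fun x => g ⟨v x, x, rfl⟩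
  have hf : ∀ x, v x = g.symm (f x) := fun x => by simp [f]
  choose e he using fun i => exists_equiv_fin_monotone (X := {x // f x = i}) fun x => key x
  refine ⟨_, fun i => g.symm i, fun i => Fintype.card {x // f x = i},
    (Equiv.sigmaCongrRight e).trans (Equiv.sigmaFiberEquiv f),
    Subtype.val_injective.comp g.symm.injective, fun i => ?_, ?_, he⟩
  · obtain ⟨x, hx⟩ := (g.symm i).2
    refine Fintype.card_pos_iff.2 ⟨x, ?_⟩
    show g _ = i
    rw [← Equiv.eq_symm_apply]
    exact Subtype.ext hx
  · rintro ⟨i, k⟩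
    show v (e i k : X) = _
    rw [hf, (e i k).2]

end Sorting

namespace PetrovBlock

/-- The real part of the eigenvalue. -/
def re : PetrovBlock → ℝ
  | real lam _ _ => lam
  | complex alpha _ _ => alpha

/-- The imaginary part of the eigenvalue. -/
def im : PetrovBlock → ℝ
  | real _ _ _ => 0
  | complex _ beta _ => beta

/-- The size of the block. -/
def size : PetrovBlock → ℕ
  | real _ m _ => m
  | complex _ _ n => n

/-- The sign of a real block. -/
def sign : PetrovBlock → ℤ
  | real _ _ eps => eps
  | complex _ _ _ => 0

/-- Whether the block belongs to a real eigenvalue. -/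
def IsReal : PetrovBlock → Prop
  | real _ _ _ => True
  | complex _ _ _ => False

theorem IsReal.eq {b : PetrovBlock} (h : b.IsReal) : b = real b.re b.size b.sign := by
  cases b
  · rfl
  · exact h.elim

theorem eq_complex {b : PetrovBlock} (h : ¬ b.IsReal) : b = complex b.re b.im b.size := by
  cases b
  · exact (h trivial).elim
  · rfl

end PetrovBlock

namespace PetrovData

open Module

/-- The positions of the blocks of a Petrov normal form. -/
abbrev BlockIndex (P : PetrovData) : Type :=
  (Σ i : Fin P.a, Fin (P.s i)) ⊕ (Σ j : Fin P.b, Fin (P.t j))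

/-- The blocks of a Petrov normal form. -/
@[reducible] def block (P : PetrovData) : P.BlockIndex → PetrovBlock
  | Sum.inl q => .real (P.lam q.1) (P.m q.1 q.2) (P.eps q.1 q.2)
  | Sum.inr q => .complex (P.alpha q.1) (P.beta q.1) (P.n q.1 q.2)

theorem block_valid (P : PetrovData) (b : P.BlockIndex) : (P.block b).Valid := by
  rcases b with q | q
  · exact ⟨P.m_pos _ _, P.eps_eq _ _⟩
  · exact ⟨P.beta_pos _, P.n_pos _ _⟩

/-- A position in the matrices of a Petrov normal form is a position in one of its blocks. -/
def frameEquiv (P : PetrovData) : P.FrameIndex ≃ Σ b, (P.block b).Idx where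
  toFun
    | Sum.inl ⟨i, k, p⟩ => ⟨Sum.inl ⟨i, k⟩, p⟩
    | Sum.inr ⟨j, l, p⟩ => ⟨Sum.inr ⟨j, l⟩, p⟩
  invFun
    | ⟨Sum.inl ⟨i, k⟩, p⟩ => Sum.inl ⟨i, k, p⟩
    | ⟨Sum.inr ⟨j, l⟩, p⟩ => Sum.inr ⟨j, l, p⟩
  left_inv := by rintro (⟨i, k, p⟩ | ⟨j, l, p⟩) <;> rfl
  right_inv := by rintro ⟨⟨i, k⟩ | ⟨j, l⟩, p⟩ <;> rfl

/-- Stated for an arbitrary family `D` so as to serve the operator and the form alike. -/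
theorem fromBlocks_blockDiagonal'_eq (P : PetrovData)
    (D : (b : P.BlockIndex) → Matrix (P.block b).Idx (P.block b).Idx ℝ) (x y : P.FrameIndex) :
    Matrix.fromBlocks
      (Matrix.blockDiagonal' fun i => Matrix.blockDiagonal' fun k => D (Sum.inl ⟨i, k⟩)) 0 0
      (Matrix.blockDiagonal' fun j => Matrix.blockDiagonal' fun l => D (Sum.inr ⟨j, l⟩)) x y =
    Matrix.blockDiagonal' D (P.frameEquiv x) (P.frameEquiv y) := by
  rcases x with ⟨i, k, p⟩ | ⟨i, k, p⟩ <;> rcases y with ⟨i', k', p'⟩ | ⟨i', k', p'⟩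
  · rw [Matrix.fromBlocks_apply₁₁]
    by_cases h : i = i'
    · subst h
      rw [Matrix.blockDiagonal'_apply_eq]
      by_cases h : k = k'
      · subst h
        rw [Matrix.blockDiagonal'_apply_eq]
        exact (Matrix.blockDiagonal'_apply_eq D _ _ _).symm
      · rw [Matrix.blockDiagonal'_apply_ne _ _ _ h]
        exact (Matrix.blockDiagonal'_apply_ne D _ _ (by simpa using h)).symm
    · rw [Matrix.blockDiagonal'_apply_ne _ _ _ h]
      exact (Matrix.blockDiagonal'_apply_ne D _ _
        (fun h' => h (congrArg Sigma.fst (Sum.inl_injective h')))).symm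
  · exact (Matrix.blockDiagonal'_apply_ne D _ _ (by simp)).symm
  · exact (Matrix.blockDiagonal'_apply_ne D _ _ (by simp)).symm
  · rw [Matrix.fromBlocks_apply₂₂]
    by_cases h : i = i'
    · subst h
      rw [Matrix.blockDiagonal'_apply_eq]
      by_cases h : k = k'
      · subst h
        rw [Matrix.blockDiagonal'_apply_eq]
        exact (Matrix.blockDiagonal'_apply_eq D _ _ _).symm
      · rw [Matrix.blockDiagonal'_apply_ne _ _ _ h]
        exact (Matrix.blockDiagonal'_apply_ne D _ _ (by simpa using h)).symm
    · rw [Matrix.blockDiagonal'_apply_ne _ _ _ h]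
      exact (Matrix.blockDiagonal'_apply_ne D _ _
        (fun h' => h (congrArg Sigma.fst (Sum.inr_injective h')))).symm

theorem opMatrix_apply (P : PetrovData) (x y : P.FrameIndex) :
    P.opMatrix x y =
      Matrix.blockDiagonal' (fun b => (P.block b).op) (P.frameEquiv x) (P.frameEquiv y) :=
  P.fromBlocks_blockDiagonal'_eq (fun b => (P.block b).op) x y

theorem formMatrix_apply (P : PetrovData) (x y : P.FrameIndex) :
    P.formMatrix x y =
      Matrix.blockDiagonal' (fun b => (P.block b).form) (P.frameEquiv x) (P.frameEquiv y) :=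
  P.fromBlocks_blockDiagonal'_eq (fun b => (P.block b).form) x y

end PetrovData

/-! ### Existence of Petrov normal forms. -/

section Existence

open Module

variable {V : Type*} [AddCommGroup V] [Module ℝ V]

theorem LinearMap.toMatrix_reindex_apply {X Y : Type*} [Fintype X] [DecidableEq X] [Fintype Y]
    [DecidableEq Y] (e : Basis X ℝ V) (f : X ≃ Y) (T : V →ₗ[ℝ] V) (x y : X) :
    LinearMap.toMatrix (e.reindex f) (e.reindex f) T (f x) (f y) = LinearMap.toMatrix e e T x y := by
  simp [LinearMap.toMatrix_apply]

theorem HasPetrovNormalForm.exists_basis {T : V →ₗ[ℝ] V} {B : LinearMap.BilinForm ℝ V}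
    {P : PetrovData} (h : HasPetrovNormalForm T B P) :
    ∃ e : Basis (Σ b, (P.block b).Idx) ℝ V,
      LinearMap.toMatrix e e T = Matrix.blockDiagonal' (fun b => (P.block b).op) ∧
      LinearMap.BilinForm.toMatrix e B = Matrix.blockDiagonal' (fun b => (P.block b).form) := by
  obtain ⟨e, h1, h2⟩ := h
  refine ⟨e.reindex P.frameEquiv, ?_, ?_⟩
  · ext x y
    obtain ⟨x, rfl⟩ := P.frameEquiv.surjective x
    obtain ⟨y, rfl⟩ := P.frameEquiv.surjective y
    rw [LinearMap.toMatrix_reindex_apply, h1, P.opMatrix_apply]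
  · ext x y
    obtain ⟨x, rfl⟩ := P.frameEquiv.surjective x
    obtain ⟨y, rfl⟩ := P.frameEquiv.surjective y
    rw [← P.formMatrix_apply, ← h2]
    simp [LinearMap.BilinForm.toMatrix_apply]

theorem hasPetrovNormalForm_of_basis {T : V →ₗ[ℝ] V} {B : LinearMap.BilinForm ℝ V}
    {P : PetrovData} {ι : Type*} [Fintype ι] [DecidableEq ι] {L : ι → PetrovBlock}
    (σ : P.BlockIndex ≃ ι) (hσ : ∀ b, L (σ b) = P.block b) (e : Basis (Σ i, (L i).Idx) ℝ V)
    (hT : LinearMap.toMatrix e e T = Matrix.blockDiagonal' (fun i => (L i).op))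
    (hB : LinearMap.BilinForm.toMatrix e B = Matrix.blockDiagonal' (fun i => (L i).form)) :
    HasPetrovNormalForm T B P := by
  -- Substituting for `L` turns the equalities of blocks, whose index types depend on them, into
  -- definitional ones.
  obtain rfl : L = fun i => P.block (σ.symm i) := by
    funext i
    rw [← hσ, σ.apply_symm_apply]
  let f : (Σ i, (P.block (σ.symm i)).Idx) ≃ P.FrameIndex :=
    (Equiv.sigmaCongrLeft (β := fun b => (P.block b).Idx) σ.symm).trans P.frameEquiv.symm
  have hf : ∀ D : (b : P.BlockIndex) → Matrix (P.block b).Idx (P.block b).Idx ℝ, ∀ x y,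
      Matrix.blockDiagonal' D (P.frameEquiv (f x)) (P.frameEquiv (f y)) =
        Matrix.blockDiagonal' (fun i => D (σ.symm i)) x y := by
    rintro D ⟨i, p⟩ ⟨j, q⟩
    simp only [f, Equiv.trans_apply, Equiv.apply_symm_apply, Equiv.sigmaCongrLeft_apply]
    by_cases h : i = j
    · subst h
      rw [Matrix.blockDiagonal'_apply_eq, Matrix.blockDiagonal'_apply_eq]
    · rw [Matrix.blockDiagonal'_apply_ne _ _ _ h, Matrix.blockDiagonal'_apply_ne]
      exact fun h' => h (σ.symm.injective h')
  refine ⟨e.reindex f, ?_, ?_⟩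
  · ext x y
    obtain ⟨x, rfl⟩ := f.surjective x
    obtain ⟨y, rfl⟩ := f.surjective y
    rw [LinearMap.toMatrix_reindex_apply, hT, P.opMatrix_apply, hf]
  · ext x y
    obtain ⟨x, rfl⟩ := f.surjective x
    obtain ⟨y, rfl⟩ := f.surjective y
    rw [P.formMatrix_apply, hf, ← hB]
    simp [LinearMap.BilinForm.toMatrix_apply]

/-- A family of blocks can be sorted into a Petrov normal form. -/
theorem exists_petrovData {ι : Type*} [Fintype ι] (L : ι → PetrovBlock)
    (hL : ∀ i, (L i).Valid) :
    ∃ (P : PetrovData) (σ : P.BlockIndex ≃ ι), ∀ b, L (σ b) = P.block b := by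
  classical
  obtain ⟨a, lam, s, e, h1, h2, h3, h4⟩ := exists_sigma_fin_equiv_sorted
    (X := {i // (L i).IsReal}) (fun i => (L i).re)
    -- Lexicographic order with the sign reversed: sizes increase, and among equal sizes the sign
    -- `1` comes first.
    (fun i => toLex ((L i).size, OrderDual.toDual (L i).sign))
  obtain ⟨b, ab, t, e', h1', h2', h3', h4'⟩ := exists_sigma_fin_equiv_sorted
    (X := {i // ¬ (L i).IsReal}) (fun i => ((L i).re, (L i).im)) (fun i => (L i).size)
  have hr : ∀ i k, L (e ⟨i, k⟩) =
      .real (lam i) (L (e ⟨i, k⟩)).size (L (e ⟨i, k⟩)).sign := by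
    intro i k
    rw [← h3 ⟨i, k⟩]
    exact (e ⟨i, k⟩).2.eq
  have hc : ∀ j l, L (e' ⟨j, l⟩) = .complex (ab j).1 (ab j).2 (L (e' ⟨j, l⟩)).size := by
    intro j l
    rw [← h3' ⟨j, l⟩]
    exact PetrovBlock.eq_complex (e' ⟨j, l⟩).2
  have hvr : ∀ i k, 0 < (L (e ⟨i, k⟩)).size ∧
      ((L (e ⟨i, k⟩)).sign = 1 ∨ (L (e ⟨i, k⟩)).sign = -1) := by
    intro i k
    have := hL (e ⟨i, k⟩)
    rw [hr i k] at this
    exact this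
  have hvc : ∀ j l, 0 < (ab j).2 ∧ 0 < (L (e' ⟨j, l⟩)).size := by
    intro j l
    have := hL (e' ⟨j, l⟩)
    rw [hc j l] at this
    exact this
  let P : PetrovData :=
    { a := a
      b := b
      lam := lam
      alpha := fun j => (ab j).1
      beta := fun j => (ab j).2
      s := s
      t := t
      m := fun i k => (L (e ⟨i, k⟩)).size
      n := fun j l => (L (e' ⟨j, l⟩)).size
      lam_injective := h1
      beta_pos := fun j => (hvc j ⟨0, h2' j⟩).1
      alpha_beta_injective := h1'
      s_pos := h2
      t_pos := h2'
      m_pos := fun i k => (hvr i k).1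
      n_pos := fun j l => (hvc j l).2
      m_mono := fun i k k' h => by
        rcases Prod.Lex.le_iff.1 (h4 i h) with h | h
        · exact le_of_lt h
        · exact le_of_eq h.1
      n_mono := h4'
      eps := fun i k => (L (e ⟨i, k⟩)).sign
      eps_eq := fun i k => (hvr i k).2
      eps_anti := fun i k k' h hm => by
        rcases Prod.Lex.le_iff.1 (h4 i h) with h | h
        · exact absurd hm (ne_of_lt h)
        · exact h.2 }
  refine ⟨P, (Equiv.sumCongr e e').trans (Equiv.sumCompl fun i => (L i).IsReal), ?_⟩
  rintro (⟨i, k⟩ | ⟨j, l⟩)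
  · exact hr i k
  · exact hc j l

/-- Every self-adjoint operator with respect to a non-degenerate symmetric form has a Petrov normal
form. -/
theorem exists_hasPetrovNormalForm [FiniteDimensional ℝ V] (T : End ℝ V)
    (B : LinearMap.BilinForm ℝ V) (hB : ∀ u v, B u v = B v u)
    (hBn : ∀ u, (∀ v, B u v = 0) → u = 0) (hT : ∀ u v, B (T u) v = B u (T v)) :
    ∃ P, HasPetrovNormalForm T B P := by
  obtain ⟨ι, _, _, L, e, hL, h1, h2⟩ := PetrovBlock.exists_basis_blockDiagonal T B hB hBn hT
  obtain ⟨P, σ, hσ⟩ := exists_petrovData L hL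
  exact ⟨P, hasPetrovNormalForm_of_basis σ hσ e h1 h2⟩

end Existence

/-! ### Jordan blocks as shift operators -/

section Shift

open Module

variable {F : Type*} [Field F]

/-- The shift operator `(S u) p = u (p + 1)`. -/
def shiftEnd (F : Type*) [Field F] (m : ℕ) : End F (Fin m → F) where
  toFun u p := if h : (p : ℕ) + 1 < m then u ⟨p + 1, h⟩ else 0
  map_add' u v := by
    funext p
    simp only [Pi.add_apply]
    split_ifs <;> simp
  map_smul' c u := by
    funext p
    simp only [Pi.smul_apply, RingHom.id_apply]
    split_ifs <;> simp

theorem shiftEnd_apply (m : ℕ) (u : Fin m → F) (p : Fin m) :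
    shiftEnd F m u p = if h : (p : ℕ) + 1 < m then u ⟨p + 1, h⟩ else 0 := rfl

theorem shiftEnd_pow_apply (m k : ℕ) (u : Fin m → F) (p : Fin m) :
    (shiftEnd F m ^ k) u p = if h : (p : ℕ) + k < m then u ⟨p + k, h⟩ else 0 := by
  induction k generalizing p with
  | zero => simp
  | succ k ih =>
    rw [pow_succ', Module.End.mul_apply, shiftEnd_apply]
    split_ifs with h1 h2 h2
    · rw [ih, dif_pos (show p + 1 + k < m by omega)]
      congr 2
      show (p : ℕ) + 1 + k = p + (k + 1)
      omega
    · rw [ih, dif_neg (show ¬ (p + 1 + k < m) by omega)]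
    · omega
    · rfl

theorem shiftEnd_pow_eq_zero {m k : ℕ} (h : m ≤ k) : shiftEnd F m ^ k = 0 := by
  refine LinearMap.ext fun u => funext fun p => ?_
  rw [shiftEnd_pow_apply, dif_neg (by omega)]
  rfl

variable {m : ℕ} {P : End F (Fin m → F)} {a d e : F}

/-- With `S` the shift, `a + S (d + e S)` is the common shape of `probe` on all blocks. For `a ≠ 0`
it is a unit plus a commuting nilpotent, hence invertible. -/
theorem eq_zero_of_pow_apply_eq_zero
    (hP : P = a • 1 + shiftEnd F m * (d • 1 + e • shiftEnd F m)) (ha : a ≠ 0) {k : ℕ}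
    {u : Fin m → F} (hu : (P ^ k) u = 0) : u = 0 := by
  have hc : Commute (shiftEnd F m) (d • 1 + e • shiftEnd F m) :=
    ((Commute.one_right _).smul_right d).add_right ((Commute.refl _).smul_right e)
  have hnil : IsNilpotent (shiftEnd F m * (d • 1 + e • shiftEnd F m)) :=
    hc.isNilpotent_mul_right ⟨m, shiftEnd_pow_eq_zero le_rfl⟩
  have hunit : IsUnit P := by
    rw [hP]
    refine hnil.isUnit_add_left_of_commute ?_ ?_
    · exact (isUnit_one (M := End F (Fin m → F))).smul (Units.mk0 a ha)
    · exact (Commute.one_right _).smul_right a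
  obtain ⟨U, hU⟩ := hunit.pow k
  have : (↑U⁻¹ * (U : End F (Fin m → F))) u = 0 := by
    rw [Module.End.mul_apply, hU, hu, map_zero]
  rwa [Units.inv_mul] at this

/-- Here `P = S Q` with `Q = d + e S` invertible and commuting with the shift `S`. So `P^(k+1) u =
0` forces `S^(k+1) u = 0`, and on `S^k u`, which `S` kills, `Q` acts as the scalar `d`. -/
theorem shift_pow_apply_eq_zero (hP : P = shiftEnd F m * (d • 1 + e • shiftEnd F m)) (hd : d ≠ 0)
    {k : ℕ} {u : Fin m → F} (hu : (P ^ (k + 1)) u = 0) :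
    (shiftEnd F m ^ (k + 1)) u = 0 ∧ (P ^ k) u = d ^ k • (shiftEnd F m ^ k) u := by
  set S := shiftEnd F m
  set Q : End F (Fin m → F) := d • 1 + e • S with hQ
  have hc : Commute S Q :=
    ((Commute.one_right _).smul_right d).add_right ((Commute.refl _).smul_right e)
  have hQu : IsUnit Q := by
    have hnil : IsNilpotent (e • S) := IsNilpotent.smul ⟨m, shiftEnd_pow_eq_zero le_rfl⟩ e
    refine hnil.isUnit_add_left_of_commute ?_ ?_
    · exact (isUnit_one (M := End F (Fin m → F))).smul (Units.mk0 d hd)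
    · exact (Commute.one_right _).smul_right d
  have h1 : (S ^ (k + 1)) u = 0 := by
    obtain ⟨U, hU⟩ := hQu.pow (k + 1)
    have h2 : (↑U⁻¹ * ((U : End F (Fin m → F)) * S ^ (k + 1))) u = 0 := by
      rw [hU, ← (hc.pow_pow (k + 1) (k + 1)).eq, ← hc.mul_pow, ← hP, Module.End.mul_apply, hu,
        map_zero]
    rwa [← mul_assoc, Units.inv_mul, one_mul] at h2
  refine ⟨h1, ?_⟩
  have h3 : ∀ j, (Q ^ j) ((S ^ k) u) = d ^ j • (S ^ k) u := by
    intro j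
    induction j with
    | zero => simp
    | succ j ih =>
      have h4 : S ((S ^ k) u) = 0 := by rw [← Module.End.mul_apply, ← pow_succ', h1]
      rw [pow_succ', Module.End.mul_apply, ih, map_smul, hQ]
      simp only [LinearMap.add_apply, LinearMap.smul_apply, Module.End.one_apply, h4, smul_zero,
        add_zero, smul_smul]
      rw [pow_succ]
  rw [hP, hc.mul_pow, (hc.pow_pow k k).eq, Module.End.mul_apply, h3]

/-- By `shift_pow_apply_eq_zero`, `u` lives in the coordinates `0, …, k`, so `S^k u` has only its
coordinate 0, equal to `u_k`. Reversal pairs it with `u_(m-1)`, which vanishes unless `m ≤ k + 1`,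
while `u_k` exists only for `k < m`. Thus only blocks of size exactly `k + 1` contribute, through
one coordinate. -/
theorem sum_pow_apply_mul_rev (hm : 0 < m)
    (hP : P = shiftEnd F m * (d • 1 + e • shiftEnd F m)) (hd : d ≠ 0)
    {k : ℕ} {u : Fin m → F} (hu : (P ^ (k + 1)) u = 0) :
    ∑ p, (P ^ k) u p * u p.rev =
      if m = k + 1 then d ^ k * (u ⟨m - 1, by omega⟩) ^ 2 else 0 := by
  obtain ⟨h1, h2⟩ := shift_pow_apply_eq_zero hP hd hu
  have hz : ∀ p : Fin m, k + 1 ≤ (p : ℕ) → u p = 0 := by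
    intro p hp
    have := congrFun h1 ⟨p - (k + 1), by omega⟩
    rw [shiftEnd_pow_apply, dif_pos (show (p : ℕ) - (k + 1) + (k + 1) < m by omega)] at this
    rw [← this.trans (Pi.zero_apply _)]
    congr 1
    ext
    show (p : ℕ) = p - (k + 1) + (k + 1)
    omega
  rw [h2, Finset.sum_eq_single ⟨0, hm⟩]
  · rw [Pi.smul_apply, shiftEnd_pow_apply, smul_eq_mul]
    have hrev : Fin.rev (⟨0, hm⟩ : Fin m) = ⟨m - 1, by omega⟩ := by
      ext; simp [Fin.val_rev]
    rw [hrev]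
    split_ifs with h3 h4 h4
    · have : (⟨0 + k, h3⟩ : Fin m) = ⟨m - 1, by omega⟩ := by
        ext; show 0 + k = m - 1; omega
      rw [this]; ring
    · rw [hz ⟨m - 1, _⟩ (by show k + 1 ≤ m - 1; simp at h3; omega), mul_zero]
    · simp at h3; omega
    · simp
  · intro p _ hp
    have hp' : (p : ℕ) ≠ 0 := fun h => hp (Fin.ext h)
    rw [Pi.smul_apply, shiftEnd_pow_apply]
    split_ifs with h3
    · rw [hz ⟨p + k, h3⟩ (by show k + 1 ≤ p + k; omega), smul_zero, zero_mul]
    · rw [smul_zero, zero_mul]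
  · simp

theorem pow_apply_eq_zero (hP : P = shiftEnd F m * (d • 1 + e • shiftEnd F m)) (u : Fin m → F) :
    (P ^ m) u = 0 := by
  have hc : Commute (shiftEnd F m) (d • 1 + e • shiftEnd F m) :=
    ((Commute.one_right _).smul_right d).add_right ((Commute.refl _).smul_right e)
  rw [hP, hc.mul_pow, shiftEnd_pow_eq_zero le_rfl, zero_mul]
  rfl

end Shift

/-! ### Real and complex blocks in coordinates. -/

namespace PetrovBlock

open Module

theorem jordanBlock_mulVec (m : ℕ) (lam : ℝ) (u : Fin m → ℝ) :
    (jordanBlock m lam).mulVec u = lam • u + shiftEnd ℝ m u := by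
  funext p
  have h1 : ∀ q : Fin m, jordanBlock m lam p q * u q =
      (if p = q then lam * u q else 0) + (if (p : ℕ) + 1 = q then u q else 0) := by
    intro q
    simp only [jordanBlock, Matrix.of_apply]
    split_ifs with h1 h2 h2
    · subst h1; omega
    · rw [add_zero]
    · rw [one_mul, zero_add]
    · simp
  simp only [Matrix.mulVec, dotProduct, h1, Finset.sum_add_distrib, Finset.sum_ite_eq,
    Finset.mem_univ, if_true, Pi.add_apply, Pi.smul_apply, smul_eq_mul, shiftEnd_apply]
  congr 1
  split_ifs with h
  · rw [Finset.sum_eq_single ⟨p + 1, h⟩]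
    · simp
    · intro q _ hq
      exact if_neg fun h' => hq (Fin.ext h'.symm)
    · simp
  · refine Finset.sum_eq_zero fun q _ => if_neg fun h' => h ?_
    omega

/-- Pairs of real coordinates as complex coordinates. -/
def complexCoord (n : ℕ) : (Fin n × Fin 2 → ℝ) ≃ₗ[ℝ] (Fin n → ℂ) where
  toFun u p := ⟨u (p, 0), u (p, 1)⟩
  invFun z q := if q.2 = 0 then (z q.1).re else (z q.1).im
  map_add' u v := rfl
  map_smul' c u := by funext p; apply Complex.ext <;> simp
  left_inv u := by
    funext ⟨p, i⟩
    obtain rfl | rfl : i = 0 ∨ i = 1 := by omega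
    · rfl
    · rfl
  right_inv z := rfl

@[simp]
theorem complexCoord_apply (n : ℕ) (u : Fin n × Fin 2 → ℝ) (p : Fin n) :
    complexCoord n u p = ⟨u (p, 0), u (p, 1)⟩ := rfl

/-- In complex coordinates a complex block is a single Jordan block with eigenvalue `α + β i`, so
the analysis of the shift over ℂ covers it. -/
theorem complexCoord_complexBlock_mulVec (n : ℕ) (alpha beta : ℝ) (u : Fin n × Fin 2 → ℝ) :
    complexCoord n ((complexBlock n alpha beta).mulVec u) =
      (⟨alpha, beta⟩ : ℂ) • complexCoord n u + shiftEnd ℂ n (complexCoord n u) := by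
  have key : ∀ (p : Fin n) (i : Fin 2), (complexBlock n alpha beta).mulVec u (p, i) =
      ((!![alpha, -beta; beta, alpha] : Matrix (Fin 2) (Fin 2) ℝ) i 0 * u (p, 0) +
        (!![alpha, -beta; beta, alpha] : Matrix (Fin 2) (Fin 2) ℝ) i 1 * u (p, 1)) +
      if h : (p : ℕ) + 1 < n then u (⟨p + 1, h⟩, i) else 0 := by
    intro p i
    have h1 : ∀ q : Fin n, ∑ j, complexBlock n alpha beta (p, i) (q, j) * u (q, j) =
        (if p = q then ∑ j, (!![alpha, -beta; beta, alpha] : Matrix (Fin 2) (Fin 2) ℝ) i j *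
          u (q, j) else 0) + (if (p : ℕ) + 1 = q then u (q, i) else 0) := by
      intro q
      simp only [complexBlock, Matrix.of_apply]
      split_ifs with h1 h2 h2
      · subst h1; omega
      · rw [add_zero]
      · simp [Matrix.one_apply]
      · simp
    simp only [Matrix.mulVec, dotProduct, Fintype.sum_prod_type, h1, Finset.sum_add_distrib,
      Finset.sum_ite_eq, Finset.mem_univ, if_true, Fin.sum_univ_two]
    congr 1
    split_ifs with h
    · rw [Finset.sum_eq_single ⟨p + 1, h⟩]
      · simp
      · intro q _ hq
        exact if_neg fun h' => hq (Fin.ext h'.symm)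
      · simp
    · refine Finset.sum_eq_zero fun q _ => if_neg fun h' => h ?_
      omega
  funext p
  apply Complex.ext
  · refine (key p 0).trans ?_
    simp only [Pi.add_apply, Pi.smul_apply, shiftEnd_apply, complexCoord_apply]
    split_ifs <;> simp <;> ring
  · refine (key p 1).trans ?_
    simp only [Pi.add_apply, Pi.smul_apply, shiftEnd_apply, complexCoord_apply]
    split_ifs <;> simp <;> ring

theorem dotProduct_antiDiagOne (m : ℕ) (c : ℝ) (u v : Fin m → ℝ) :
    u ⬝ᵥ (c • antiDiagOne m).mulVec v = c * ∑ p, u p * v p.rev := by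
  have key : ∀ p, (antiDiagOne m).mulVec v p = v p.rev := by
    intro p
    simp only [Matrix.mulVec, dotProduct, antiDiagOne, Matrix.of_apply, ite_mul, one_mul, zero_mul,
      Finset.sum_ite_eq', Finset.mem_univ, if_true]
  rw [Matrix.smul_mulVec, dotProduct_smul, smul_eq_mul]
  simp only [dotProduct, key]

/-- The entries `-1, 1` are those of `-Re (z w)`, so the form is minus the real part of the complex
anti-diagonal form. -/
theorem dotProduct_complexFormBlock (n : ℕ) (u v : Fin n × Fin 2 → ℝ) :
    u ⬝ᵥ (complexFormBlock n).mulVec v =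
      -(∑ p, complexCoord n u p * complexCoord n v p.rev).re := by
  have key : ∀ p i, (complexFormBlock n).mulVec v (p, i) =
      if i = 0 then -v (p.rev, 0) else v (p.rev, 1) := by
    intro p i
    simp only [Matrix.mulVec, dotProduct, Fintype.sum_prod_type, complexFormBlock, Matrix.of_apply]
    rw [Finset.sum_eq_single p.rev]
    · obtain rfl | rfl : i = 0 ∨ i = 1 := by omega
      · simp
      · simp
    · intro q _ hq
      simp [hq]
    · simp
  simp only [dotProduct, Fintype.sum_prod_type, key, Fin.sum_univ_two, Complex.re_sum,
    Complex.mul_re]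
  rw [← Finset.sum_neg_distrib]
  refine Finset.sum_congr rfl fun p _ => ?_
  simp only [complexCoord_apply, Fin.isValue, if_true, one_ne_zero, if_false]
  ring

end PetrovBlock

/-! ### Detecting a block by the signature of a form -/

namespace PetrovBlock

open Module

/-- A real polynomial in `t` which is nilpotent exactly on the blocks with the eigenvalue of `b`. -/
def probe {R : Type*} [Ring R] [Algebra ℝ R] (t : R) : PetrovBlock → R
  | real lam _ _ => t - lam • (1 : R)
  | complex alpha beta _ => (t - alpha • (1 : R)) ^ 2 + beta ^ 2 • (1 : R)

/-- The sign for which the form `± B(probe ^ (size - 1) u, u)` is positive somewhere on `b`. -/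
def probeSign : PetrovBlock → ℝ
  | real _ _ eps => eps
  | complex _ _ _ => 1

/-- The target may be linear over a larger field, so that complex blocks can be studied with `F =
ℂ`. -/
theorem map_probe {F V W : Type*} [Field F] [Algebra ℝ F] [AddCommGroup V] [Module ℝ V]
    [AddCommGroup W] [Module ℝ W] [Module F W] [IsScalarTower ℝ F W] {T : End ℝ V} {P : End F W}
    (f : V →ₗ[ℝ] W) (h : ∀ v, f (T v) = P (f v)) (b : PetrovBlock) (v : V) :
    f (b.probe T v) = b.probe P (f v) := by
  cases b
  · simp [probe, h]
  · simp [probe, pow_two, h]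

theorem map_probe_pow {F V W : Type*} [Field F] [Algebra ℝ F] [AddCommGroup V] [Module ℝ V]
    [AddCommGroup W] [Module ℝ W] [Module F W] [IsScalarTower ℝ F W] {T : End ℝ V} {P : End F W}
    (f : V →ₗ[ℝ] W) (h : ∀ v, f (T v) = P (f v)) (b : PetrovBlock) (k : ℕ) (v : V) :
    f ((b.probe T ^ k) v) = (b.probe P ^ k) (f v) := by
  induction k generalizing v with
  | zero => rfl
  | succ k ih => rw [pow_succ, pow_succ, Module.End.mul_apply, Module.End.mul_apply, ih,
      map_probe f h]

section Model

variable {F : Type*} [Field F] [Algebra ℝ F] (m : ℕ) (mu : F)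

/-- Brings `probe` to the shape `a + S (d + e S)`, where `a` is the value at `mu` of the polynomial
of the eigenvalue. -/
theorem probe_real (lam : ℝ) (n : ℕ) (eps : ℤ) :
    (real lam n eps).probe (mu • 1 + shiftEnd F m : End F (Fin m → F)) =
      (mu - algebraMap ℝ F lam) • 1 +
        shiftEnd F m * ((1 : F) • 1 + (0 : F) • shiftEnd F m) := by
  rw [probe, ← algebraMap_smul F lam (1 : End F (Fin m → F)), one_smul, zero_smul, add_zero,
    mul_one]
  module

/-- Taylor expansion at `mu` of `q = (X - α)² + β²`: `q(mu + S) = q(mu) + S (q'(mu) + S)`. -/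
theorem probe_complex (alpha beta : ℝ) (n : ℕ) :
    (complex alpha beta n).probe (mu • 1 + shiftEnd F m : End F (Fin m → F)) =
      ((mu - algebraMap ℝ F alpha) ^ 2 + algebraMap ℝ F beta ^ 2) • 1 +
        shiftEnd F m * ((2 * (mu - algebraMap ℝ F alpha)) • 1 + (1 : F) • shiftEnd F m) := by
  rw [probe, ← algebraMap_smul F alpha (1 : End F (Fin m → F)),
    ← algebraMap_smul F (beta ^ 2) (1 : End F (Fin m → F)), map_pow]
  simp only [pow_two, mul_add, add_mul, sub_mul, mul_sub, smul_mul_assoc, mul_smul_comm, one_mul,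
    mul_one]
  module

end Model

/-- The quadratic form `± B(probe ^ (size - 1) u, u)` of the block `b₀`, on the block `b`. -/
def probeForm (b₀ b : PetrovBlock) (u : b.Idx → ℝ) : ℝ :=
  b₀.probeSign * (((b₀.probe (Matrix.toLin' b.op) ^ (b₀.size - 1)) u) ⬝ᵥ b.form.mulVec u)

/-- The generalized eigenspace on which `probeForm` is considered. -/
def probeKer (b₀ b : PetrovBlock) : Submodule ℝ (b.Idx → ℝ) :=
  LinearMap.ker (b₀.probe (Matrix.toLin' b.op) ^ b₀.size)

theorem probeForm_zero (b₀ b : PetrovBlock) : b₀.probeForm b 0 = 0 := by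
  simp [probeForm]

theorem probeForm_smul (b₀ b : PetrovBlock) (c : ℝ) (u : b.Idx → ℝ) :
    b₀.probeForm b (c • u) = c ^ 2 * b₀.probeForm b u := by
  simp only [probeForm, map_smul, Matrix.mulVec_smul, dotProduct_smul, smul_dotProduct, smul_eq_mul]
  ring

/-- The model of a real block. -/
theorem probe_real_pow_apply (b₀ : PetrovBlock) (lam : ℝ) (m : ℕ) (eps : ℤ) (k : ℕ)
    (u : Fin m → ℝ) :
    (b₀.probe (Matrix.toLin' (real lam m eps).op) ^ k) u =
      (b₀.probe (lam • 1 + shiftEnd ℝ m : End ℝ (Fin m → ℝ)) ^ k) u := by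
  refine map_probe_pow (T := Matrix.toLin' (real lam m eps).op) (LinearMap.id) (fun v => ?_) b₀ k u
  exact jordanBlock_mulVec m lam v

/-- The model of a complex block. -/
theorem complexCoord_probe_pow_apply (b₀ : PetrovBlock) (alpha beta : ℝ) (n : ℕ) (k : ℕ)
    (u : Fin n × Fin 2 → ℝ) :
    complexCoord n ((b₀.probe (Matrix.toLin' (complex alpha beta n).op) ^ k) u) =
      (b₀.probe ((⟨alpha, beta⟩ : ℂ) • 1 + shiftEnd ℂ n : End ℂ (Fin n → ℂ)) ^ k)
        (complexCoord n u) := by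
  refine map_probe_pow (T := Matrix.toLin' (complex alpha beta n).op)
    (complexCoord n).toLinearMap (fun v => ?_) b₀ k u
  exact complexCoord_complexBlock_mulVec n alpha beta v

theorem probeForm_real (b₀ : PetrovBlock) (lam : ℝ) (m : ℕ) (eps : ℤ) (u : Fin m → ℝ) :
    b₀.probeForm (real lam m eps) u = b₀.probeSign * (eps * ∑ p,
      (b₀.probe (lam • 1 + shiftEnd ℝ m : End ℝ (Fin m → ℝ)) ^ (b₀.size - 1)) u p * u p.rev) := by
  rw [probeForm, probe_real_pow_apply]
  exact congrArg _ (dotProduct_antiDiagOne m eps _ u)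

theorem probeForm_complex (b₀ : PetrovBlock) (alpha beta : ℝ) (n : ℕ) (u : Fin n × Fin 2 → ℝ) :
    b₀.probeForm (complex alpha beta n) u = b₀.probeSign * -(∑ p,
      (b₀.probe ((⟨alpha, beta⟩ : ℂ) • 1 + shiftEnd ℂ n : End ℂ (Fin n → ℂ)) ^ (b₀.size - 1))
        (complexCoord n u) p * complexCoord n u p.rev).re := by
  rw [← complexCoord_probe_pow_apply]
  exact congrArg _ (dotProduct_complexFormBlock n _ u)

theorem mem_probeKer_real {b₀ : PetrovBlock} {lam : ℝ} {m : ℕ} {eps : ℤ} {u : Fin m → ℝ} :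
    u ∈ b₀.probeKer (real lam m eps) ↔
      (b₀.probe (lam • 1 + shiftEnd ℝ m : End ℝ (Fin m → ℝ)) ^ b₀.size) u = 0 := by
  rw [probeKer, LinearMap.mem_ker, probe_real_pow_apply]

theorem mem_probeKer_complex {b₀ : PetrovBlock} {alpha beta : ℝ} {n : ℕ}
    {u : Fin n × Fin 2 → ℝ} :
    u ∈ b₀.probeKer (complex alpha beta n) ↔
      (b₀.probe ((⟨alpha, beta⟩ : ℂ) • 1 + shiftEnd ℂ n : End ℂ (Fin n → ℂ)) ^ b₀.size)
        (complexCoord n u) = 0 := by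
  rw [probeKer, LinearMap.mem_ker, ← complexCoord_probe_pow_apply]
  exact ((complexCoord n).map_eq_zero_iff).symm

theorem probeForm_real_eq {lam : ℝ} {m k : ℕ} {eps eps₀ : ℤ} (hm : 0 < m) (hk : 0 < k)
    {u : Fin m → ℝ} (hu : u ∈ (real lam k eps₀).probeKer (real lam m eps)) :
    (real lam k eps₀).probeForm (real lam m eps) u =
      if m = k then (eps₀ * eps : ℝ) * u ⟨m - 1, by omega⟩ ^ 2 else 0 := by
  obtain ⟨k, rfl⟩ : ∃ j, k = j + 1 := ⟨k - 1, by omega⟩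
  rw [mem_probeKer_real] at hu
  have hP : (real lam (k + 1) eps₀).probe (lam • 1 + shiftEnd ℝ m : End ℝ (Fin m → ℝ)) =
      shiftEnd ℝ m * ((1 : ℝ) • 1 + (0 : ℝ) • shiftEnd ℝ m) := by
    rw [probe_real]; simp
  rw [probeForm_real]
  have := sum_pow_apply_mul_rev hm hP one_ne_zero (k := k) hu
  have h2 : (real lam (k + 1) eps₀).size - 1 = k := rfl
  rw [h2, this]
  split_ifs
  · simp only [probeSign]; ring
  · simp

theorem probe_complex_self {alpha beta : ℝ} (m k : ℕ) :
    (complex alpha beta k).probe ((⟨alpha, beta⟩ : ℂ) • 1 + shiftEnd ℂ m : End ℂ (Fin m → ℂ)) =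
      shiftEnd ℂ m * ((2 * beta * Complex.I) • 1 + (1 : ℂ) • shiftEnd ℂ m) := by
  have h1 : (⟨alpha, beta⟩ : ℂ) - algebraMap ℝ ℂ alpha = beta * Complex.I := by
    apply Complex.ext <;> simp
  have h2 : (beta * Complex.I) ^ 2 + algebraMap ℝ ℂ beta ^ 2 = 0 := by
    rw [mul_pow, Complex.I_sq, Complex.coe_algebraMap]; ring
  rw [probe_complex, h1, h2, zero_smul, zero_add, mul_assoc]

/-- At `α + β i` the polynomial of the eigenvalue vanishes and has derivative `2 β i ≠ 0`; this
derivative is the `d` of `sum_pow_apply_mul_rev`. -/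
theorem probeForm_complex_eq {alpha beta : ℝ} {m k : ℕ} (hb : 0 < beta) (hm : 0 < m) (hk : 0 < k)
    {u : Fin m × Fin 2 → ℝ} (hu : u ∈ (complex alpha beta k).probeKer (complex alpha beta m)) :
    (complex alpha beta k).probeForm (complex alpha beta m) u =
      if m = k then (-((2 * beta * Complex.I) ^ (m - 1) *
        complexCoord m u ⟨m - 1, by omega⟩ ^ 2)).re else 0 := by
  obtain ⟨k, rfl⟩ : ∃ j, k = j + 1 := ⟨k - 1, by omega⟩
  rw [mem_probeKer_complex] at hu
  have hd : (2 * beta * Complex.I : ℂ) ≠ 0 := by simp [hb.ne']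
  rw [probeForm_complex]
  have := sum_pow_apply_mul_rev hm (probe_complex_self m (k + 1)) hd (k := k) hu
  have h2 : (complex alpha beta (k + 1)).size - 1 = k := rfl
  rw [h2, this]
  split_ifs with h
  · subst h
    simp [probeSign]
  · simp [probeSign]

theorem eq_zero_of_mem_probeKer_complex {b₀ : PetrovBlock} {alpha beta : ℝ} {n : ℕ} {a d e : ℂ}
    (h : b₀.probe ((⟨alpha, beta⟩ : ℂ) • 1 + shiftEnd ℂ n : End ℂ (Fin n → ℂ)) =
      a • 1 + shiftEnd ℂ n * (d • 1 + e • shiftEnd ℂ n)) (ha : a ≠ 0)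
    {u : Fin n × Fin 2 → ℝ} (hu : u ∈ b₀.probeKer (complex alpha beta n)) : u = 0 :=
  (complexCoord n).map_eq_zero_iff.1
    (eq_zero_of_pow_apply_eq_zero h ha (mem_probeKer_complex.1 hu))

/-- The form `probeForm` of `b₀` is nonpositive on every other block. -/
theorem probeForm_nonpos {b₀ b : PetrovBlock} (h₀ : b₀.Valid) (hb : b.Valid) (hne : b ≠ b₀)
    {u : b.Idx → ℝ} (hu : u ∈ b₀.probeKer b) : b₀.probeForm b u ≤ 0 := by
  have hzero : u = 0 → b₀.probeForm b u ≤ 0 := by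
    rintro rfl
    rw [probeForm_zero]
  rcases b with ⟨lam, m, eps⟩ | ⟨alpha, beta, m⟩ <;>
    rcases b₀ with ⟨lam₀, k, eps₀⟩ | ⟨alpha₀, beta₀, k⟩
  · by_cases hl : lam = lam₀
    · subst hl
      rw [probeForm_real_eq hb.1 h₀.1 hu]
      split_ifs with hmk
      -- Blocks with the same eigenvalue and size can differ only in the sign, so the form is minus
      -- a square here.
      · have : (eps₀ * eps : ℝ) = -1 := by
          rcases h₀.2 with h | h <;> rcases hb.2 with h' | h' <;> subst h <;> subst h'
          · exact (hne (by rw [hmk])).elim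
          · norm_num
          · norm_num
          · exact (hne (by rw [hmk])).elim
        rw [this]
        nlinarith [sq_nonneg (u ⟨m - 1, by have := hb.1; omega⟩)]
      · exact le_rfl
    · exact hzero (eq_zero_of_pow_apply_eq_zero (probe_real m lam lam₀ k eps₀)
        (sub_ne_zero.2 hl) (mem_probeKer_real.1 hu))
  · refine hzero (eq_zero_of_pow_apply_eq_zero (probe_complex m lam alpha₀ beta₀ k)
      ?_ (mem_probeKer_real.1 hu))
    have := h₀.1
    simp only [Algebra.algebraMap_self, RingHom.id_apply]
    positivity
  · suffices ha : ((⟨alpha, beta⟩ : ℂ) - algebraMap ℝ ℂ lam₀) ≠ 0 by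
      have h := probe_real m (⟨alpha, beta⟩ : ℂ) lam₀ k eps₀
      exact hzero (eq_zero_of_mem_probeKer_complex h ha hu)
    intro h
    have := congrArg Complex.im h
    simp at this
    exact hb.1.ne' this
  · by_cases hl : alpha = alpha₀ ∧ beta = beta₀
    · obtain ⟨rfl, rfl⟩ := hl
      rw [probeForm_complex_eq hb.1 hb.2 h₀.2 hu, if_neg]
      rintro rfl
      exact hne rfl
    · suffices ha : (((⟨alpha, beta⟩ : ℂ) - algebraMap ℝ ℂ alpha₀) ^ 2 +
        algebraMap ℝ ℂ beta₀ ^ 2) ≠ 0 by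
        have h := probe_complex m (⟨alpha, beta⟩ : ℂ) alpha₀ beta₀ k
        exact hzero (eq_zero_of_mem_probeKer_complex h ha hu)
      -- The imaginary part `2 (α - α₀) β = 0` gives `α = α₀`, and then the real part gives `β² =
      -- β₀²`, with both positive.
      intro h
      have h1 := congrArg Complex.re h
      have h2 := congrArg Complex.im h
      simp [pow_two] at h1 h2
      have hb1 := hb.1
      have hb2 := h₀.1
      have ha : alpha = alpha₀ := by
        rcases mul_eq_zero.1 (show (alpha - alpha₀) * beta = 0 by linarith) with h | h
        · linarith
        · exact (hb1.ne' h).elim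
      subst ha
      exact hl ⟨rfl, by nlinarith⟩

/-- Only the last coordinate matters. For a real block it is 1, and the sign of the block cancels
the sign in `probeForm`. For a complex block it is a `z` with `z² = -1/(2 β i)^(m-1)`, which makes
the value 1. -/
theorem exists_probeForm_pos {b : PetrovBlock} (hb : b.Valid) :
    ∃ u ∈ b.probeKer b, 0 < b.probeForm b u := by
  rcases b with ⟨lam, m, eps⟩ | ⟨alpha, beta, m⟩
  · have hu : (fun _ => 1 : Fin m → ℝ) ∈ (real lam m eps).probeKer (real lam m eps) := by
      rw [mem_probeKer_real]
      refine pow_apply_eq_zero (d := 1) (e := 0) ?_ _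
      rw [probe_real]; simp
    refine ⟨_, hu, ?_⟩
    rw [probeForm_real_eq hb.1 hb.1 hu, if_pos rfl]
    rcases hb.2 with h | h <;> simp [h]
  · obtain ⟨z, hz⟩ := IsAlgClosed.exists_pow_nat_eq
      (-(1 / (2 * beta * Complex.I) ^ (m - 1)) : ℂ) (n := 2) (by norm_num)
    have hu : (complexCoord m).symm (fun _ => z) ∈
        (complex alpha beta m).probeKer (complex alpha beta m) := by
      rw [mem_probeKer_complex]
      exact pow_apply_eq_zero (probe_complex_self m m) _
    refine ⟨_, hu, ?_⟩
    have hd : (2 * beta * Complex.I : ℂ) ≠ 0 := by simp [hb.1.ne']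
    rw [probeForm_complex_eq hb.1 hb.2 hb.2 hu, if_pos rfl, LinearEquiv.apply_symm_apply, hz,
      mul_neg, mul_one_div_cancel (pow_ne_zero _ hd)]
    simp

/-- The positive index on one block is at most 1. For a complex block the form is `Re ((z u)²)`,
with `u` the last coordinate and `z² = -(2 β i)^(m-1)`; where `Re (z u) = 0` it equals `-(Im (z
u))²`. -/
theorem exists_dual_probeForm_nonpos {b : PetrovBlock} (hb : b.Valid) :
    ∃ φ : Dual ℝ (b.Idx → ℝ), ∀ u ∈ b.probeKer b, φ u = 0 → b.probeForm b u ≤ 0 := by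
  rcases b with ⟨lam, m, eps⟩ | ⟨alpha, beta, m⟩
  · refine ⟨LinearMap.proj (⟨m - 1, by have := hb.1; omega⟩ : Fin m), fun u hu h => ?_⟩
    rw [probeForm_real_eq hb.1 hb.1 hu, if_pos rfl]
    have h' : u ⟨m - 1, by have := hb.1; omega⟩ = 0 := h
    rw [h']
    simp
  · obtain ⟨z, hz⟩ := IsAlgClosed.exists_pow_nat_eq
      (-((2 * beta * Complex.I) ^ (m - 1)) : ℂ) (n := 2) (by norm_num)
    refine ⟨Complex.reLm ∘ₗ LinearMap.mulLeft ℝ z ∘ₗ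
      LinearMap.proj (⟨m - 1, by have := hb.2; omega⟩ : Fin m) ∘ₗ (complexCoord m).toLinearMap,
      fun u hu h => ?_⟩
    rw [probeForm_complex_eq hb.1 hb.2 hb.2 hu, if_pos rfl, ← neg_mul, ← hz, ← mul_pow]
    have h' : (z * complexCoord m u ⟨m - 1, by have := hb.2; omega⟩).re = 0 := h
    rw [pow_two, Complex.mul_re, h']
    nlinarith [sq_nonneg (z * complexCoord m u ⟨m - 1, by have := hb.2; omega⟩).im]

end PetrovBlock

/-! ### Uniqueness of the Petrov normal form -/

section Uniqueness

open Module

/-- The inequality behind the law of inertia: a space on which `h` is positive meets the common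
kernel of the `φ r` only in 0, so these functionals are jointly injective on it. -/
theorem card_le_card_of_definite {V : Type*} [AddCommGroup V] [Module ℝ V] (h : V → ℝ)
    (U : Submodule ℝ V) {R R' : Type*} [Fintype R] [Fintype R'] (w : (R → ℝ) →ₗ[ℝ] V)
    (hw : ∀ c, c ≠ 0 → w c ∈ U ∧ 0 < h (w c)) (φ : R' → Dual ℝ V)
    (hφ : ∀ v ∈ U, (∀ r, φ r v = 0) → h v ≤ 0) : Fintype.card R ≤ Fintype.card R' := by
  have hinj : Function.Injective (LinearMap.pi φ ∘ₗ w) := by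
    rw [← LinearMap.ker_eq_bot, LinearMap.ker_eq_bot']
    intro c hc
    by_contra hne
    obtain ⟨h1, h2⟩ := hw c hne
    exact absurd (hφ _ h1 fun r => congrFun hc r) (not_le.2 h2)
  simpa using LinearMap.finrank_le_finrank_of_injective hinj

variable {V : Type*} [AddCommGroup V] [Module ℝ V]

theorem Matrix.blockDiagonal'_mulVec_apply {ι : Type*} [Fintype ι] [DecidableEq ι]
    {m : ι → Type*} [∀ i, Fintype (m i)] (D : (i : ι) → Matrix (m i) (m i) ℝ)
    (v : (Σ i, m i) → ℝ) (i : ι) (p : m i) :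
    (Matrix.blockDiagonal' D).mulVec v ⟨i, p⟩ = (D i).mulVec (fun q => v ⟨i, q⟩) p := by
  simp only [Matrix.mulVec, dotProduct, Fintype.sum_sigma]
  rw [Finset.sum_eq_single i]
  · simp only [Matrix.blockDiagonal'_apply_eq]
  · intro j _ hj
    exact Finset.sum_eq_zero fun q _ => by
      rw [Matrix.blockDiagonal'_apply_ne _ _ _ hj.symm, zero_mul]
  · simp

/-- The coordinates in the blocks of a basis. -/
noncomputable def blockCoord {ι : Type*} [Fintype ι] {L : ι → PetrovBlock} (e : Basis (Σ i, (L i).Idx) ℝ V) :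
    V ≃ₗ[ℝ] ((i : ι) → (L i).Idx → ℝ) :=
  e.equivFun.trans (LinearEquiv.piCurry ℝ fun i (_ : (L i).Idx) => ℝ)

variable {T : End ℝ V} {B : LinearMap.BilinForm ℝ V}

/-- The quadratic form whose signature counts the blocks equal to `b₀`. -/
def countForm (T : End ℝ V) (B : LinearMap.BilinForm ℝ V) (b₀ : PetrovBlock) (v : V) : ℝ :=
  b₀.probeSign * B ((b₀.probe T ^ (b₀.size - 1)) v) v

section

variable {ι : Type*} [Fintype ι] [DecidableEq ι] {L : ι → PetrovBlock}
  {e : Basis (Σ i, (L i).Idx) ℝ V}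

theorem blockCoord_probe_pow
    (hT : LinearMap.toMatrix e e T = Matrix.blockDiagonal' (fun i => (L i).op))
    (b₀ : PetrovBlock) (k : ℕ) (v : V) (i : ι) :
    blockCoord e ((b₀.probe T ^ k) v) i =
      (b₀.probe (Matrix.toLin' (L i).op) ^ k) (blockCoord e v i) := by
  refine PetrovBlock.map_probe_pow (F := ℝ) (P := Matrix.toLin' (L i).op)
    (LinearMap.proj i ∘ₗ (blockCoord e).toLinearMap)
    (fun v => ?_) b₀ k v
  funext p
  have h := congrFun (LinearMap.toMatrix_mulVec_repr e e T v) ⟨i, p⟩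
  rw [hT, Matrix.blockDiagonal'_mulVec_apply] at h
  exact h.symm

theorem bilin_eq_sum_blockCoord
    (hB : LinearMap.BilinForm.toMatrix e B = Matrix.blockDiagonal' (fun i => (L i).form))
    (u v : V) :
    B u v = ∑ i, blockCoord e u i ⬝ᵥ (L i).form.mulVec (blockCoord e v i) := by
  rw [LinearMap.BilinForm.apply_eq_dotProduct_toMatrix_mulVec e B, hB, dotProduct,
    Fintype.sum_sigma]
  refine Finset.sum_congr rfl fun i _ => Finset.sum_congr rfl fun p _ => ?_
  rw [Matrix.blockDiagonal'_mulVec_apply]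
  rfl

theorem countForm_eq_sum
    (hT : LinearMap.toMatrix e e T = Matrix.blockDiagonal' (fun i => (L i).op))
    (hB : LinearMap.BilinForm.toMatrix e B = Matrix.blockDiagonal' (fun i => (L i).form))
    (b₀ : PetrovBlock) (v : V) :
    countForm T B b₀ v = ∑ i, b₀.probeForm (L i) (blockCoord e v i) := by
  rw [countForm, bilin_eq_sum_blockCoord hB, Finset.mul_sum]
  refine Finset.sum_congr rfl fun i _ => ?_
  rw [blockCoord_probe_pow hT, PetrovBlock.probeForm]

theorem mem_ker_probe_pow_iff
    (hT : LinearMap.toMatrix e e T = Matrix.blockDiagonal' (fun i => (L i).op))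
    (b₀ : PetrovBlock) (v : V) :
    v ∈ LinearMap.ker (b₀.probe T ^ b₀.size) ↔
      ∀ i, blockCoord e v i ∈ b₀.probeKer (L i) := by
  rw [LinearMap.mem_ker, ← (blockCoord e).map_eq_zero_iff, funext_iff]
  refine forall_congr' fun i => ?_
  rw [blockCoord_probe_pow hT, PetrovBlock.probeKer, LinearMap.mem_ker]
  rfl

end

/-- On the generalized kernel, `countForm` is the sum of the `probeForm` of the blocks. In the basis
`e` each block equal to `b₀` supplies a positive direction. In `e'` the form is nonpositive once one
functional for each such block vanishes. -/
theorem card_blocks_le {ι ι' : Type*} [Fintype ι] [DecidableEq ι] [Fintype ι'] [DecidableEq ι']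
    {L : ι → PetrovBlock} {L' : ι' → PetrovBlock}
    (e : Basis (Σ i, (L i).Idx) ℝ V) (e' : Basis (Σ i, (L' i).Idx) ℝ V)
    (hT : LinearMap.toMatrix e e T = Matrix.blockDiagonal' (fun i => (L i).op))
    (hB : LinearMap.BilinForm.toMatrix e B = Matrix.blockDiagonal' (fun i => (L i).form))
    (hT' : LinearMap.toMatrix e' e' T = Matrix.blockDiagonal' (fun i => (L' i).op))
    (hB' : LinearMap.BilinForm.toMatrix e' B = Matrix.blockDiagonal' (fun i => (L' i).form))
    (hL' : ∀ i, (L' i).Valid) {b₀ : PetrovBlock} (h₀ : b₀.Valid) :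
    Nat.card {i // L i = b₀} ≤ Nat.card {i // L' i = b₀} := by
  classical
  -- Putting `L i = b₀` inside the existential lets vectors be chosen for all `i`, without transport
  -- along that equality.
  have hpos : ∀ i, ∃ u : (L i).Idx → ℝ,
      L i = b₀ → u ∈ b₀.probeKer (L i) ∧ 0 < b₀.probeForm (L i) u := by
    intro i
    by_cases h : L i = b₀
    · obtain ⟨u, h1, h2⟩ := PetrovBlock.exists_probeForm_pos (b := L i) (h ▸ h₀)
      rw [← h]
      exact ⟨u, fun _ => ⟨h1, h2⟩⟩
    · exact ⟨0, fun h' => (h h').elim⟩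
  have hdual : ∀ i, ∃ φ : Dual ℝ ((L' i).Idx → ℝ), L' i = b₀ →
      ∀ u ∈ b₀.probeKer (L' i), φ u = 0 → b₀.probeForm (L' i) u ≤ 0 := by
    intro i
    by_cases h : L' i = b₀
    · obtain ⟨φ, h1⟩ := PetrovBlock.exists_dual_probeForm_nonpos (b := L' i) (h ▸ h₀)
      rw [← h]
      exact ⟨φ, fun _ => h1⟩
    · exact ⟨0, fun h' => (h h').elim⟩
  choose u hu using hpos
  choose φ hφ using hdual
  let g : ({i // L i = b₀} → ℝ) →ₗ[ℝ] ((i : ι) → (L i).Idx → ℝ) :=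
    LinearMap.pi fun i => if h : L i = b₀ then
      (LinearMap.proj (⟨i, h⟩ : {i // L i = b₀})).smulRight (u i) else 0
  have hg1 : ∀ c (i : ι) (h : L i = b₀), g c i = c ⟨i, h⟩ • u i := by
    intro c i h
    simp [g, h]
  have hg2 : ∀ c (i : ι), ¬ L i = b₀ → g c i = 0 := by
    intro c i h
    simp [g, h]
  rw [Nat.card_eq_fintype_card, Nat.card_eq_fintype_card]
  refine card_le_card_of_definite (countForm T B b₀) (LinearMap.ker (b₀.probe T ^ b₀.size))
    ((blockCoord e).symm.toLinearMap ∘ₗ g) (fun c hc => ⟨?_, ?_⟩)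
    (fun i => φ i ∘ₗ LinearMap.proj (i : ι') ∘ₗ (blockCoord e').toLinearMap) fun v hv hv0 => ?_
  · rw [mem_ker_probe_pow_iff hT]
    intro i
    show blockCoord e ((blockCoord e).symm (g c)) i ∈ _
    rw [LinearEquiv.apply_symm_apply]
    by_cases h : L i = b₀
    · rw [hg1 c i h]
      exact Submodule.smul_mem _ _ (hu i h).1
    · rw [hg2 c i h]
      exact Submodule.zero_mem _
  · rw [countForm_eq_sum hT hB]
    have hval : ∀ i, 0 ≤ b₀.probeForm (L i) (g c i) ∧
        ∀ h : L i = b₀, c ⟨i, h⟩ ≠ 0 → 0 < b₀.probeForm (L i) (g c i) := by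
      intro i
      by_cases h : L i = b₀
      · rw [hg1 c i h, PetrovBlock.probeForm_smul]
        have := (hu i h).2
        exact ⟨by positivity, fun _ h' => by positivity⟩
      · rw [hg2 c i h, PetrovBlock.probeForm_zero]
        exact ⟨le_rfl, fun h' => (h h').elim⟩
    obtain ⟨⟨i, hi⟩, hci⟩ := Function.ne_iff.1 hc
    have := Finset.sum_pos' (s := Finset.univ) (f := fun i => b₀.probeForm (L i) (g c i))
      (fun i _ => (hval i).1) ⟨i, Finset.mem_univ _, (hval i).2 hi hci⟩
    refine this.trans_eq (Finset.sum_congr rfl fun i _ => ?_)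
    show _ = b₀.probeForm (L i) (blockCoord e ((blockCoord e).symm (g c)) i)
    rw [LinearEquiv.apply_symm_apply]
  · rw [mem_ker_probe_pow_iff hT'] at hv
    rw [countForm_eq_sum hT' hB']
    refine Finset.sum_nonpos fun i _ => ?_
    by_cases h : L' i = b₀
    · exact hφ i h _ (hv i) (hv0 ⟨i, h⟩)
    · exact PetrovBlock.probeForm_nonpos h₀ (hL' i) h (hv i)

theorem Multiset.count_map_univ_eq_natCard {X A : Type*} [Fintype X] [DecidableEq A] (f : X → A)
    (a : A) : (Finset.univ.val.map f).count a = Nat.card {x // f x = a} := by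
  classical
  rw [Multiset.count_map, Nat.card_eq_fintype_card, Fintype.card_subtype, Finset.card_def,
    Finset.filter_val]
  simp only [eq_comm]

namespace PetrovData

theorem natCard_block_real (P : PetrovData) (lam : ℝ) (m : ℕ) (eps : ℤ) :
    Nat.card {b // P.block b = .real lam m eps} =
      Nat.card {q : Σ i : Fin P.a, Fin (P.s i) //
        (P.lam q.1, P.m q.1 q.2, P.eps q.1 q.2) = (lam, m, eps)} := by
  refine (Nat.card_congr
    { toFun := fun q => ⟨Sum.inl q.1, by
        have := q.2; simp only [Prod.mk.injEq] at this; simp [this]⟩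
      invFun := fun b => match b with
        | ⟨Sum.inl q, h⟩ => ⟨q, by simpa using h⟩
        | ⟨Sum.inr q, h⟩ => by cases h
      left_inv := fun q => rfl
      right_inv := ?_ }).symm
  rintro ⟨q | q, h⟩
  · rfl
  · cases h

theorem natCard_block_complex (P : PetrovData) (z : ℂ) (n : ℕ) :
    Nat.card {b // P.block b = .complex z.re z.im n} =
      Nat.card {q : Σ j : Fin P.b, Fin (P.t j) //
        ((⟨P.alpha q.1, P.beta q.1⟩, P.n q.1 q.2) : ℂ × ℕ) = (z, n)} := by
  refine (Nat.card_congr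
    { toFun := fun q => ⟨Sum.inr q.1, by
        have := q.2; simp only [Prod.mk.injEq, Complex.ext_iff] at this; simp [this]⟩
      invFun := fun b => match b with
        | ⟨Sum.inr q, h⟩ => ⟨q, by simpa [Complex.ext_iff, and_assoc] using h⟩
        | ⟨Sum.inl q, h⟩ => by cases h
      left_inv := fun q => rfl
      right_inv := ?_ }).symm
  rintro ⟨q | q, h⟩
  · cases h
  · rfl

end PetrovData

/-- The blocks of a Petrov normal form are determined by the operator and the form. -/
theorem HasPetrovNormalForm.blocks_eq {P Q : PetrovData} (hP : HasPetrovNormalForm T B P)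
    (hQ : HasPetrovNormalForm T B Q) :
    P.realBlocks = Q.realBlocks ∧ P.complexBlocks = Q.complexBlocks := by
  classical
  obtain ⟨e, h1, h2⟩ := hP.exists_basis
  obtain ⟨e', h1', h2'⟩ := hQ.exists_basis
  -- A `b₀` that is not valid occurs in neither normal form, so both counts are zero.
  have key : ∀ b₀ : PetrovBlock,
      Nat.card {b // P.block b = b₀} = Nat.card {b // Q.block b = b₀} := by
    intro b₀
    by_cases h₀ : b₀.Valid
    · exact le_antisymm (card_blocks_le e e' h1 h2 h1' h2' Q.block_valid h₀)
        (card_blocks_le e' e h1' h2' h1 h2 P.block_valid h₀)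
    · have : IsEmpty {b // P.block b = b₀} := ⟨fun b => h₀ (b.2 ▸ P.block_valid b)⟩
      have : IsEmpty {b // Q.block b = b₀} := ⟨fun b => h₀ (b.2 ▸ Q.block_valid b)⟩
      rw [Nat.card_of_isEmpty, Nat.card_of_isEmpty]
  constructor
  · refine Multiset.ext.2 fun ⟨lam, m, eps⟩ => ?_
    rw [PetrovData.realBlocks, PetrovData.realBlocks, Multiset.count_map_univ_eq_natCard,
      Multiset.count_map_univ_eq_natCard, ← PetrovData.natCard_block_real,
      ← PetrovData.natCard_block_real, key]
  · refine Multiset.ext.2 fun ⟨z, n⟩ => ?_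
    rw [PetrovData.complexBlocks, PetrovData.complexBlocks, Multiset.count_map_univ_eq_natCard,
      Multiset.count_map_univ_eq_natCard, ← PetrovData.natCard_block_complex,
      ← PetrovData.natCard_block_complex, key]

end Uniqueness

/-! ### The theorem on hypersurfaces. -/

theorem proposition3p4 (K : SpaceFormKind) (n s : ℕ) (hn : 0 < n) (hs : s ≤ n + 1)
    (M : Type*) [TopologicalSpace M] [ChartedSpace (EuclideanSpace ℝ (Fin n)) M]
    [IsManifold (𝓡 n) ∞ M] [ConnectedSpace M]
    (S : NondegHypersurface K n s M)
    (hJ : ∃ D : JordanData, ∀ x : M, HasJordanNormalForm (S.shapeOperator x) D) :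
    (∀ x : M, ∃ (P : PetrovData) (U : Set M)
        (e : P.FrameIndex → (y : M) → TangentSpace (𝓡 n) y)
        (he : IsLocalFrameOn (𝓡 n) (EuclideanSpace ℝ (Fin n)) ∞ e U),
      IsOpen U ∧ x ∈ U ∧
        ∀ (y : M) (hy : y ∈ U),
          IsPetrovBasis (S.shapeOperator y) (S.metric y) P (he.toBasisAt hy)) ∧
    (∃ τ : Multiset (ℕ × ℤ) × Multiset ℕ, ∀ (x : M) (P : PetrovData),
      HasPetrovNormalForm (S.shapeOperator x) (S.metric x) P → P.algebraicType = τ) ∧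
    (∀ (x y : M) (P Q : PetrovData),
      HasPetrovNormalForm (S.shapeOperator x) (S.metric x) P →
      HasPetrovNormalForm (S.shapeOperator y) (S.metric y) Q →
        P.realBlocks = Q.realBlocks ∧ P.complexBlocks = Q.complexBlocks) := by
  obtain ⟨D, hD⟩ := hJ
  have hex : ∀ x, ∃ P, HasPetrovNormalForm (S.shapeOperator x) (S.metric x) P := fun x =>
    have : FiniteDimensional ℝ (TangentSpace (𝓡 n) x) :=
      inferInstanceAs (FiniteDimensional ℝ (EuclideanSpace ℝ (Fin n)))
    exists_hasPetrovNormalForm _ _ (S.metric_comm x) (fun _ h => S.metric_eq_zero h)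
      (S.metric_shapeOperator_comm x)
  choose P hP using hex
  -- Near `x` the smooth frame exhibits `P x` as a normal form at `y` too, and uniqueness compares
  -- it with the chosen `P y`. The data `P` themselves may vary by reordering eigenvalues, hence the
  -- multisets.
  have hloc : IsLocallyConstant fun x => ((P x).realBlocks, (P x).complexBlocks) := by
    refine (IsLocallyConstant.iff_exists_open _).2 fun x => ?_
    obtain ⟨U, e, he, hU, hx, h⟩ := S.exists_isLocalFrameOn_isPetrovBasis hD (hP x)
    exact ⟨U, hU, hx, fun y hy => Prod.ext_iff.2 ((hP y).blocks_eq ⟨_, h y hy⟩)⟩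
  have hconst : ∀ (x y : M) (Q R : PetrovData),
      HasPetrovNormalForm (S.shapeOperator x) (S.metric x) Q →
      HasPetrovNormalForm (S.shapeOperator y) (S.metric y) R →
        Q.realBlocks = R.realBlocks ∧ Q.complexBlocks = R.complexBlocks := by
    intro x y Q R hQ hR
    have h1 := hQ.blocks_eq (hP x)
    have h2 := (hP y).blocks_eq hR
    have h3 := Prod.ext_iff.1 (hloc.apply_eq_of_preconnectedSpace x y)
    exact ⟨h1.1.trans (h3.1.trans h2.1), h1.2.trans (h3.2.trans h2.2)⟩
  refine ⟨fun x => ?_, ?_, hconst⟩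
  · obtain ⟨U, e, he, h⟩ := S.exists_isLocalFrameOn_isPetrovBasis hD (hP x)
    exact ⟨P x, U, e, he, h⟩
  · obtain ⟨x₀⟩ : Nonempty M := inferInstance
    refine ⟨(P x₀).algebraicType, fun x Q hQ => ?_⟩
    obtain ⟨h1, h2⟩ := hconst x x₀ Q (P x₀) hQ (hP x₀)
    rw [PetrovData.algebraicType, PetrovData.algebraicType, h1, h2]
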